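/- **Setting.** Let $\mathcal M=(\mathcal S,\mathcal A,H,\{r_h\},\{\mathbb P_h\})$ be an episodic MDP with horizon $H\ge 1$, measurable state space $\mathcal S$, finite nonempty action set $\mathcal A$, rewards $r_h:\mathcal S\times\mathcal A\to[0,1]$ and transition kernels $\mathbb P_h$. Write $z=(s,a)$, let $V_h^\pi$ and $V_h^*=\sup_\pi V^\pi_h$ be the value functions, with $V^*_{H+1}=0$, and let $\pi^*$ be an optimal policy. Put $[\mathcal T_hV](z)=\mathbb E_{s'\sim\mathbb P_h(\cdot|z)}[r_h(z)+V(s')]$, $[\mathcal T_{2,h}V](z)=\mathbb E_{s'\sim\mathbb P_h(\cdot|z)}[(r_h(z)+V(s'))^2]$ and $[\mathbb V_hV^*_{h+1}](z)=\max\{1,\mathrm{Var}_{s'\sim\mathbb P_h(\cdot|z)}V^*_{h+1}(s')\}$. For functions $f(s,a)$ write $f(s)=\max_a f(s,a)$; $\{x\}_{[0,b]}$ is truncation to $[0,b]$. Let $\mathcal F_h$ ($h\in[H]$) be finite classes of measurable functions $\mathcal S\times\mathcal A\to[0,L]$, let $\mathcal N=\max_h|\mathcal F_h|\ge 2$, and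 let $\mathcal W$ be a finite class of measurable functions with $\mathcal N_b=|\mathcal W|$. Two datasets $\mathcal D=\{(s_h^k,a_h^k,r_h^k)\}$ and $\bar{\mathcal D}=\{(\bar s_h^k,\bar a_h^k,\bar r_h^k)\}$ of $K$ episodes each consist of $2K$ independent episodes generated by a behavior policy $\mu$ from an arbitrary initial distribution; $d_h^\mu$ is the law of the stage-$h$ pair. For $\lambda\ge 0$ and $\sigma>0$ let $$D^2_{\mathcal F_h}(z;\mathcal D_h;\sigma)=\sup_{f_1,f_2\in\mathcal F_h}\frac{(f_1(z)-f_2(z))^2}{\sum_{k\in[K]}\sigma(z_h^k)^{-2}(f_1(z_h^k)-f_2(z_h^k))^2+\lambda}.$$ **Assumptions.** (i) *Uniform coverage*: $\kappa>0$ and $\mathbb E_{d^\mu_h}[(f_1-f_2)^2]\ge\kappa\|f_1-f_2\|_\infty^2$ for all $h$ and $f_1,f_2\in\mathcal F_h$. (ii) *$\epsilon$-completeness*: for all $h$ and all measurable $V:\mathcal S\to[0,H]$ there are $f,f_2\in\mathcal F_h$ with $\|f-\mathcal T_hV\|_\infty\le\epsilon$ and $\|f_2-\mathcal T_{2,h}V\|_\infty\le\epsilon$,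 where $0<\epsilon\le 1/\sqrt K$. (iii) *Bonus oracle*: for a constant $0<C<\infty$, when called at stage $h$ with a dataset, a variance function $\sigma$, a function $f_0\in\mathcal F_h$ and a parameter $\beta$, the oracle returns some $b\in\mathcal W$ with $b(z)\ge|f(z)-f_0(z)|$ for all $z$ and all $f\in\mathcal F_h$ satisfying $\sum_k\sigma(z_h^k)^{-2}(f(z_h^k)-f_0(z_h^k))^2\le\beta^2$, and with $b(z)\le C\big(D_{\mathcal F_h}(z;\mathcal D_h;\sigma)\sqrt{\beta^2+\lambda}+\epsilon\beta\big)$ for all $z$. **Algorithm (PNLSVI).** Set $\check f_{H+1}=\hat f_{H+1}=0$. For $h=H,\dots,1$, using $\bar{\mathcal D}$: let $\bar f_h$ and $\bar g_h$ be minimizers over $\mathcal F_h$ of $\sum_k(f(\bar z_h^k)-\bar r_h^k-\check f_{h+1}(\bar s_{h+1}^k))^2$ and of $\sum_k(g(\bar z_h^k)-(\bar r_h^k+\check f_{h+1}(\bar s_{h+1}^k))^2)^2$; get $\bar b_h$ from the oracle with $\sigma=1$, $f_0=\bar f_h$ and parameter $\bar\beta_h$; set $\check f_h=\{\bar f_h-\bar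 b_h-\epsilon\}_{[0,H-h+1]}$ and $\hat\sigma_h^2=\max\{1,\bar g_h-\bar f_h^2-c_\sigma\sqrt{\ell\log(\mathcal N\mathcal N_b)}\,H^3/\sqrt{K\kappa}\}$. Then for $h=H,\dots,1$, using $\mathcal D$: let $\tilde f_h$ be a minimizer over $\mathcal F_h$ of $\sum_k\hat\sigma_h(z_h^k)^{-2}(f(z_h^k)-r_h^k-\hat f_{h+1}(s_{h+1}^k))^2$; get $b_h$ from the oracle with $\sigma=\hat\sigma_h$, $f_0=\tilde f_h$ and parameter $\beta_h$; set $\hat f_h=\{\tilde f_h-b_h-\epsilon\}_{[0,H-h+1]}$, and let $\hat\pi_h(\cdot|s)$ play only maximizers of $\hat f_h(s,\cdot)$. Ties and oracle answers are arbitrary. **Theorem 1.** For every $C>0$ and $\lambda\ge0$ there are constants $c_K,c_{\bar\beta},c_\sigma,c_\beta,c>0$, depending only on $C$ and $\lambda$, such that the following holds for every such problem and every $\delta\in(0,1)$, with the logarithmic factor $\ell=\log(eHK/\delta)$. If $$K\ \ge\ c_K\,\ell\,\frac{\log(\mathcal N\cdot\mathcal N_b)\,H^6}{\kappa^2},$$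 $c_{\bar\beta}\sqrt{\ell\log(\mathcal N\mathcal N_b)}\,H\le\bar\beta_h\le c_{\bar\beta}\sqrt{\ell\log(\mathcal N\mathcal N_b)}\,H^2$ and $\beta_h=c_\beta\sqrt{\ell\log\mathcal N}$ for all $h\in[H]$, then with probability at least $1-\delta$ every output policy $\hat\pi$ of PNLSVI satisfies, for every $s\in\mathcal S$, $$V_1^*(s)-V_1^{\hat\pi}(s)\ \le\ c\,\sqrt{\ell\,\log\mathcal N}\;\sum_{h=1}^H\mathbb E_{\pi^*}\Big[D_{\mathcal F_h}\big(z_h;\mathcal D_h;\sigma_h^*\big)\,\Big|\,s_1=s\Big],\qquad \sigma_h^*=\sqrt{[\mathbb V_hV^*_{h+1}]},$$ that is, the squared differences at $z_h^k$ in the denominator of the divergence are weighted by $1/[\mathbb V_hV^*_{h+1}](z_h^k)$. -/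

import Mathlib

open MeasureTheory ProbabilityTheory

universe u v w

noncomputable section

namespace OfflineRL

/-- An inhomogeneous episodic Markov decision process with horizon `H`. Stages are numbered from
`0`, so stage `h` here is stage `h + 1` of the usual `1`-based numbering; only the rewards and
transitions of the stages `h < H` matter for anything below. -/
structure MDP (S : Type u) (A : Type v) [MeasurableSpace S] [MeasurableSpace A] (H : ℕ) where
  /-- the reward function of stage `h` -/
  r : ℕ → S × A → ℝ
  measurable_r : ∀ h, Measurable (r h)
  r_mem : ∀ h z, r h z ∈ Set.Icc (0 : ℝ) 1
  /-- the transition kernel of stage `h` -/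
  P : ℕ → Kernel (S × A) S
  markov : ∀ h, IsMarkovKernel (P h)

attribute [instance] MDP.markov

/-- A (randomized, Markov) policy: at every stage a measurable map from states to probability
distributions over actions. -/
structure Policy (S : Type u) (A : Type v) [MeasurableSpace S] [MeasurableSpace A] where
  kernel : ℕ → Kernel S A
  markov : ∀ h, IsMarkovKernel (kernel h)

attribute [instance] Policy.markov

section MDPBasics

variable {S : Type u} {A : Type v} [MeasurableSpace S] [MeasurableSpace A] {H : ℕ}

/-- `M.rollout π n h s` is the law of the `n` consecutive state-action pairs
`(s_h, a_h), …, (s_{h+n-1}, a_{h+n-1})` when `s_h = s`, `a_i ∼ π_i(s_i)` and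
`s_{i+1} ∼ P_i(s_i, a_i)`. -/
def MDP.rollout (M : MDP S A H) (π : Policy S A) : (n h : ℕ) → Kernel S (Fin n → S × A)
  | 0, _ => Kernel.const S (Measure.dirac Fin.elim0)
  | n + 1, h =>
      (Kernel.id ×ₖ (π.kernel h ⊗ₖ (M.rollout π n (h + 1) ∘ₖ M.P h))).map
        (fun x : S × (A × (Fin n → S × A)) =>
          (Fin.cons (x.1, x.2.1) x.2.2 : Fin (n + 1) → S × A))

lemma measurable_cons (n : ℕ) :
    Measurable (fun x : S × (A × (Fin n → S × A)) =>
      (Fin.cons (x.1, x.2.1) x.2.2 : Fin (n + 1) → S × A)) := by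
  refine measurable_pi_lambda _ fun i => ?_
  refine Fin.cases ?_ (fun j => ?_) i
  · simp only [Fin.cons_zero]; fun_prop
  · simp only [Fin.cons_succ]; fun_prop

instance MDP.isMarkovKernel_rollout (M : MDP S A H) (π : Policy S A) (n h : ℕ) :
    IsMarkovKernel (M.rollout π n h) := by
  induction n generalizing h with
  | zero => unfold MDP.rollout; infer_instance
  | succ n ih =>
    have := ih (h + 1)
    unfold MDP.rollout
    exact Kernel.IsMarkovKernel.map _ (measurable_cons n)

/-- The law of a whole episode under the policy `π`, with initial state distribution `ρ`. The
entries `0, …, H - 1` are the state-action pairs of the `H` stages. The state in the last entry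
is the state reached after the last stage; the action in the last entry is never looked at. -/
def MDP.episodeLaw (M : MDP S A H) (π : Policy S A) (ρ : Measure S) :
    Measure (Fin (H + 1) → S × A) :=
  ρ.bind (M.rollout π (H + 1) 0)

/-- The distribution `d^π_h` of the state-action pair of stage `h`. -/
def MDP.stageLaw (M : MDP S A H) (π : Policy S A) (ρ : Measure S) (h : Fin H) :
    Measure (S × A) :=
  (M.episodeLaw π ρ).map (fun τ => τ h.castSucc)

/-- The value function `V^π_h`: expected cumulative reward of the stages `h, …, H - 1` from
`s_h = s`. -/
def MDP.value (M : MDP S A H) (π : Policy S A) (h : ℕ) (s : S) : ℝ :=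
  ∫ τ, ∑ i : Fin (H - h), M.r (h + i) (τ i) ∂(M.rollout π (H - h) h s)

/-- The optimal value function `V^*_h`. -/
def MDP.optValue (M : MDP S A H) (h : ℕ) (s : S) : ℝ :=
  ⨆ π : Policy S A, M.value π h s

/-- `π` is an optimal policy. -/
def MDP.IsOptimal (M : MDP S A H) (π : Policy S A) : Prop :=
  ∀ h s, M.value π h s = M.optValue h s

/-- `[P_h V](s, a)` -/
def MDP.expNext (M : MDP S A H) (h : ℕ) (V : S → ℝ) (z : S × A) : ℝ :=
  ∫ s', V s' ∂(M.P h z)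

/-- The Bellman operator `T_h`. -/
def MDP.bellman (M : MDP S A H) (h : ℕ) (V : S → ℝ) (z : S × A) : ℝ :=
  ∫ s', (M.r h z + V s') ∂(M.P h z)

/-- The second-moment Bellman operator `T_{2,h}`. -/
def MDP.bellman₂ (M : MDP S A H) (h : ℕ) (V : S → ℝ) (z : S × A) : ℝ :=
  ∫ s', (M.r h z + V s') ^ 2 ∂(M.P h z)

/-- The conditional variance `[Var_h V](s, a)`. -/
def MDP.condVar (M : MDP S A H) (h : ℕ) (V : S → ℝ) (z : S × A) : ℝ :=
  M.expNext h (fun s => V s ^ 2) z - (M.expNext h V z) ^ 2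

/-- The truncated conditional variance `[𝕍_h V^*_{h+1}](s, a)` of the optimal value function. -/
def MDP.truncVar (M : MDP S A H) (h : ℕ) (z : S × A) : ℝ :=
  max 1 (M.condVar h (M.optValue (h + 1)) z)

/-- The complexity `𝒩 = max_h |F_h|` of a family of finite function classes. -/
def complexity (H : ℕ) (F : ℕ → Finset (S × A → ℝ)) : ℕ :=
  Finset.univ.sup fun h : Fin H => (F h).card

/-- `ε`-completeness of the function classes `F_h`. -/
def MDP.Complete (M : MDP S A H) (F : ℕ → Finset (S × A → ℝ)) (eps : ℝ) : Prop :=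
  ∀ h < H, ∀ V : S → ℝ, Measurable V → (∀ s, V s ∈ Set.Icc (0 : ℝ) H) →
    (∃ f ∈ F h, ∀ z, |f z - M.bellman h V z| ≤ eps) ∧
    (∃ f ∈ F h, ∀ z, |f z - M.bellman₂ h V z| ≤ eps)

/-- Uniform data coverage with constant `κ` of the behavior policy `μ` started from `ρ`. -/
def MDP.Coverage (M : MDP S A H) (μ : Policy S A) (ρ : Measure S)
    (F : ℕ → Finset (S × A → ℝ)) (κ : ℝ) : Prop :=
  ∀ h : Fin H, ∀ f₁ ∈ F h, ∀ f₂ ∈ F h,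
    κ * (⨆ z, |f₁ z - f₂ z|) ^ 2 ≤ ∫ z, (f₁ z - f₂ z) ^ 2 ∂(M.stageLaw μ ρ h)

end MDPBasics

section Divergence

variable {S : Type u} {A : Type v} {K : ℕ}

/-- The empirical weighted squared norm `∑_k g(z_k)² / σ(z_k)²`. -/
def wnormSq (zs : Fin K → S × A) (σ : S × A → ℝ) (g : S × A → ℝ) : ℝ :=
  ∑ k, 1 / (σ (zs k)) ^ 2 * (g (zs k)) ^ 2

/-- The `D²`-divergence `D²_F(z; D; σ)`, an extended nonnegative real: `x / 0 = ∞` for `x > 0`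
and `0 / 0 = 0`, which can only occur for `λ = 0`. -/
def divSq (F : Finset (S × A → ℝ)) (zs : Fin K → S × A) (σ : S × A → ℝ) (lam : ℝ)
    (z : S × A) : ENNReal :=
  ⨆ f₁ ∈ F, ⨆ f₂ ∈ F,
    ENNReal.ofReal ((f₁ z - f₂ z) ^ 2) /
      ENNReal.ofReal (wnormSq zs σ (fun y => f₁ y - f₂ y) + lam)

/-- `D_F(z; D; σ)`, the square root of the `D²`-divergence. -/
def div (F : Finset (S × A → ℝ)) (zs : Fin K → S × A) (σ : S × A → ℝ) (lam : ℝ)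
    (z : S × A) : ENNReal :=
  (divSq F zs σ lam z) ^ (1 / 2 : ℝ)

/-- `b` is an admissible answer of the bonus oracle: it lies in the bonus class `W`, dominates the
width at `f₀` of the confidence ball of radius `β`, and is bounded by the divergence. -/
structure IsBonus (F W : Finset (S × A → ℝ)) (C lam eps β : ℝ) (zs : Fin K → S × A)
    (σ : S × A → ℝ) (f₀ b : S × A → ℝ) : Prop where
  mem : b ∈ W
  lower : ∀ z, ∀ f ∈ F, wnormSq zs σ (fun y => f y - f₀ y) ≤ β ^ 2 → |f z - f₀ z| ≤ b z
  upper : ∀ z, ENNReal.ofReal (b z) ≤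
    ENNReal.ofReal C *
      (div F zs σ lam z * ENNReal.ofReal (√(β ^ 2 + lam)) + ENNReal.ofReal (eps * β))

/-- `f` minimizes the weighted least-squares loss `∑_k (f(z_k) - y_k)² / σ(z_k)²` over `F`. -/
def IsLeastSquares (F : Finset (S × A → ℝ)) (zs : Fin K → S × A) (σ : S × A → ℝ)
    (y : Fin K → ℝ) (f : S × A → ℝ) : Prop :=
  f ∈ F ∧ ∀ g ∈ F,
    ∑ k, 1 / (σ (zs k)) ^ 2 * (f (zs k) - y k) ^ 2 ≤
      ∑ k, 1 / (σ (zs k)) ^ 2 * (g (zs k) - y k) ^ 2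

end Divergence

section Algorithm

variable {S : Type u} {A : Type v} {H K : ℕ}

/-- The state-action pairs `z_h^k` of stage `h` in a dataset of `K` episodes. -/
def pairs (D : Fin K → Fin (H + 1) → S × A) (h : Fin H) (k : Fin K) : S × A :=
  D k h.castSucc

/-- The states `s_{h+1}^k` that follow stage `h` in a dataset of `K` episodes. -/
def nexts (D : Fin K → Fin (H + 1) → S × A) (h : Fin H) (k : Fin K) : S :=
  (D k h.succ).1

/-- `f(s) = max_a f(s, a)` -/
def maxA (f : S × A → ℝ) (s : S) : ℝ :=
  ⨆ a, f (s, a)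

/-- Truncation of `x` to `[0, b]`. -/
def clip (b x : ℝ) : ℝ :=
  max 0 (min b x)

/-- The functions produced by one execution of PNLSVI. -/
structure Run (S : Type u) (A : Type v) where
  /-- first-moment regression of the variance phase -/
  fbar : ℕ → S × A → ℝ
  /-- second-moment regression of the variance phase -/
  gbar : ℕ → S × A → ℝ
  /-- bonus of the variance phase -/
  bbar : ℕ → S × A → ℝ
  /-- pessimistic value estimate of the variance phase -/
  fcheck : ℕ → S × A → ℝ
  /-- weighted regression of the planning phase -/
  ftilde : ℕ → S × A → ℝ
  /-- bonus of the planning phase -/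
  b : ℕ → S × A → ℝ
  /-- pessimistic value estimate of the planning phase -/
  fhat : ℕ → S × A → ℝ

/-- The square root `σ̂_h` of the variance estimator, with perturbation term `pert`. -/
def Run.sigmaHat (R : Run S A) (pert : ℝ) (h : ℕ) (z : S × A) : ℝ :=
  √(max 1 (R.gbar h z - (R.fbar h z) ^ 2 - pert))

variable [MeasurableSpace S] [MeasurableSpace A]

/-- `R` is an execution of PNLSVI on the datasets `Dbar` (variance phase) and `D` (planning phase),
for some choice of the minimizers and some admissible answers of the bonus oracle. -/
structure IsRun (M : MDP S A H) (F : ℕ → Finset (S × A → ℝ)) (W : Finset (S × A → ℝ))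
    (C lam eps : ℝ) (βbar β : ℕ → ℝ) (pert : ℝ)
    (Dbar D : Fin K → Fin (H + 1) → S × A) (R : Run S A) : Prop where
  fcheck_last : R.fcheck H = fun _ => 0
  fbar_spec : ∀ h : Fin H, IsLeastSquares (F h) (pairs Dbar h) (fun _ => 1)
    (fun k => M.r h (pairs Dbar h k) + maxA (R.fcheck (h + 1)) (nexts Dbar h k)) (R.fbar h)
  gbar_spec : ∀ h : Fin H, IsLeastSquares (F h) (pairs Dbar h) (fun _ => 1)
    (fun k => (M.r h (pairs Dbar h k) + maxA (R.fcheck (h + 1)) (nexts Dbar h k)) ^ 2) (R.gbar h)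
  bbar_spec : ∀ h : Fin H, IsBonus (F h) W C lam eps (βbar h) (pairs Dbar h) (fun _ => 1)
    (R.fbar h) (R.bbar h)
  fcheck_spec : ∀ h : Fin H, ∀ z,
    R.fcheck h z = clip ((H : ℝ) - (h : ℕ)) (R.fbar h z - R.bbar h z - eps)
  fhat_last : R.fhat H = fun _ => 0
  ftilde_spec : ∀ h : Fin H, IsLeastSquares (F h) (pairs D h) (R.sigmaHat pert h)
    (fun k => M.r h (pairs D h k) + maxA (R.fhat (h + 1)) (nexts D h k)) (R.ftilde h)
  b_spec : ∀ h : Fin H, IsBonus (F h) W C lam eps (β h) (pairs D h) (R.sigmaHat pert h)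
    (R.ftilde h) (R.b h)
  fhat_spec : ∀ h : Fin H, ∀ z,
    R.fhat h z = clip ((H : ℝ) - (h : ℕ)) (R.ftilde h z - R.b h z - eps)

/-- `π` is an output policy of the run: it only plays actions that maximize `f̂_h(s, ·)`. -/
def Run.IsOutput (R : Run S A) (H : ℕ) (π : Policy S A) : Prop :=
  ∀ h < H, ∀ s a, π.kernel h s {a} ≠ 0 → ∀ a', R.fhat h (s, a') ≤ R.fhat h (s, a)

end Algorithm

/-- The logarithmic factor hidden in the `Õ` and `Ω̃` notation: `log (e H K / δ)`. -/
def logFactor (H K : ℕ) (δ : ℝ) : ℝ :=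
  1 + Real.log ((H : ℝ) * K / δ)

end OfflineRL

end

/-!
The estimates of both phases are pessimistic: the regression of stage `h` lies, on a good event, in
the confidence ball of the bonus oracle around an approximation of the Bellman image of the next
estimate, so lowering it by the bonus and truncating gives a function between `T_h V - 2 b - 2 ε` and
`T_h V` (`Regime.pessimistic_of_bonus`). A policy that is greedy for pessimistic estimates is at
least as good as they claim, and the gap between the estimates and the optimal value telescopes
along an optimal policy (`MDP.IsOptimal.suboptimality_le`). It remains to bound `b + ε` by the
divergence with the optimal weights, which follows from the oracle's upper bound, once the estimated
weights are comparable with the truncated variance of `V*`, and from completeness at the value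
functions `0` and `1`, which bounds `ε ≤ 1 / √K` by the divergence.

All probabilistic input is one exponential inequality: if `∫ exp φ ≤ 1` for the law of an episode,
then `∑ φ ≤ Λ` over an independent sample fails with probability at most `exp (-Λ)`. It is applied
with a union bound over finite classes that do not depend on the data. Value estimates range over
`valueClass`, of size `𝒩 𝒩_b`, and estimated weights over the pairs of regressions of the variance
phase, a class of size at most `𝒩 ^ 2`; for this reason the independence of the two datasets is not
needed. The exponents are self-normalized, that is, the empirical norm of a difference of functions
appears as its own variance proxy, so that least squares can be solved for that norm
(`IsLeastSquares.wnormSq_sub_le`).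

In the variance phase Hoeffding's lemma gives radius `H √(ℓ log (𝒩 𝒩_b))`. Uniform coverage turns
empirical norms into sup norms, and the lower bound on `K` makes the value estimates `1 / 4`-close to
`V*`; conditional variances, truncated at `1`, are then comparable up to constants
(`Regime.sigmaHat_comparable`). In the planning phase the noise is split into that of `V*`, treated
by a Bernstein bound with no union over value estimates, and that of `V - V*`
(`Regime.planning_regression`). The latter has range at most `√(log 𝒩 / log (𝒩 𝒩_b))` by backward
induction, which pays exactly for the union over the value estimates, so the radius is
`√(ℓ log 𝒩)` without any power of `H` and without `𝒩_b`.
-/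

noncomputable section

namespace OfflineRL

/-! ### Trajectory laws and value functions -/

section Trajectories

variable {S : Type u} {A : Type v} [MeasurableSpace S] [MeasurableSpace A] {H : ℕ}

lemma measurable_cons_pair (n : ℕ) (z : S × A) :
    Measurable (fun τ : Fin n → S × A => (Fin.cons z τ : Fin (n + 1) → S × A)) := by
  refine measurable_pi_lambda _ fun i => ?_
  refine Fin.cases ?_ (fun j => ?_) i
  · simp only [Fin.cons_zero]; fun_prop
  · simp only [Fin.cons_succ]; fun_prop

lemma MDP.lintegral_rollout_succ (M : MDP S A H) (π : Policy S A) (n h : ℕ) (s : S)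
    {Φ : (Fin (n + 1) → S × A) → ENNReal} (hΦ : Measurable Φ) :
    ∫⁻ τ, Φ τ ∂(M.rollout π (n + 1) h s) =
      ∫⁻ a, ∫⁻ s', ∫⁻ τ, Φ (Fin.cons (s, a) τ) ∂(M.rollout π n (h + 1) s')
        ∂(M.P h (s, a)) ∂(π.kernel h s) := by
  have hm : Measurable fun x : S × (A × (Fin n → S × A)) =>
      Φ (Fin.cons (x.1, x.2.1) x.2.2) := hΦ.comp (measurable_cons n)
  rw [MDP.rollout, Kernel.lintegral_map _ (measurable_cons n) _ hΦ]
  rw [Kernel.lintegral_id_prod hm, Kernel.lintegral_compProd]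
  · refine lintegral_congr fun a => ?_
    exact Kernel.lintegral_comp _ _ _ (hΦ.comp (measurable_cons_pair n (s, a)))
  · exact hm.comp measurable_prodMk_left

/-- The law of the future of stage `h` depends only on what the policy does from stage `h` on. -/
lemma MDP.rollout_congr (M : MDP S A H) {π π' : Policy S A} (n h : ℕ)
    (hπ : ∀ j, h ≤ j → π.kernel j = π'.kernel j) : M.rollout π n h = M.rollout π' n h := by
  induction n generalizing h with
  | zero => rfl
  | succ n ih =>
    simp only [MDP.rollout]
    rw [ih (h + 1) fun j hj => hπ j (by omega)]
    simp only [hπ h le_rfl]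

lemma MDP.lintegral_rollout_sum_succ (M : MDP S A H) (π : Policy S A) (n h : ℕ) (s : S)
    {g : ℕ → S × A → ENNReal} (hg : ∀ j, Measurable (g j)) :
    ∫⁻ τ, ∑ i : Fin (n + 1), g (h + i) (τ i) ∂(M.rollout π (n + 1) h s) =
      ∫⁻ a, (g h (s, a) + ∫⁻ s', ∫⁻ τ, ∑ i : Fin n, g (h + 1 + i) (τ i)
        ∂(M.rollout π n (h + 1) s') ∂(M.P h (s, a))) ∂(π.kernel h s) := by
  rw [M.lintegral_rollout_succ π n h s]
  · refine lintegral_congr fun a => ?_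
    simp only [Fin.sum_univ_succ, Fin.cons_zero, Fin.cons_succ, Fin.val_zero, add_zero,
      Fin.val_succ]
    simp_rw [lintegral_add_left measurable_const, lintegral_const, measure_univ, mul_one]
    rw [lintegral_add_left measurable_const, lintegral_const, measure_univ, mul_one]
    simp only [add_assoc, add_comm 1]
  · exact Finset.measurable_sum _ fun i _ => (hg _).comp (measurable_pi_apply i)

/-- The state of stage `i + 1` is drawn from the transition kernel at the pair of stage `i`. -/
lemma MDP.lintegral_rollout_pair (M : MDP S A H) (π : Policy S A) {Φ : (S × A) × S → ENNReal}
    (hΦ : Measurable Φ) (n h i : ℕ) (hi : i + 1 < n) (s : S) :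
    ∫⁻ τ, Φ (τ ⟨i, by omega⟩, (τ ⟨i + 1, hi⟩).1) ∂(M.rollout π n h s) =
      ∫⁻ τ, ∫⁻ s', Φ (τ ⟨i, by omega⟩, s') ∂(M.P (h + i) (τ ⟨i, by omega⟩))
        ∂(M.rollout π n h s) := by
  have hker : ∀ j, Measurable fun z : S × A => ∫⁻ s', Φ (z, s') ∂(M.P j z) := fun j =>
    hΦ.lintegral_kernel_prod_right'
  induction n generalizing h i s with
  | zero => omega
  | succ n ih =>
    have hm : Measurable fun τ : Fin (n + 1) → S × A =>
        ∫⁻ s', Φ (τ ⟨i, by omega⟩, s') ∂(M.P (h + i) (τ ⟨i, by omega⟩)) :=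
      (hker (h + i)).comp (measurable_pi_apply _)
    rw [M.lintegral_rollout_succ π n h s (by fun_prop), M.lintegral_rollout_succ π n h s hm]
    refine lintegral_congr fun a => ?_
    cases i with
    | zero =>
      obtain ⟨m, rfl⟩ : ∃ m, n = m + 1 := ⟨n - 1, by omega⟩
      have h1 : ∀ s', ∫⁻ τ, Φ ((s, a), (τ (0 : Fin (m + 1))).1)
          ∂(M.rollout π (m + 1) (h + 1) s') = Φ ((s, a), s') := by
        intro s'
        rw [M.lintegral_rollout_succ π m (h + 1) s' (by fun_prop)]
        simp
      have h2 : ∀ τ : Fin (m + 1) → S × A,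
          (Fin.cons (s, a) τ : Fin (m + 2) → S × A) ⟨0 + 1, hi⟩ = τ 0 := fun τ => rfl
      have h3 : ∀ τ : Fin (m + 1) → S × A,
          (Fin.cons (s, a) τ : Fin (m + 2) → S × A) ⟨0, by omega⟩ = (s, a) := fun τ => rfl
      simp only [h2, h3, h1, add_zero]
      simp
    | succ i =>
      refine lintegral_congr fun s' => ?_
      have h2 : ∀ (τ : Fin n → S × A),
          (Fin.cons (s, a) τ : Fin (n + 1) → S × A) ⟨i + 1 + 1, hi⟩ = τ ⟨i + 1, by omega⟩ :=
        fun τ => rfl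
      have h3 : ∀ (τ : Fin n → S × A),
          (Fin.cons (s, a) τ : Fin (n + 1) → S × A) ⟨i + 1, by omega⟩ = τ ⟨i, by omega⟩ :=
        fun τ => rfl
      simp only [h2, h3]
      rw [ih (h + 1) i (by omega) s']
      simp only [add_assoc, add_comm 1]

lemma MDP.lintegral_episodeLaw_pair (M : MDP S A H) (π : Policy S A) (ρ : Measure S)
    {Φ : (S × A) × S → ENNReal} (hΦ : Measurable Φ) (h : Fin H) :
    ∫⁻ τ, Φ (τ h.castSucc, (τ h.succ).1) ∂(M.episodeLaw π ρ) =
      ∫⁻ z, ∫⁻ s', Φ (z, s') ∂(M.P h z) ∂(M.stageLaw π ρ h) := by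
  have hker : Measurable fun z : S × A => ∫⁻ s', Φ (z, s') ∂(M.P h z) :=
    hΦ.lintegral_kernel_prod_right'
  have hm : Measurable fun τ : Fin (H + 1) → S × A =>
      ∫⁻ s', Φ (τ h.castSucc, s') ∂(M.P h (τ h.castSucc)) := hker.comp (measurable_pi_apply _)
  rw [MDP.stageLaw, lintegral_map hker (measurable_pi_apply _), MDP.episodeLaw,
    Measure.lintegral_bind (Kernel.aemeasurable _) (by fun_prop),
    Measure.lintegral_bind (Kernel.aemeasurable _) hm.aemeasurable]
  refine lintegral_congr fun s => ?_
  have := M.lintegral_rollout_pair π hΦ (H + 1) 0 h (by have := h.2; omega) s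
  simp only [zero_add] at this
  exact this

lemma MDP.lintegral_episodeLaw_dirac (M : MDP S A H) (π : Policy S A) (s : S)
    (Φ : (Fin (H + 1) → S × A) → ENNReal) :
    ∫⁻ τ, Φ τ ∂(M.episodeLaw π (Measure.dirac s)) =
      ∫⁻ τ, Φ τ ∂(M.rollout π (H + 1) 0 s) := by
  rw [MDP.episodeLaw, Measure.dirac_bind (Kernel.measurable _)]

instance MDP.isProbabilityMeasure_episodeLaw (M : MDP S A H) (π : Policy S A) (ρ : Measure S)
    [IsProbabilityMeasure ρ] : IsProbabilityMeasure (M.episodeLaw π ρ) := by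
  unfold MDP.episodeLaw; infer_instance

instance MDP.isProbabilityMeasure_stageLaw (M : MDP S A H) (π : Policy S A) (ρ : Measure S)
    [IsProbabilityMeasure ρ] (h : Fin H) : IsProbabilityMeasure (M.stageLaw π ρ h) :=
  Measure.isProbabilityMeasure_map (measurable_pi_apply _).aemeasurable

/-! ### Values and the Bellman equations -/

lemma MDP.reward_nonneg (M : MDP S A H) (h : ℕ) (z : S × A) : 0 ≤ M.r h z := (M.r_mem h z).1

lemma MDP.reward_le_one (M : MDP S A H) (h : ℕ) (z : S × A) : M.r h z ≤ 1 := (M.r_mem h z).2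

lemma MDP.measurable_rollout_sum (M : MDP S A H) (n h : ℕ) :
    Measurable fun τ : Fin n → S × A => ∑ i : Fin n, M.r (h + i) (τ i) :=
  Finset.measurable_sum _ fun i _ => (M.measurable_r _).comp (measurable_pi_apply i)

lemma MDP.rollout_sum_nonneg (M : MDP S A H) (n h : ℕ) (τ : Fin n → S × A) :
    0 ≤ ∑ i : Fin n, M.r (h + i) (τ i) := Finset.sum_nonneg fun _ _ => M.reward_nonneg _ _

lemma MDP.rollout_sum_le (M : MDP S A H) (n h : ℕ) (τ : Fin n → S × A) :
    ∑ i : Fin n, M.r (h + i) (τ i) ≤ n := by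
  calc _ ≤ ∑ _i : Fin n, (1 : ℝ) := Finset.sum_le_sum fun i _ => M.reward_le_one _ _
    _ = n := by simp

lemma MDP.integrable_rollout_sum (M : MDP S A H) (π : Policy S A) (n h : ℕ) (s : S) :
    Integrable (fun τ : Fin n → S × A => ∑ i : Fin n, M.r (h + i) (τ i)) (M.rollout π n h s) := by
  refine Integrable.of_bound (M.measurable_rollout_sum n h).aestronglyMeasurable n ?_
  refine Filter.Eventually.of_forall fun τ => ?_
  rw [Real.norm_of_nonneg (M.rollout_sum_nonneg n h τ)]
  exact M.rollout_sum_le n h τ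

lemma MDP.ofReal_value (M : MDP S A H) (π : Policy S A) {n h : ℕ} (hn : H - h = n) (s : S) :
    ENNReal.ofReal (M.value π h s) = ∫⁻ τ, ∑ i : Fin n, ENNReal.ofReal (M.r (h + i) (τ i))
      ∂(M.rollout π n h s) := by
  subst hn
  rw [MDP.value, ofReal_integral_eq_lintegral_ofReal (M.integrable_rollout_sum π _ h s)
    (Filter.Eventually.of_forall fun τ => M.rollout_sum_nonneg _ h τ)]
  refine lintegral_congr fun τ => ?_
  rw [ENNReal.ofReal_sum_of_nonneg fun _ _ => M.reward_nonneg _ _]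

lemma MDP.value_nonneg (M : MDP S A H) (π : Policy S A) (h : ℕ) (s : S) : 0 ≤ M.value π h s :=
  integral_nonneg fun τ => M.rollout_sum_nonneg _ h τ

lemma MDP.value_le (M : MDP S A H) (π : Policy S A) {h : ℕ} (hh : h ≤ H) (s : S) :
    M.value π h s ≤ (H : ℝ) - h := by
  have := integral_mono (M.integrable_rollout_sum π (H - h) h s) (integrable_const _)
    (fun τ => M.rollout_sum_le (H - h) h τ)
  simpa [MDP.value, Nat.cast_sub hh] using this

lemma MDP.value_le_horizon (M : MDP S A H) (π : Policy S A) (h : ℕ) (s : S) :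
    M.value π h s ≤ H := by
  have := integral_mono (M.integrable_rollout_sum π (H - h) h s) (integrable_const _)
    (fun τ => M.rollout_sum_le (H - h) h τ)
  refine (this.trans ?_ : M.value π h s ≤ _)
  simp

lemma MDP.value_last (M : MDP S A H) (π : Policy S A) (s : S) : M.value π H s = 0 :=
  le_antisymm (by simpa using M.value_le π le_rfl s) (M.value_nonneg π H s)

lemma MDP.measurable_value (M : MDP S A H) (π : Policy S A) (h : ℕ) :
    Measurable (M.value π h) := by
  have h1 : M.value π h = fun s => (∫⁻ τ, ENNReal.ofReal
      (∑ i : Fin (H - h), M.r (h + i) (τ i)) ∂(M.rollout π (H - h) h s)).toReal := by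
    funext s
    exact integral_eq_lintegral_of_nonneg_ae
      (Filter.Eventually.of_forall fun τ => M.rollout_sum_nonneg _ h τ)
      (M.measurable_rollout_sum _ h).aestronglyMeasurable
  rw [h1]
  exact (M.measurable_rollout_sum _ h).ennreal_ofReal.lintegral_kernel.ennreal_toReal

lemma integrable_of_mem_Icc {X : Type*} [MeasurableSpace X] (m : Measure X) [IsFiniteMeasure m]
    {V : X → ℝ} (hV : Measurable V) {a b : ℝ} (hb : ∀ x, V x ∈ Set.Icc a b) : Integrable V m :=
  Integrable.of_mem_Icc a b hV.aemeasurable (Filter.Eventually.of_forall hb)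

lemma MDP.ofReal_bellman (M : MDP S A H) (h : ℕ) {V : S → ℝ} (hV : Measurable V) {b : ℝ}
    (hb : ∀ s, V s ∈ Set.Icc 0 b) (z : S × A) :
    ENNReal.ofReal (M.bellman h V z) =
      ENNReal.ofReal (M.r h z) + ∫⁻ s', ENNReal.ofReal (V s') ∂(M.P h z) := by
  rw [MDP.bellman, ofReal_integral_eq_lintegral_ofReal (f := fun s' => M.r h z + V s')
    ((integrable_const _).add (integrable_of_mem_Icc _ hV hb))
    (Filter.Eventually.of_forall fun s => add_nonneg (M.reward_nonneg h z) (hb s).1)]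
  simp_rw [ENNReal.ofReal_add (M.reward_nonneg h z) (hb _).1]
  rw [lintegral_add_left measurable_const]
  simp

lemma MDP.bellman_eq (M : MDP S A H) (h : ℕ) {V : S → ℝ} (hV : Measurable V) {a b : ℝ}
    (hb : ∀ s, V s ∈ Set.Icc a b) (z : S × A) :
    M.bellman h V z = M.r h z + M.expNext h V z := by
  rw [MDP.bellman, MDP.expNext, integral_add (integrable_const _) (integrable_of_mem_Icc _ hV hb)]
  simp

lemma MDP.expNext_mem (M : MDP S A H) (h : ℕ) {V : S → ℝ} (hV : Measurable V) {a b : ℝ}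
    (hb : ∀ s, V s ∈ Set.Icc a b) (z : S × A) : M.expNext h V z ∈ Set.Icc a b := by
  have hi := integrable_of_mem_Icc (M.P h z) hV hb
  constructor
  · simpa [MDP.expNext] using integral_mono (integrable_const a) hi fun s => (hb s).1
  · simpa [MDP.expNext] using integral_mono hi (integrable_const b) fun s => (hb s).2

lemma MDP.measurable_expNext (M : MDP S A H) (h : ℕ) {V : S → ℝ} (hV : Measurable V) :
    Measurable (M.expNext h V) :=
  (hV.stronglyMeasurable.integral_kernel (κ := M.P h)).measurable

/-- The Bellman equation of a fixed policy. -/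
lemma MDP.ofReal_value_eq (M : MDP S A H) (π : Policy S A) {h : ℕ} (hh : h < H) (s : S) :
    ENNReal.ofReal (M.value π h s) =
      ∫⁻ a, ENNReal.ofReal (M.bellman h (M.value π (h + 1)) (s, a)) ∂(π.kernel h s) := by
  obtain ⟨n, hn⟩ : ∃ n, H - h = n + 1 := ⟨H - h - 1, by omega⟩
  have hn' : H - (h + 1) = n := by omega
  rw [M.ofReal_value π hn, M.lintegral_rollout_sum_succ π n h s (g := fun j z => ENNReal.ofReal (M.r j z))
    fun j => (M.measurable_r j).ennreal_ofReal]
  refine lintegral_congr fun a => ?_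
  rw [M.ofReal_bellman h (M.measurable_value π _)
    (fun s => ⟨M.value_nonneg π _ s, M.value_le_horizon π _ s⟩)]
  simp_rw [M.ofReal_value π hn']

lemma MDP.bddAbove_value (M : MDP S A H) (h : ℕ) (s : S) :
    BddAbove (Set.range fun π : Policy S A => M.value π h s) :=
  ⟨H, by rintro _ ⟨π, rfl⟩; exact M.value_le_horizon π h s⟩

lemma MDP.measurable_bellman (M : MDP S A H) (h : ℕ) {V : S → ℝ} (hV : Measurable V) {a b : ℝ}
    (hb : ∀ s, V s ∈ Set.Icc a b) : Measurable (M.bellman h V) := by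
  have : M.bellman h V = fun z => M.r h z + M.expNext h V z :=
    funext fun z => M.bellman_eq h hV hb z
  rw [this]
  exact (M.measurable_r h).add (M.measurable_expNext h hV)

section Optimal

variable {M : MDP S A H} {π : Policy S A}

lemma MDP.IsOptimal.optValue_eq (hπ : M.IsOptimal π) (h : ℕ) : M.optValue h = M.value π h :=
  funext fun s => (hπ h s).symm

lemma MDP.IsOptimal.measurable_optValue (hπ : M.IsOptimal π) (h : ℕ) :
    Measurable (M.optValue h) := by
  rw [hπ.optValue_eq]; exact M.measurable_value π h

lemma MDP.IsOptimal.optValue_mem (hπ : M.IsOptimal π) (h : ℕ) (s : S) :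
    M.optValue h s ∈ Set.Icc (0 : ℝ) H := by
  rw [hπ.optValue_eq]; exact ⟨M.value_nonneg π h s, M.value_le_horizon π h s⟩

lemma MDP.IsOptimal.optValue_last (hπ : M.IsOptimal π) (s : S) : M.optValue H s = 0 := by
  rw [hπ.optValue_eq, M.value_last]

lemma MDP.IsOptimal.ofReal_optValue_eq (hπ : M.IsOptimal π) {h : ℕ} (hh : h < H) (s : S) :
    ENNReal.ofReal (M.optValue h s) =
      ∫⁻ a, ENNReal.ofReal (M.bellman h (M.optValue (h + 1)) (s, a)) ∂(π.kernel h s) := by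
  rw [hπ.optValue_eq, hπ.optValue_eq, M.ofReal_value_eq π hh]

/-- No action beats the optimal value: compare with the policy that plays `a` at stage `h` and
follows `π` elsewhere. -/
lemma MDP.IsOptimal.bellman_le_optValue (hπ : M.IsOptimal π) {h : ℕ} (hh : h < H) (s : S) (a : A) :
    M.bellman h (M.optValue (h + 1)) (s, a) ≤ M.optValue h s := by
  classical
  let π' : Policy S A :=
    { kernel := fun j => if j = h then Kernel.const S (Measure.dirac a) else π.kernel j
      markov := fun j => by
        change IsMarkovKernel (if j = h then _ else _)
        split_ifs <;> infer_instance }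
  have hker : π'.kernel h = Kernel.const S (Measure.dirac a) := if_pos rfl
  have hnext : M.value π' (h + 1) = M.optValue (h + 1) := by
    rw [hπ.optValue_eq]
    funext s'
    rw [MDP.value, MDP.value, M.rollout_congr (π := π') (π' := π) _ _ fun j hj => ?_]
    exact if_neg (by omega)
  have h1 := M.ofReal_value_eq π' hh s
  rw [hnext, hker, Kernel.const_apply, lintegral_dirac'] at h1
  · have h2 : M.value π' h s ≤ M.optValue h s := le_ciSup (M.bddAbove_value h s) π'
    refine le_trans (le_of_eq ?_) h2
    have h0 : 0 ≤ M.bellman h (M.optValue (h + 1)) (s, a) :=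
      integral_nonneg fun s' => add_nonneg (M.reward_nonneg _ _) (hπ.optValue_mem _ _).1
    exact ((ENNReal.ofReal_eq_ofReal_iff (M.value_nonneg π' h s) h0).1 h1).symm
  · exact ((M.measurable_bellman h (hπ.measurable_optValue _)
      (hπ.optValue_mem _)).comp measurable_prodMk_left).ennreal_ofReal

end Optimal

end Trajectories

/-! ### Exponential concentration for independent samples -/

section Concentration

variable {Ω : Type*} {E : Type*} [MeasurableSpace Ω] [MeasurableSpace E]

/-- Exponential Markov inequality for a sum over an independent sample. -/
lemma measure_lt_sum_le {ι : Type*} [Fintype ι] {Pr : Measure Ω} {ν : Measure E}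
    {X : ι → Ω → E} (hX : ∀ i, Measurable (X i)) (hind : iIndepFun X Pr)
    (hlaw : ∀ i, Pr.map (X i) = ν) {φ : E → ℝ} (hφ : Measurable φ)
    (hexp : ∫⁻ x, ENNReal.ofReal (Real.exp (φ x)) ∂ν ≤ 1) (Λ : ℝ) :
    Pr {ω | Λ < ∑ i, φ (X i ω)} ≤ ENNReal.ofReal (Real.exp (-Λ)) := by
  have hg : Measurable fun x => ENNReal.ofReal (Real.exp (φ x)) := by fun_prop
  have h1 : ∫⁻ ω, ∏ i, ENNReal.ofReal (Real.exp (φ (X i ω))) ∂Pr ≤ 1 := by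
    rw [lintegral_prod_eq_prod_lintegral_of_indepFun Finset.univ
      (fun i ω => ENNReal.ofReal (Real.exp (φ (X i ω)))) (hind.comp _ fun _ => hg)
      fun i => hg.comp (hX i)]
    refine Finset.prod_le_one' fun i _ => ?_
    rw [← lintegral_map hg (hX i), hlaw i]
    exact hexp
  have hm : Measurable fun ω => ∏ i, ENNReal.ofReal (Real.exp (φ (X i ω))) :=
    Finset.measurable_prod _ fun i _ => hg.comp (hX i)
  have h2 := mul_meas_ge_le_lintegral (μ := Pr) hm (ENNReal.ofReal (Real.exp Λ))
  have h3 : {ω | Λ < ∑ i, φ (X i ω)} ⊆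
      {ω | ENNReal.ofReal (Real.exp Λ) ≤ ∏ i, ENNReal.ofReal (Real.exp (φ (X i ω)))} := by
    intro ω hω
    simp only [Set.mem_ofPred_eq] at hω ⊢
    rw [← ENNReal.ofReal_prod_of_nonneg fun _ _ => (Real.exp_pos _).le, ← Real.exp_sum]
    exact ENNReal.ofReal_le_ofReal (Real.exp_le_exp.2 hω.le)
  calc Pr {ω | Λ < ∑ i, φ (X i ω)} ≤ _ := measure_mono h3
    _ = ENNReal.ofReal (Real.exp (-Λ)) * (ENNReal.ofReal (Real.exp Λ) * Pr {ω |
          ENNReal.ofReal (Real.exp Λ) ≤ ∏ i, ENNReal.ofReal (Real.exp (φ (X i ω)))}) := by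
        rw [← mul_assoc, ← ENNReal.ofReal_mul (Real.exp_pos _).le, ← Real.exp_add]
        simp
    _ ≤ ENNReal.ofReal (Real.exp (-Λ)) * 1 := by gcongr; exact h2.trans h1
    _ = _ := mul_one _

/-- The union bound over finitely many exponential inequalities. -/
lemma exists_event_forall_sum_le {ι J : Type*} [Fintype ι] {Pr : Measure Ω} {ν : Measure E}
    {X : ι → Ω → E} (hX : ∀ i, Measurable (X i)) (hind : iIndepFun X Pr)
    (hlaw : ∀ i, Pr.map (X i) = ν) (I : Finset J) {φ : J → E → ℝ}
    (hφ : ∀ j ∈ I, Measurable (φ j))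
    (hexp : ∀ j ∈ I, ∫⁻ x, ENNReal.ofReal (Real.exp (φ j x)) ∂ν ≤ 1) {Λ p : ℝ}
    (hp : I.card * Real.exp (-Λ) ≤ p) :
    ∃ G : Set Ω, MeasurableSet G ∧ Pr Gᶜ ≤ ENNReal.ofReal p ∧
      ∀ ω ∈ G, ∀ j ∈ I, ∑ i, φ j (X i ω) ≤ Λ := by
  refine ⟨(⋃ j ∈ I, {ω | Λ < ∑ i, φ j (X i ω)})ᶜ, ?_, ?_, ?_⟩
  · refine (Finset.measurableSet_biUnion _ fun j hj => ?_).compl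
    exact measurableSet_lt measurable_const
      (Finset.measurable_sum _ fun i _ => (hφ j hj).comp (hX i))
  · rw [compl_compl]
    calc _ ≤ ∑ j ∈ I, Pr {ω | Λ < ∑ i, φ j (X i ω)} := measure_biUnion_finset_le _ _
      _ ≤ ∑ _j ∈ I, ENNReal.ofReal (Real.exp (-Λ)) := Finset.sum_le_sum fun j hj =>
          measure_lt_sum_le hX hind hlaw (hφ j hj) (hexp j hj) Λ
      _ = ENNReal.ofReal (I.card * Real.exp (-Λ)) := by
          rw [Finset.sum_const, nsmul_eq_mul, ENNReal.ofReal_mul (Nat.cast_nonneg _),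
            ENNReal.ofReal_natCast]
      _ ≤ _ := ENNReal.ofReal_le_ofReal hp
  · intro ω hω j hj
    simp only [Set.mem_compl_iff, Set.mem_iUnion, not_exists, Set.mem_ofPred_eq, not_lt] at hω
    exact hω j hj

lemma lintegral_exp_le_one_of_integral {m : Measure E} {φ : E → ℝ} (hi : Integrable (fun x => Real.exp (φ x)) m)
    (h : ∫ x, Real.exp (φ x) ∂m ≤ 1) : ∫⁻ x, ENNReal.ofReal (Real.exp (φ x)) ∂m ≤ 1 := by
  rw [← ofReal_integral_eq_lintegral_ofReal hi
    (Filter.Eventually.of_forall fun x => (Real.exp_pos _).le)]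
  exact ENNReal.ofReal_le_one.2 h

variable {m : Measure E} [IsProbabilityMeasure m]

lemma integral_sub_const_sq {g : E → ℝ} (hg : Integrable g m)
    (hg2 : Integrable (fun x => g x ^ 2) m) (c : ℝ) :
    ∫ x, (g x - c) ^ 2 ∂m = ∫ x, g x ^ 2 ∂m - 2 * c * ∫ x, g x ∂m + c ^ 2 := by
  have h1 : Integrable (fun x => 2 * c * g x) m := hg.const_mul _
  have h2 : Integrable (fun x => g x ^ 2 - 2 * c * g x) m := hg2.sub h1
  calc _ = ∫ x, (g x ^ 2 - 2 * c * g x + c ^ 2) ∂m := by congr 1; funext x; ring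
    _ = _ := by
        rw [integral_add h2 (integrable_const _), integral_sub hg2 h1, integral_const_mul]
        simp

/-- Hoeffding's lemma. -/
lemma lintegral_exp_hoeffding {g : E → ℝ} (hg : Measurable g) {a b : ℝ}
    (hb : ∀ x, g x ∈ Set.Icc a b) (t : ℝ) :
    ∫⁻ x, ENNReal.ofReal (Real.exp (t * (g x - ∫ y, g y ∂m) - t ^ 2 * (b - a) ^ 2 / 8)) ∂m
      ≤ 1 := by
  have h := hasSubgaussianMGF_of_mem_Icc (μ := m) hg.aemeasurable
    (Filter.Eventually.of_forall hb)
  have h1 := h.mgf_le t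
  have h2 := h.integrable_exp_mul t
  have h3 : ∀ x, Real.exp (t * (g x - ∫ y, g y ∂m) - t ^ 2 * (b - a) ^ 2 / 8) =
      Real.exp (t * (g x - ∫ y, g y ∂m)) * Real.exp (-(t ^ 2 * (b - a) ^ 2 / 8)) := fun x => by
    rw [← Real.exp_add]; ring_nf
  have h4 : (((‖b - a‖₊ / 2) ^ 2 : NNReal) : ℝ) * t ^ 2 / 2 = t ^ 2 * (b - a) ^ 2 / 8 := by
    push_cast
    rw [Real.norm_eq_abs, div_pow, sq_abs]
    ring
  refine lintegral_exp_le_one_of_integral ?_ ?_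
  · simp_rw [h3]; exact h2.mul_const _
  · simp_rw [h3]
    rw [integral_mul_const]
    rw [h4] at h1
    calc _ ≤ Real.exp (t ^ 2 * (b - a) ^ 2 / 8) * Real.exp (-(t ^ 2 * (b - a) ^ 2 / 8)) := by
          gcongr; exact h1
      _ = 1 := by rw [← Real.exp_add]; simp

/-- The variance form of the exponential inequality, valid while the exponent is at most one. -/
lemma lintegral_exp_bernstein {g : E → ℝ} (hg : Measurable g) {R : ℝ}
    (hb : ∀ x, g x ∈ Set.Icc 0 R) {t : ℝ} (ht : |t| * R ≤ 1) :
    ∫⁻ x, ENNReal.ofReal (Real.exp (t * (g x - ∫ y, g y ∂m) -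
      t ^ 2 * (∫ y, g y ^ 2 ∂m - (∫ y, g y ∂m) ^ 2))) ∂m ≤ 1 := by
  set c := ∫ y, g y ∂m with hc
  set v := ∫ y, g y ^ 2 ∂m - c ^ 2 with hv
  have hgi : Integrable g m := integrable_of_mem_Icc m hg hb
  have hg2 : Integrable (fun x => g x ^ 2) m := integrable_of_mem_Icc m (hg.pow_const 2)
    (a := 0) (b := R ^ 2) fun x => ⟨sq_nonneg _, pow_le_pow_left₀ (hb x).1 (hb x).2 2⟩
  have hcm : c ∈ Set.Icc 0 R := by
    constructor
    · exact integral_nonneg fun x => (hb x).1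
    · simpa using integral_mono hgi (integrable_const R) fun x => (hb x).2
  have hx : ∀ x, |t * (g x - c)| ≤ 1 := by
    intro x
    rw [abs_mul]
    refine le_trans ?_ ht
    gcongr
    rw [abs_le]
    constructor <;> linarith [(hb x).1, (hb x).2, hcm.1, hcm.2]
  have hpt : ∀ x, Real.exp (t * (g x - c)) ≤ 1 + t * (g x - c) + t ^ 2 * (g x - c) ^ 2 := by
    intro x
    have := (abs_le.1 (Real.abs_exp_sub_one_sub_id_le (hx x))).2
    rw [mul_pow] at this
    linarith
  have hei : Integrable (fun x => Real.exp (t * (g x - c))) m := by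
    refine integrable_of_mem_Icc m (by fun_prop) (a := 0) (b := Real.exp 1) fun x => ?_
    exact ⟨(Real.exp_pos _).le, Real.exp_le_exp.2 (abs_le.1 (hx x)).2⟩
  have hd : Integrable (fun x => g x - c) m := hgi.sub (integrable_const c)
  have hd2 : Integrable (fun x => (g x - c) ^ 2) m := by
    have : (fun x => (g x - c) ^ 2) = fun x => g x ^ 2 - 2 * c * g x + c ^ 2 := by
      funext x; ring
    rw [this]
    exact (hg2.sub (hgi.const_mul _)).add (integrable_const _)
  have hd2v : ∫ x, (g x - c) ^ 2 ∂m = v := by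
    rw [integral_sub_const_sq hgi hg2, ← hc, hv]; ring
  have hd0 : ∫ x, (g x - c) ∂m = 0 := by
    rw [integral_sub hgi (integrable_const c), ← hc]; simp
  have hint : ∫ x, Real.exp (t * (g x - c)) ∂m ≤ 1 + t ^ 2 * v := by
    have h1 : Integrable (fun x => 1 + t * (g x - c)) m :=
      (integrable_const _).add (hd.const_mul t)
    have h2 : Integrable (fun x => t ^ 2 * (g x - c) ^ 2) m := hd2.const_mul _
    calc _ ≤ ∫ x, (1 + t * (g x - c) + t ^ 2 * (g x - c) ^ 2) ∂m :=
          integral_mono hei (h1.add h2) hpt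
      _ = 1 + t ^ 2 * v := by
          rw [integral_add h1 h2, integral_add (integrable_const _) (hd.const_mul t),
            integral_const_mul, integral_const_mul, hd0, hd2v]
          simp
  have h3 : ∀ x, Real.exp (t * (g x - c) - t ^ 2 * v) =
      Real.exp (t * (g x - c)) * Real.exp (-(t ^ 2 * v)) := fun x => by
    rw [← Real.exp_add]; ring_nf
  refine lintegral_exp_le_one_of_integral ?_ ?_
  · simp_rw [h3]; exact hei.mul_const _
  · simp_rw [h3]
    rw [integral_mul_const]
    calc _ ≤ Real.exp (t ^ 2 * v) * Real.exp (-(t ^ 2 * v)) := by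
          gcongr
          exact hint.trans (by linarith [Real.add_one_le_exp (t ^ 2 * v)])
      _ = 1 := by rw [← Real.exp_add]; simp

/-- The exponential inequality behind the lower tail of a sum of variables in `[0, 1]`. -/
lemma lintegral_exp_lower_tail {g : E → ℝ} (hg : Measurable g) (hb : ∀ x, g x ∈ Set.Icc 0 1)
    {κ : ℝ} (hκ : κ ≤ ∫ x, g x ∂m) :
    ∫⁻ x, ENNReal.ofReal (Real.exp (κ / 2 - g x)) ∂m ≤ 1 := by
  have hgi : Integrable g m := integrable_of_mem_Icc m hg hb
  -- `exp (-y) ≤ 1 - y / 2` on `[0, 1]`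
  have hpt : ∀ x, Real.exp (-g x) ≤ 1 - g x / 2 := by
    intro x
    obtain ⟨h0, h1⟩ := hb x
    have h2 : Real.exp (-g x) * (1 + g x) ≤ 1 := by
      calc _ ≤ Real.exp (-g x) * Real.exp (g x) := by
            gcongr; linarith [Real.add_one_le_exp (g x)]
        _ = 1 := by rw [← Real.exp_add]; simp
    nlinarith [mul_nonneg h0 (sub_nonneg.2 h1)]
  have hei : Integrable (fun x => Real.exp (-g x)) m :=
    integrable_of_mem_Icc m (by fun_prop) (a := 0) (b := 1) fun x =>
      ⟨(Real.exp_pos _).le, Real.exp_le_one_iff.2 (by linarith [(hb x).1])⟩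
  have hint : ∫ x, Real.exp (-g x) ∂m ≤ 1 - κ / 2 := by
    calc _ ≤ ∫ x, (1 - g x / 2) ∂m :=
          integral_mono hei ((integrable_const _).sub (hgi.div_const 2)) hpt
      _ = 1 - (∫ x, g x ∂m) / 2 := by
          rw [integral_sub (integrable_const _) (hgi.div_const 2), integral_div]; simp
      _ ≤ _ := by linarith
  have h3 : ∀ x, Real.exp (κ / 2 - g x) = Real.exp (-g x) * Real.exp (κ / 2) := fun x => by
    rw [← Real.exp_add]; ring_nf
  refine lintegral_exp_le_one_of_integral ?_ ?_
  · simp_rw [h3]; exact hei.mul_const _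
  · simp_rw [h3]
    rw [integral_mul_const]
    calc _ ≤ Real.exp (-(κ / 2)) * Real.exp (κ / 2) := by
          gcongr
          exact hint.trans (by linarith [Real.add_one_le_exp (-(κ / 2))])
      _ = 1 := by rw [← Real.exp_add]; simp

end Concentration

/-! ### Weighted least squares and the divergence -/

section Regression

variable {S : Type u} {A : Type v} {K : ℕ}

lemma wnormSq_nonneg (zs : Fin K → S × A) (σ g : S × A → ℝ) : 0 ≤ wnormSq zs σ g :=
  Finset.sum_nonneg fun _ _ => by positivity

lemma one_div_sq_le_one {x : ℝ} (hx : 1 ≤ x) : 1 / x ^ 2 ≤ 1 :=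
  div_le_one_of_le₀ (one_le_pow₀ hx) (sq_nonneg x)

/-- The error of weighted least squares around a function `g` of the class that approximates the
regression function `T`: by minimality of `f` it is controlled by the correlation of `f - g` with
the noise `y - T`. -/
lemma IsLeastSquares.wnormSq_sub_le {F : Finset (S × A → ℝ)} {zs : Fin K → S × A}
    {σ f g T : S × A → ℝ} {y : Fin K → ℝ} (hf : IsLeastSquares F zs σ y f) (hg : g ∈ F)
    (hσ : ∀ z, 1 ≤ σ z) {eps : ℝ} (hT : ∀ z, |g z - T z| ≤ eps) (heps : K * eps ^ 2 ≤ 1)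
    {Q : ℝ} (hnoise : ∑ k, 1 / (σ (zs k)) ^ 2 * (f (zs k) - g (zs k)) * (y k - T (zs k)) ≤
      wnormSq zs σ (fun z => f z - g z) / 4 + Q) :
    wnormSq zs σ (fun z => f z - g z) ≤ 8 * Q + 16 := by
  set W := wnormSq zs σ (fun z => f z - g z) with hW
  have hw : ∀ z, 0 < 1 / (σ z) ^ 2 := fun z => by have := hσ z; positivity
  have hw1 : ∀ z, 1 / (σ z) ^ 2 ≤ 1 := fun z => one_div_sq_le_one (hσ z)
  have hmin := hf.2 g hg
  have hsplit : W = ∑ k, 1 / (σ (zs k)) ^ 2 * (f (zs k) - y k) ^ 2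
      - ∑ k, 1 / (σ (zs k)) ^ 2 * (g (zs k) - y k) ^ 2
      + 2 * ∑ k, 1 / (σ (zs k)) ^ 2 * (f (zs k) - g (zs k)) * (y k - T (zs k))
      + 2 * ∑ k, 1 / (σ (zs k)) ^ 2 * (f (zs k) - g (zs k)) * (T (zs k) - g (zs k)) := by
    rw [hW, wnormSq, Finset.mul_sum, Finset.mul_sum, ← Finset.sum_sub_distrib,
      ← Finset.sum_add_distrib, ← Finset.sum_add_distrib]
    refine Finset.sum_congr rfl fun k _ => ?_
    ring
  -- the misspecification term is absorbed by Young's inequality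
  have hmis : 2 * ∑ k, 1 / (σ (zs k)) ^ 2 * (f (zs k) - g (zs k)) * (T (zs k) - g (zs k)) ≤
      W / 4 + 4 := by
    have h1 : ∀ k, 2 * (1 / (σ (zs k)) ^ 2 * (f (zs k) - g (zs k)) * (T (zs k) - g (zs k))) ≤
        1 / (σ (zs k)) ^ 2 * (f (zs k) - g (zs k)) ^ 2 / 4 + 4 * eps ^ 2 := by
      intro k
      have h2 : (T (zs k) - g (zs k)) ^ 2 ≤ eps ^ 2 := by
        rw [← sq_abs, abs_sub_comm]
        exact pow_le_pow_left₀ (abs_nonneg _) (hT _) 2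
      have h3 : 1 / (σ (zs k)) ^ 2 * (T (zs k) - g (zs k)) ^ 2 ≤ eps ^ 2 :=
        (mul_le_of_le_one_left (sq_nonneg _) (hw1 _)).trans h2
      have h4 : 0 ≤ 1 / (σ (zs k)) ^ 2 *
          ((f (zs k) - g (zs k)) / 2 - 2 * (T (zs k) - g (zs k))) ^ 2 :=
        mul_nonneg (hw _).le (sq_nonneg _)
      nlinarith
    calc _ = ∑ k, 2 * (1 / (σ (zs k)) ^ 2 * (f (zs k) - g (zs k)) * (T (zs k) - g (zs k))) := by
          rw [Finset.mul_sum]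
      _ ≤ ∑ k, (1 / (σ (zs k)) ^ 2 * (f (zs k) - g (zs k)) ^ 2 / 4 + 4 * eps ^ 2) :=
          Finset.sum_le_sum fun k _ => h1 k
      _ = W / 4 + 4 * (K * eps ^ 2) := by
          rw [Finset.sum_add_distrib, ← Finset.sum_div]
          simp only [Finset.sum_const, Finset.card_univ, Fintype.card_fin, nsmul_eq_mul]
          rw [hW, wnormSq]; ring
      _ ≤ _ := by linarith
  linarith

lemma le_divSq {F : Finset (S × A → ℝ)} {f₁ f₂ : S × A → ℝ} (hf₁ : f₁ ∈ F) (hf₂ : f₂ ∈ F)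
    (zs : Fin K → S × A) (σ : S × A → ℝ) (lam : ℝ) (z : S × A) :
    ENNReal.ofReal ((f₁ z - f₂ z) ^ 2) /
      ENNReal.ofReal (wnormSq zs σ (fun y => f₁ y - f₂ y) + lam) ≤ divSq F zs σ lam z := by
  unfold divSq
  exact le_iSup₂_of_le f₁ hf₁ (le_iSup₂_of_le f₂ hf₂ le_rfl)

lemma ofReal_div_le_four_mul {x b b' : ℝ} (h : b ≤ 4 * b') :
    ENNReal.ofReal x / ENNReal.ofReal b' ≤ 4 * (ENNReal.ofReal x / ENNReal.ofReal b) := by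
  have h4 : ENNReal.ofReal 4 = 4 := by simp
  have h3 : (ENNReal.ofReal (4 * b'))⁻¹ ≤ (ENNReal.ofReal b)⁻¹ :=
    ENNReal.inv_le_inv.2 (ENNReal.ofReal_le_ofReal h)
  rw [ENNReal.ofReal_mul (by norm_num), ENNReal.mul_inv (by simp) (by simp), h4] at h3
  rw [div_eq_mul_inv, div_eq_mul_inv, mul_left_comm]
  refine mul_le_mul_right ?_ _
  calc (ENNReal.ofReal b')⁻¹ = 4 * (4⁻¹ * (ENNReal.ofReal b')⁻¹) := by
        rw [← mul_assoc, ENNReal.mul_inv_cancel (by simp) (by simp), one_mul]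
    _ ≤ _ := mul_le_mul_right h3 _

/-- A pointwise comparison of differences with their empirical norm bounds the divergence. -/
lemma div_le_ofReal {F : Finset (S × A → ℝ)} {zs : Fin K → S × A} {σ : S × A → ℝ} {lam d : ℝ}
    (hlam : 0 ≤ lam) (hd : 0 ≤ d) {z : S × A}
    (h : ∀ f₁ ∈ F, ∀ f₂ ∈ F,
      (f₁ z - f₂ z) ^ 2 ≤ d ^ 2 * wnormSq zs σ (fun y => f₁ y - f₂ y)) :
    div F zs σ lam z ≤ ENNReal.ofReal d := by
  have h1 : divSq F zs σ lam z ≤ ENNReal.ofReal d ^ (2 : ℝ) := by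
    refine iSup₂_le fun f₁ hf₁ => iSup₂_le fun f₂ hf₂ => ?_
    rw [ENNReal.ofReal_rpow_of_nonneg hd (by norm_num), Real.rpow_two]
    refine ENNReal.div_le_of_le_mul ?_
    rw [← ENNReal.ofReal_mul (sq_nonneg d)]
    refine ENNReal.ofReal_le_ofReal ((h f₁ hf₁ f₂ hf₂).trans ?_)
    gcongr
    linarith
  calc div F zs σ lam z ≤ (ENNReal.ofReal d ^ (2 : ℝ)) ^ (1 / 2 : ℝ) :=
        ENNReal.rpow_le_rpow h1 (by norm_num)
    _ = _ := by rw [← ENNReal.rpow_mul]; norm_num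

/-- Enlarging the weights by at most a factor of four at most doubles the divergence. -/
lemma div_le_two_mul_div {F : Finset (S × A → ℝ)} {zs : Fin K → S × A} {σ τ : S × A → ℝ}
    {lam : ℝ} (hlam : 0 ≤ lam) (hσ : ∀ z, 1 ≤ σ z) (hτ : ∀ z, 1 ≤ τ z)
    (h : ∀ z, σ z ^ 2 ≤ 4 * τ z ^ 2) (z : S × A) :
    div F zs σ lam z ≤ 2 * div F zs τ lam z := by
  have hw : ∀ g, wnormSq zs τ g + lam ≤ 4 * (wnormSq zs σ g + lam) := by
    intro g
    have : wnormSq zs τ g ≤ 4 * wnormSq zs σ g := by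
      rw [wnormSq, wnormSq, Finset.mul_sum]
      refine Finset.sum_le_sum fun k _ => ?_
      have h1 := hσ (zs k)
      have h2 := hτ (zs k)
      rw [← mul_assoc]
      gcongr
      rw [mul_one_div, div_le_div_iff₀ (by positivity) (by positivity)]
      linarith [h (zs k)]
    linarith
  have h1 : divSq F zs σ lam z ≤ 4 * divSq F zs τ lam z := by
    unfold divSq
    refine iSup₂_le fun f₁ hf₁ => iSup₂_le fun f₂ hf₂ => ?_
    exact (ofReal_div_le_four_mul (hw _)).trans
      (mul_le_mul_right (le_divSq hf₁ hf₂ zs τ lam z) _)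
  have h4 : (4 : ENNReal) ^ (1 / 2 : ℝ) = 2 := by
    rw [show (4 : ENNReal) = 2 ^ (2 : ℝ) by norm_num, ← ENNReal.rpow_mul]
    norm_num
  calc div F zs σ lam z ≤ (4 * divSq F zs τ lam z) ^ (1 / 2 : ℝ) :=
        ENNReal.rpow_le_rpow h1 (by norm_num)
    _ = _ := by rw [ENNReal.mul_rpow_of_nonneg _ _ (by norm_num), h4, div]

/-- A class that contains two functions whose difference is everywhere close to one has a
divergence of order at least `1 / √K`. -/
lemma ofReal_le_mul_div {F : Finset (S × A → ℝ)} {zs : Fin K → S × A} {σ : S × A → ℝ}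
    {lam eps : ℝ} (hlam : 0 ≤ lam) (heps : 0 ≤ eps) (hK : K * eps ^ 2 ≤ 1) (hK1 : 1 ≤ K)
    (hσ : ∀ z, 1 ≤ σ z) {f₁ f₂ : S × A → ℝ} (hf₁ : f₁ ∈ F) (hf₂ : f₂ ∈ F)
    (h : ∀ z, f₁ z - f₂ z ∈ Set.Icc (1 / 2 : ℝ) (3 / 2)) (z : S × A) :
    ENNReal.ofReal eps ≤ ENNReal.ofReal (3 + 2 * √lam) * div F zs σ lam z := by
  have hK1' : (1 : ℝ) ≤ K := by exact_mod_cast hK1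
  have hw : wnormSq zs σ (fun y => f₁ y - f₂ y) ≤ K * (9 / 4) := by
    have : ∀ k, 1 / (σ (zs k)) ^ 2 * (f₁ (zs k) - f₂ (zs k)) ^ 2 ≤ 9 / 4 := by
      intro k
      have h2 : 1 / (σ (zs k)) ^ 2 ≤ 1 := one_div_sq_le_one (hσ (zs k))
      have h3 := h (zs k)
      refine (mul_le_of_le_one_left (sq_nonneg _) h2).trans ?_
      nlinarith [h3.1, h3.2]
    calc _ ≤ ∑ _k : Fin K, (9 / 4 : ℝ) := Finset.sum_le_sum fun k _ => this k
      _ = _ := by simp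
  have h0 := wnormSq_nonneg zs σ (fun y => f₁ y - f₂ y)
  have h2 := le_divSq hf₁ hf₂ zs σ lam z
  have h3 : ENNReal.ofReal ((eps / (3 + 2 * √lam)) ^ 2) ≤ divSq F zs σ lam z := by
    refine le_trans ?_ h2
    rw [ENNReal.le_div_iff_mul_le (Or.inr ?_) (Or.inr ENNReal.ofReal_ne_top)]
    · rw [← ENNReal.ofReal_mul (sq_nonneg _)]
      refine ENNReal.ofReal_le_ofReal ?_
      have h5 : (1 / 4 : ℝ) ≤ (f₁ z - f₂ z) ^ 2 := by nlinarith [(h z).1]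
      refine le_trans ?_ h5
      have hs := Real.sqrt_nonneg lam
      have hs2 := Real.sq_sqrt hlam
      rw [div_pow, div_mul_eq_mul_div, div_le_iff₀ (by positivity)]
      have h6 : wnormSq zs σ (fun y => f₁ y - f₂ y) + lam ≤ K * (9 / 4 + lam) := by nlinarith
      calc eps ^ 2 * (wnormSq zs σ (fun y => f₁ y - f₂ y) + lam)
          ≤ eps ^ 2 * (K * (9 / 4 + lam)) := by gcongr
        _ = (K * eps ^ 2) * (9 / 4 + lam) := by ring
        _ ≤ 1 * (9 / 4 + lam) := by gcongr
        _ ≤ _ := by nlinarith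
    · have : (0 : ℝ) < (f₁ z - f₂ z) ^ 2 := by nlinarith [(h z).1]
      exact (ENNReal.ofReal_pos.2 this).ne'
  have h4 : ENNReal.ofReal (eps / (3 + 2 * √lam)) ≤ div F zs σ lam z := by
    calc _ = (ENNReal.ofReal ((eps / (3 + 2 * √lam)) ^ 2)) ^ (1 / 2 : ℝ) := by
          rw [ENNReal.ofReal_rpow_of_nonneg (sq_nonneg _) (by norm_num), ← Real.sqrt_eq_rpow,
            Real.sqrt_sq (by positivity)]
      _ ≤ _ := ENNReal.rpow_le_rpow h3 (by norm_num)
  calc ENNReal.ofReal eps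
      = ENNReal.ofReal (3 + 2 * √lam) * ENNReal.ofReal (eps / (3 + 2 * √lam)) := by
        rw [← ENNReal.ofReal_mul (by positivity)]
        congr 1
        field_simp
    _ ≤ _ := by gcongr

lemma IsBonus.nonneg {F W : Finset (S × A → ℝ)} {C lam eps β : ℝ} {zs : Fin K → S × A}
    {σ f₀ b : S × A → ℝ} (hb : IsBonus F W C lam eps β zs σ f₀ b) (hf₀ : f₀ ∈ F) (z : S × A) :
    0 ≤ b z := by
  have := hb.lower z f₀ hf₀ (by simp [wnormSq]; positivity)
  simpa using this

lemma IsBonus.le_of_div_le {F W : Finset (S × A → ℝ)} {C lam eps β : ℝ} {zs : Fin K → S × A}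
    {σ f₀ b : S × A → ℝ} (hb : IsBonus F W C lam eps β zs σ f₀ b) (hC : 0 ≤ C) {d : ℝ}
    (hd : 0 ≤ d) (hε : 0 ≤ eps) (hβ : 0 ≤ β) {z : S × A}
    (h : div F zs σ lam z ≤ ENNReal.ofReal d) :
    b z ≤ C * (d * √(β ^ 2 + lam) + eps * β) := by
  have h1 := hb.upper z
  have h2 : ENNReal.ofReal (b z) ≤ ENNReal.ofReal (C * (d * √(β ^ 2 + lam) + eps * β)) := by
    refine h1.trans ?_
    rw [ENNReal.ofReal_mul hC, ENNReal.ofReal_add (by positivity) (by positivity),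
      ENNReal.ofReal_mul hd]
    gcongr
  exact (ENNReal.ofReal_le_ofReal_iff (by positivity)).1 h2

end Regression

section Pointwise

variable {S : Type u} {A : Type v}

lemma clip_mem {b : ℝ} (hb : 0 ≤ b) (x : ℝ) : clip b x ∈ Set.Icc 0 b :=
  ⟨le_max_left _ _, max_le hb (min_le_left _ _)⟩

lemma clip_le_of_le {b x y : ℝ} (h : x ≤ y) (hy : 0 ≤ y) : clip b x ≤ y :=
  max_le hy ((min_le_right _ _).trans h)

lemma le_clip_add {b x y c : ℝ} (hb : y ≤ b) (h : y ≤ x + c) (hc : 0 ≤ c) : y ≤ clip b x + c := by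
  have : min b x ≤ clip b x := le_max_right _ _
  rcases le_total b x with hbx | hbx
  · rw [min_eq_left hbx] at this; linarith
  · rw [min_eq_right hbx] at this; linarith

lemma maxA_le [Nonempty A] {f : S × A → ℝ} {s : S} {c : ℝ} (h : ∀ a, f (s, a) ≤ c) :
    maxA f s ≤ c :=
  ciSup_le h

variable [Fintype A]

lemma le_maxA (f : S × A → ℝ) (s : S) (a : A) : f (s, a) ≤ maxA f s :=
  le_ciSup (f := fun a => f (s, a)) (Set.finite_range _).bddAbove a

lemma measurable_maxA [MeasurableSpace S] [MeasurableSpace A] {f : S × A → ℝ}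
    (hf : Measurable f) : Measurable (maxA f) :=
  Measurable.iSup fun _ => hf.comp (measurable_id.prodMk measurable_const)

lemma maxA_mem [Nonempty A] {f : S × A → ℝ} {a b : ℝ} (h : ∀ z, f z ∈ Set.Icc a b) (s : S) :
    maxA f s ∈ Set.Icc a b :=
  ⟨(h (s, Classical.arbitrary A)).1.trans (le_maxA f s _), maxA_le fun a => (h (s, a)).2⟩

lemma measurable_clip (b : ℝ) : Measurable (clip b) := by
  unfold clip; fun_prop

end Pointwise

section Variance

variable {S : Type u} {A : Type v} [MeasurableSpace S] [MeasurableSpace A] {H : ℕ}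
  (M : MDP S A H) (h : ℕ) (z : S × A)

lemma integrable_sq_of_mem_Icc {X : Type*} [MeasurableSpace X] (m : Measure X)
    [IsFiniteMeasure m] {V : X → ℝ} (hV : Measurable V) {b : ℝ} (hb : ∀ x, V x ∈ Set.Icc 0 b) :
    Integrable (fun x => V x ^ 2) m :=
  integrable_of_mem_Icc m (hV.pow_const 2) (a := 0) (b := b ^ 2)
    fun x => ⟨sq_nonneg _, pow_le_pow_left₀ (hb x).1 (hb x).2 2⟩

variable {V V' : S → ℝ} {b : ℝ}

lemma MDP.bellman₂_sub_sq (hV : Measurable V) (hb : ∀ s, V s ∈ Set.Icc 0 b) :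
    M.bellman₂ h V z - M.bellman h V z ^ 2 = M.condVar h V z := by
  have h1 := integrable_of_mem_Icc (M.P h z) hV hb
  have h2 := integrable_sq_of_mem_Icc (M.P h z) hV hb
  have h3 := integral_sub_const_sq h1 h2 (-M.r h z)
  have h4 : M.bellman₂ h V z = ∫ s', (V s' - -M.r h z) ^ 2 ∂(M.P h z) := by
    simp only [MDP.bellman₂, sub_neg_eq_add, add_comm]
  rw [h4, h3, M.bellman_eq h hV hb, MDP.condVar, MDP.expNext, MDP.expNext]
  ring

lemma MDP.condVar_le_sq (hV : Measurable V) (hb : ∀ s, V s ∈ Set.Icc 0 b) :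
    M.condVar h V z ≤ b ^ 2 := by
  have h1 : M.expNext h (fun s => V s ^ 2) z ≤ b ^ 2 :=
    (M.expNext_mem h (hV.pow_const 2)
      (fun s => ⟨sq_nonneg _, pow_le_pow_left₀ (hb s).1 (hb s).2 2⟩) z).2
  rw [MDP.condVar]
  nlinarith [sq_nonneg (M.expNext h V z)]

/-- Conditional variances of uniformly close functions are comparable. -/
lemma MDP.condVar_le_of_abs_sub_le (hV : Measurable V) (hb : ∀ s, V s ∈ Set.Icc 0 b)
    (hV' : Measurable V') (hb' : ∀ s, V' s ∈ Set.Icc 0 b) {e : ℝ}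
    (he : ∀ s, |V s - V' s| ≤ e) :
    M.condVar h V z ≤ 2 * M.condVar h V' z + 2 * e ^ 2 := by
  have h1 := integrable_of_mem_Icc (M.P h z) hV hb
  have h2 := integrable_sq_of_mem_Icc (M.P h z) hV hb
  have h1' := integrable_of_mem_Icc (M.P h z) hV' hb'
  have h2' := integrable_sq_of_mem_Icc (M.P h z) hV' hb'
  -- the variance is at most the second moment around any centre; take the mean of `V'`
  set c := ∫ s, V' s ∂(M.P h z) with hc
  have e1 := integral_sub_const_sq h1 h2 c
  have e2 := integral_sub_const_sq h1' h2' c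
  have hd : ∀ {V : S → ℝ}, Integrable V (M.P h z) → Integrable (fun s => V s ^ 2) (M.P h z) →
      Integrable (fun s => (V s - c) ^ 2) (M.P h z) := by
    intro V h1 h2
    have : (fun s => (V s - c) ^ 2) = fun s => V s ^ 2 - 2 * c * V s + c ^ 2 := by
      funext s; ring
    rw [this]
    exact (h2.sub (h1.const_mul _)).add (integrable_const _)
  have h3 : ∫ s, (V s - c) ^ 2 ∂(M.P h z) ≤ ∫ s, (2 * (V' s - c) ^ 2 + 2 * e ^ 2) ∂(M.P h z) := by
    refine integral_mono (hd h1 h2) (((hd h1' h2').const_mul 2).add (integrable_const _))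
      fun s => ?_
    have h4 : (V s - V' s) ^ 2 ≤ e ^ 2 := by
      rw [← sq_abs]; exact pow_le_pow_left₀ (abs_nonneg _) (he s) 2
    change (V s - c) ^ 2 ≤ 2 * (V' s - c) ^ 2 + 2 * e ^ 2
    nlinarith [sq_nonneg ((V s - V' s) - (V' s - c))]
  rw [integral_add ((hd h1' h2').const_mul 2) (integrable_const _), integral_const_mul, e1, e2]
    at h3
  simp only [integral_const, probReal_univ, smul_eq_mul, one_mul] at h3
  simp only [MDP.condVar, MDP.expNext]
  nlinarith [sq_nonneg (∫ s, V s ∂(M.P h z) - c)]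

lemma MDP.bellman_mono (hV : Measurable V) (hb : ∀ s, V s ∈ Set.Icc 0 b)
    (hV' : Measurable V') (hb' : ∀ s, V' s ∈ Set.Icc 0 b) {x : ℝ} (hle : ∀ s, V s ≤ V' s + x) :
    M.bellman h V z ≤ M.bellman h V' z + x := by
  have h1 := integrable_of_mem_Icc (M.P h z) hV hb
  have h1' := integrable_of_mem_Icc (M.P h z) hV' hb'
  rw [M.bellman_eq h hV hb, M.bellman_eq h hV' hb', MDP.expNext, MDP.expNext]
  have := integral_mono h1 (h1'.add (integrable_const x)) hle
  rw [integral_add' h1' (integrable_const x)] at this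
  simp only [integral_const, probReal_univ, smul_eq_mul, one_mul] at this
  linarith

lemma MDP.bellman_mem (hV : Measurable V) (hb : ∀ s, V s ∈ Set.Icc 0 b) :
    M.bellman h V z ∈ Set.Icc 0 (b + 1) := by
  rw [M.bellman_eq h hV hb]
  have := M.expNext_mem h hV hb z
  have h2 := M.r_mem h z
  exact ⟨add_nonneg h2.1 this.1, by linarith [this.2, h2.2]⟩

end Variance

/-! ### Pessimism and the decomposition of the suboptimality -/

section Pessimism

variable {S : Type u} {A : Type v} [MeasurableSpace S] [MeasurableSpace A] {H : ℕ}
  {M : MDP S A H} {π : Policy S A}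

/-- A truncated estimate lowered by its confidence width is pessimistic, and it loses at most twice
the width. -/
lemma clip_sub_bellman {h : ℕ} {V : S → ℝ} (hV : Measurable V)
    (hb : ∀ s, V s ∈ Set.Icc 0 ((H : ℝ) - (h + 1))) {z : S × A} {x b eps : ℝ} (h0 : 0 ≤ b)
    (heps : 0 ≤ eps) (hx : |x - M.bellman h V z| ≤ b + eps) :
    clip ((H : ℝ) - h) (x - b - eps) ≤ M.bellman h V z ∧
      M.bellman h V z ≤ clip ((H : ℝ) - h) (x - b - eps) + (2 * b + 2 * eps) := by
  obtain ⟨h1, h2⟩ := M.bellman_mem h z hV hb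
  obtain ⟨h3, h4⟩ := abs_le.1 hx
  exact ⟨clip_le_of_le (by linarith) h1, le_clip_add (by linarith) (by linarith) (by linarith)⟩

variable [Fintype A]

/-- One backward step for an estimate that lies between `T_h V - y` and `T_h V`. -/
lemma MDP.IsOptimal.maxA_close [Nonempty A] (hπ : M.IsOptimal π) {h : ℕ} (hh : h < H) {V : S → ℝ}
    (hV : Measurable V) (hb : ∀ s, V s ∈ Set.Icc 0 (H : ℝ)) {x y : ℝ}
    (hx : ∀ s, V s ≤ M.optValue (h + 1) s ∧ M.optValue (h + 1) s ≤ V s + x)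
    {f : S × A → ℝ}
    (hf : ∀ z, f z ≤ M.bellman h V z ∧ M.bellman h V z ≤ f z + y) (s : S) :
    maxA f s ≤ M.optValue h s ∧ M.optValue h s ≤ maxA f s + (x + y) := by
  have hVs := hπ.measurable_optValue (h + 1)
  have hbs := hπ.optValue_mem (h + 1)
  have h1 : ∀ a, M.bellman h (M.optValue (h + 1)) (s, a) ≤ maxA f s + (x + y) := fun a => by
    have h1 := M.bellman_mono h (s, a) hVs hbs hV hb fun s => (hx s).2
    have h2 := (hf (s, a)).2
    have h3 := le_maxA f s a
    linarith
  constructor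
  · refine maxA_le fun a => (hf (s, a)).1.trans ?_
    refine le_trans ?_ (hπ.bellman_le_optValue hh s a)
    simpa using M.bellman_mono h (s, a) hV hb hVs hbs (x := 0) fun s => by simpa using (hx s).1
  · have h0 : 0 ≤ maxA f s + (x + y) :=
      (M.bellman_mem h (s, Classical.arbitrary A) hVs hbs).1.trans (h1 _)
    rw [← ENNReal.ofReal_le_ofReal_iff h0, hπ.ofReal_optValue_eq hh s]
    calc _ ≤ ∫⁻ _a, ENNReal.ofReal (maxA f s + (x + y)) ∂(π.kernel h s) :=
          lintegral_mono fun a => ENNReal.ofReal_le_ofReal (h1 a)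
      _ = _ := by simp

/-- A policy that is greedy for pessimistic estimates is at least as good as they claim. -/
lemma maxA_le_value_of_greedy [Nonempty A] [MeasurableSingletonClass A] {πhat : Policy S A}
    {f : ℕ → S × A → ℝ} (hm : ∀ h ≤ H, Measurable (maxA (f h)))
    (hb : ∀ h ≤ H, ∀ s, maxA (f h) s ∈ Set.Icc 0 (H : ℝ))
    (hlast : ∀ s, maxA (f H) s = 0)
    (hf : ∀ h < H, ∀ z, f h z ≤ M.bellman h (maxA (f (h + 1))) z)
    (hgreedy : ∀ h < H, ∀ s a, πhat.kernel h s {a} ≠ 0 → ∀ a', f h (s, a') ≤ f h (s, a))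
    {h : ℕ} (hh : h ≤ H) (s : S) : maxA (f h) s ≤ M.value πhat h s := by
  induction hh using Nat.decreasingInduction generalizing s with
  | self => rw [hlast, M.value_last]
  | of_succ h hh ih =>
    rw [← ENNReal.ofReal_le_ofReal_iff (M.value_nonneg _ _ _), M.ofReal_value_eq πhat hh s]
    calc ENNReal.ofReal (maxA (f h) s) = ∫⁻ _a, ENNReal.ofReal (maxA (f h) s)
          ∂(πhat.kernel h s) := by simp
      _ ≤ _ := by
        refine lintegral_mono_ae ?_
        rw [ae_iff_of_countable]
        intro a ha
        refine ENNReal.ofReal_le_ofReal ?_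
        calc maxA (f h) s ≤ f h (s, a) := maxA_le fun a' => hgreedy h hh s a ha a'
          _ ≤ M.bellman h (maxA (f (h + 1))) (s, a) := hf h hh _
          _ ≤ _ := by
            simpa using M.bellman_mono h (s, a) (hm (h + 1) hh) (hb (h + 1) hh)
              (M.measurable_value πhat (h + 1))
              (fun s => ⟨M.value_nonneg _ _ s, M.value_le_horizon _ _ s⟩) (x := 0)
              fun s => by simpa using ih s

/-- Unrolling the Bellman equation of an optimal policy: the gap between the optimal value and
pessimistic estimates is at most the expected sum of their losses along the optimal policy. -/
lemma MDP.IsOptimal.ofReal_sub_maxA_le (hπ : M.IsOptimal π)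
    {f : ℕ → S × A → ℝ} (hm : ∀ h ≤ H, Measurable (maxA (f h)))
    (hb : ∀ h ≤ H, ∀ s, maxA (f h) s ∈ Set.Icc 0 (H : ℝ))
    (hlast : ∀ s, maxA (f H) s = 0)
    (hopt : ∀ h ≤ H, ∀ s, maxA (f h) s ≤ M.optValue h s)
    {y : ℕ → S × A → ℝ}
    (hf : ∀ h < H, ∀ z, M.bellman h (maxA (f (h + 1))) z ≤ f h z + y h z)
    {g : ℕ → S × A → ENNReal} (hg : ∀ h, Measurable (g h))
    (hyg : ∀ h < H, ∀ z, ENNReal.ofReal (y h z) ≤ g h z)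
    (n h : ℕ) (hn : h + n = H) (s : S) :
    ENNReal.ofReal (M.optValue h s - maxA (f h) s) ≤
      ∫⁻ τ, ∑ i : Fin (n + 1), g (h + i) (τ i) ∂(M.rollout π (n + 1) h s) := by
  induction n generalizing h s with
  | zero =>
    obtain rfl : h = H := by omega
    rw [hlast, hπ.optValue_last]
    simp
  | succ n ih =>
    have hh : h < H := by omega
    rw [ENNReal.ofReal_sub _ (hb h hh.le s).1, tsub_le_iff_left, hπ.ofReal_optValue_eq hh,
      M.lintegral_rollout_sum_succ π (n + 1) h s hg]
    calc _ ≤ ∫⁻ a, (ENNReal.ofReal (maxA (f h) s) + (g h (s, a) + ∫⁻ s', ∫⁻ τ,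
            ∑ i : Fin (n + 1), g (h + 1 + i) (τ i) ∂(M.rollout π (n + 1) (h + 1) s')
              ∂(M.P h (s, a)))) ∂(π.kernel h s) := by
          refine lintegral_mono fun a => ?_
          have hV := hm (h + 1) hh
          have hbV := hb (h + 1) hh
          have hVs := hπ.measurable_optValue (h + 1)
          have hbs := hπ.optValue_mem (h + 1)
          have hd : ∀ s, M.optValue (h + 1) s - maxA (f (h + 1)) s ∈ Set.Icc 0 (H : ℝ) :=
            fun s => ⟨sub_nonneg.2 (hopt _ hh s), by linarith [(hbV s).1, (hbs s).2]⟩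
          have e1 : M.bellman h (M.optValue (h + 1)) (s, a) =
              M.bellman h (maxA (f (h + 1))) (s, a) +
                ∫ s', (M.optValue (h + 1) s' - maxA (f (h + 1)) s') ∂(M.P h (s, a)) := by
            rw [M.bellman_eq h hVs hbs, M.bellman_eq h hV hbV,
              integral_sub (integrable_of_mem_Icc _ hVs hbs) (integrable_of_mem_Icc _ hV hbV)]
            simp only [MDP.expNext]
            ring
          have e2 : M.bellman h (maxA (f (h + 1))) (s, a) ≤ maxA (f h) s + y h (s, a) := by
            linarith [hf h hh (s, a), le_maxA (f h) s a]
          calc ENNReal.ofReal (M.bellman h (M.optValue (h + 1)) (s, a))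
              ≤ ENNReal.ofReal (maxA (f h) s + (y h (s, a) + ∫ s', (M.optValue (h + 1) s' -
                  maxA (f (h + 1)) s') ∂(M.P h (s, a)))) :=
                ENNReal.ofReal_le_ofReal (by linarith)
            _ ≤ ENNReal.ofReal (maxA (f h) s) + (ENNReal.ofReal (y h (s, a)) +
                  ENNReal.ofReal (∫ s', (M.optValue (h + 1) s' -
                    maxA (f (h + 1)) s') ∂(M.P h (s, a)))) :=
                ENNReal.ofReal_add_le.trans (add_le_add le_rfl ENNReal.ofReal_add_le)
            _ ≤ _ := by
                refine add_le_add le_rfl (add_le_add (hyg h hh _) ?_)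
                rw [ofReal_integral_eq_lintegral_ofReal
                  (f := fun s => M.optValue (h + 1) s - maxA (f (h + 1)) s)
                  (integrable_of_mem_Icc _ (hVs.sub hV) hd)
                  (Filter.Eventually.of_forall fun s => (hd s).1)]
                exact lintegral_mono fun s' => ih (h + 1) (by omega) s'
      _ = _ := by rw [lintegral_add_left measurable_const]; simp

/-- The suboptimality of a policy that is greedy for pessimistic estimates. -/
lemma MDP.IsOptimal.suboptimality_le [Nonempty A] [MeasurableSingletonClass A] (hπ : M.IsOptimal π)
    {πhat : Policy S A}
    {f : ℕ → S × A → ℝ} (hm : ∀ h ≤ H, Measurable (maxA (f h)))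
    (hb : ∀ h ≤ H, ∀ s, maxA (f h) s ∈ Set.Icc 0 (H : ℝ))
    (hlast : ∀ s, maxA (f H) s = 0)
    (hopt : ∀ h ≤ H, ∀ s, maxA (f h) s ≤ M.optValue h s)
    {y : ℕ → S × A → ℝ}
    (hf : ∀ h < H, ∀ z, f h z ≤ M.bellman h (maxA (f (h + 1))) z ∧
      M.bellman h (maxA (f (h + 1))) z ≤ f h z + y h z)
    (hgreedy : ∀ h < H, ∀ s a, πhat.kernel h s {a} ≠ 0 → ∀ a', f h (s, a') ≤ f h (s, a))
    {g : Fin H → S × A → ENNReal} (hg : ∀ h, Measurable (g h))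
    (hyg : ∀ h : Fin H, ∀ z, ENNReal.ofReal (y h z) ≤ g h z) (s : S) :
    ENNReal.ofReal (M.optValue 0 s - M.value πhat 0 s) ≤
      ∑ h : Fin H, ∫⁻ τ, g h (τ h.castSucc) ∂(M.episodeLaw π (Measure.dirac s)) := by
  let g' : ℕ → S × A → ENNReal := fun h => if hh : h < H then g ⟨h, hh⟩ else 0
  have hg' : ∀ h, Measurable (g' h) := fun h => by
    by_cases hh : h < H
    · simp only [g', hh, dif_pos]; exact hg _
    · simp only [g', hh, dif_neg, not_false_iff]; exact measurable_const
  have hval := maxA_le_value_of_greedy (M := M) hm hb hlast (fun h hh z => (hf h hh z).1) hgreedy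
    (Nat.zero_le H) s
  calc ENNReal.ofReal (M.optValue 0 s - M.value πhat 0 s)
      ≤ ENNReal.ofReal (M.optValue 0 s - maxA (f 0) s) :=
        ENNReal.ofReal_le_ofReal (by linarith)
    _ ≤ ∫⁻ τ, ∑ i : Fin (H + 1), g' (0 + i) (τ i) ∂(M.rollout π (H + 1) 0 s) :=
        hπ.ofReal_sub_maxA_le hm hb hlast hopt (fun h hh z => (hf h hh z).2) hg'
          (fun h hh z => by simpa [g', hh] using hyg ⟨h, hh⟩ z) H 0 (by simp) s
    _ = ∫⁻ τ, ∑ h : Fin H, g h (τ h.castSucc) ∂(M.rollout π (H + 1) 0 s) := by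
        refine lintegral_congr fun τ => ?_
        rw [Fin.sum_univ_castSucc]
        simp [g']
    _ = ∑ h : Fin H, ∫⁻ τ, g h (τ h.castSucc) ∂(M.rollout π (H + 1) 0 s) :=
        lintegral_finsetSum _ fun h _ => (hg h).comp (measurable_pi_apply _)
    _ = _ := by simp_rw [M.lintegral_episodeLaw_dirac π s]

end Pessimism

/-! ### Uniform concentration over the function classes -/

lemma abs_sub_le_iSup {S : Type u} {A : Type v} {L : ℝ} {f₁ f₂ : S × A → ℝ} (h₁ : ∀ z, f₁ z ∈ Set.Icc 0 L)
    (h₂ : ∀ z, f₂ z ∈ Set.Icc 0 L) (z : S × A) : |f₁ z - f₂ z| ≤ ⨆ z, |f₁ z - f₂ z| := by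
  refine le_ciSup (f := fun z => |f₁ z - f₂ z|) ⟨L, ?_⟩ z
  rintro _ ⟨y, rfl⟩
  rw [abs_le]
  constructor <;> linarith [(h₁ y).1, (h₁ y).2, (h₂ y).1, (h₂ y).2]

section Events

variable {S : Type u} {A : Type v} [MeasurableSpace S] [MeasurableSpace A] {H K : ℕ}
  {Ω : Type w} [MeasurableSpace Ω]

/-- An exponential inequality that holds conditionally on the state-action pair of stage `h` holds
for the whole episode. -/
lemma MDP.lintegral_exp_episode_le_one (M : MDP S A H) (μ : Policy S A) (ρ : Measure S)
    [IsProbabilityMeasure ρ] (h : Fin H) {ψ : (S × A) × S → ℝ} (hψ : Measurable ψ)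
    (hexp : ∀ z, ∫⁻ s', ENNReal.ofReal (Real.exp (ψ (z, s'))) ∂(M.P h z) ≤ 1) :
    ∫⁻ τ, ENNReal.ofReal (Real.exp (ψ (τ h.castSucc, (τ h.succ).1))) ∂(M.episodeLaw μ ρ) ≤ 1 := by
  rw [M.lintegral_episodeLaw_pair μ ρ (Φ := fun x => ENNReal.ofReal (Real.exp (ψ x)))
    (by fun_prop) h]
  calc _ ≤ ∫⁻ _z, 1 ∂(M.stageLaw μ ρ h) := lintegral_mono fun z => hexp z
    _ = 1 := by simp

variable (M : MDP S A H) (μ : Policy S A) (ρ : Measure S) [IsProbabilityMeasure ρ]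
  {Pr : Measure Ω} {X : Fin K → Ω → Fin (H + 1) → S × A}

/-- Uniform Hoeffding bound for the correlation of weights `a` with the noise of the targets `u`. -/
lemma exists_event_hoeffding (hX : ∀ k, Measurable (X k)) (hind : iIndepFun X Pr)
    (hlaw : ∀ k, Pr.map (X k) = M.episodeLaw μ ρ) {J : Type*} (I : Finset J) {st : J → Fin H}
    {a : J → S × A → ℝ} (ha : ∀ j ∈ I, Measurable (a j)) {u : J → (S × A) × S → ℝ}
    (hu : ∀ j ∈ I, Measurable (u j)) {R : ℝ} (hR : 0 < R)
    (hb : ∀ j ∈ I, ∀ z, ∃ c, ∀ s', u j (z, s') ∈ Set.Icc c (c + R)) {Λ p : ℝ}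
    (hp : I.card * Real.exp (-Λ) ≤ p) :
    ∃ G : Set Ω, MeasurableSet G ∧ Pr Gᶜ ≤ ENNReal.ofReal p ∧ ∀ ω ∈ G, ∀ j ∈ I,
      ∑ k, a j (pairs (fun k => X k ω) (st j) k) *
        (u j (pairs (fun k => X k ω) (st j) k, nexts (fun k => X k ω) (st j) k) -
          ∫ s', u j (pairs (fun k => X k ω) (st j) k, s')
            ∂(M.P (st j) (pairs (fun k => X k ω) (st j) k))) ≤
      (∑ k, a j (pairs (fun k => X k ω) (st j) k) ^ 2) / 8 + R ^ 2 * Λ := by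
  set ψ : J → (S × A) × S → ℝ := fun j x =>
    (1 / R ^ 2 * a j x.1) * (u j x - ∫ s', u j (x.1, s') ∂(M.P (st j) x.1)) -
      (1 / R ^ 2 * a j x.1) ^ 2 * R ^ 2 / 8 with hψ
  have hψm : ∀ j ∈ I, Measurable (ψ j) := by
    intro j hj
    have h1 : Measurable fun z : S × A => ∫ s', u j (z, s') ∂(M.P (st j) z) :=
      ((hu j hj).stronglyMeasurable.integral_kernel_prod_right' (κ := M.P (st j))).measurable
    have h2 := ha j hj
    have h3 := hu j hj
    have h4 : Measurable fun x : (S × A) × S => ∫ s', u j (x.1, s') ∂(M.P (st j) x.1) :=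
      h1.comp measurable_fst
    simp only [hψ]
    fun_prop
  obtain ⟨G, hG, hPG, hGω⟩ := exists_event_forall_sum_le hX hind hlaw I
    (φ := fun j τ => ψ j (τ (st j).castSucc, (τ (st j).succ).1))
    (fun j hj => by have := hψm j hj; fun_prop)
    (fun j hj => M.lintegral_exp_episode_le_one μ ρ (st j) (hψm j hj) fun z => by
      obtain ⟨c, hc⟩ := hb j hj z
      have := lintegral_exp_hoeffding (m := M.P (st j) z)
        ((hu j hj).comp measurable_prodMk_left) hc (1 / R ^ 2 * a j z)
      simpa [hψ] using this) hp
  refine ⟨G, hG, hPG, fun ω hω j hj => ?_⟩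
  have h1 := hGω ω hω j hj
  have h2 : ∑ k, ψ j (X k ω (st j).castSucc, (X k ω (st j).succ).1) =
      1 / R ^ 2 * (∑ k, a j (pairs (fun k => X k ω) (st j) k) *
        (u j (pairs (fun k => X k ω) (st j) k, nexts (fun k => X k ω) (st j) k) -
          ∫ s', u j (pairs (fun k => X k ω) (st j) k, s')
            ∂(M.P (st j) (pairs (fun k => X k ω) (st j) k))) -
      (∑ k, a j (pairs (fun k => X k ω) (st j) k) ^ 2) / 8) := by
    rw [Finset.sum_div, ← Finset.sum_sub_distrib, Finset.mul_sum]
    refine Finset.sum_congr rfl fun k _ => ?_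
    simp only [hψ, pairs, nexts]
    field_simp
  rw [h2, one_div, inv_mul_le_iff₀ (by positivity)] at h1
  linarith

/-- Uniform Bernstein bound for the correlation of weights `a` with the noise of a fixed target
`g`. -/
lemma exists_event_bernstein (hX : ∀ k, Measurable (X k)) (hind : iIndepFun X Pr)
    (hlaw : ∀ k, Pr.map (X k) = M.episodeLaw μ ρ) {J : Type*} (I : Finset J) {st : J → Fin H}
    {a : J → S × A → ℝ} (ha : ∀ j ∈ I, Measurable (a j)) {g : J → S → ℝ}
    (hg : ∀ j ∈ I, Measurable (g j)) {R : ℝ}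
    (hb : ∀ j ∈ I, ∀ s, g j s ∈ Set.Icc 0 R) {θ : J → ℝ} (hθ : ∀ j ∈ I, 0 < θ j)
    (hθa : ∀ j ∈ I, ∀ z, |θ j * a j z| * R ≤ 1) {Λ p : ℝ}
    (hp : I.card * Real.exp (-Λ) ≤ p) :
    ∃ G : Set Ω, MeasurableSet G ∧ Pr Gᶜ ≤ ENNReal.ofReal p ∧ ∀ ω ∈ G, ∀ j ∈ I,
      ∑ k, a j (pairs (fun k => X k ω) (st j) k) *
        (g j (nexts (fun k => X k ω) (st j) k) -
          M.expNext (st j) (g j) (pairs (fun k => X k ω) (st j) k)) ≤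
      θ j * (∑ k, a j (pairs (fun k => X k ω) (st j) k) ^ 2 *
        M.condVar (st j) (g j) (pairs (fun k => X k ω) (st j) k)) + Λ / θ j := by
  set ψ : J → (S × A) × S → ℝ := fun j x =>
    (θ j * a j x.1) * (g j x.2 - M.expNext (st j) (g j) x.1) -
      (θ j * a j x.1) ^ 2 * M.condVar (st j) (g j) x.1 with hψ
  have hψm : ∀ j ∈ I, Measurable (ψ j) := by
    intro j hj
    have h1 := M.measurable_expNext (st j) (hg j hj)
    have h1' := M.measurable_expNext (st j) ((hg j hj).pow_const 2)
    have h2 := ha j hj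
    have h3 := hg j hj
    have h4 : Measurable (M.condVar (st j) (g j)) := by unfold MDP.condVar; fun_prop
    fun_prop
  obtain ⟨G, hG, hPG, hGω⟩ := exists_event_forall_sum_le hX hind hlaw I
    (φ := fun j τ => ψ j (τ (st j).castSucc, (τ (st j).succ).1))
    (fun j hj => by have := hψm j hj; fun_prop)
    (fun j hj => M.lintegral_exp_episode_le_one μ ρ (st j) (hψm j hj) fun z =>
      lintegral_exp_bernstein (m := M.P (st j) z) (hg j hj) (hb j hj) (hθa j hj z)) hp
  refine ⟨G, hG, hPG, fun ω hω j hj => ?_⟩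
  have h1 := hGω ω hω j hj
  have hθj := hθ j hj
  have h2 : ∑ k, ψ j (X k ω (st j).castSucc, (X k ω (st j).succ).1) =
      θ j * (∑ k, a j (pairs (fun k => X k ω) (st j) k) *
        (g j (nexts (fun k => X k ω) (st j) k) -
          M.expNext (st j) (g j) (pairs (fun k => X k ω) (st j) k)) -
      θ j * (∑ k, a j (pairs (fun k => X k ω) (st j) k) ^ 2 *
        M.condVar (st j) (g j) (pairs (fun k => X k ω) (st j) k))) := by
    simp only [mul_sub (θ j), Finset.mul_sum, ← Finset.sum_sub_distrib]
    refine Finset.sum_congr rfl fun k _ => ?_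
    simp only [hψ, pairs, nexts]
    ring
  rw [h2, mul_comm, ← le_div_iff₀ hθj] at h1
  linarith

/-- On the event that the coverage of the behavior policy is visible in the data `D`, the empirical
norms of differences dominate their sup norms. -/
def EmpiricalCoverage (F : ℕ → Finset (S × A → ℝ)) (κ : ℝ) (D : Fin K → Fin (H + 1) → S × A) :
    Prop :=
  ∀ h : Fin H, ∀ f₁ ∈ F h, ∀ f₂ ∈ F h, K * κ / 4 * (⨆ z, |f₁ z - f₂ z|) ^ 2 ≤
    wnormSq (pairs D h) (fun _ => 1) (fun z => f₁ z - f₂ z)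

variable {M μ ρ}

lemma exists_event_coverage (hX : ∀ k, Measurable (X k)) (hind : iIndepFun X Pr)
    (hlaw : ∀ k, Pr.map (X k) = M.episodeLaw μ ρ) {F : ℕ → Finset (S × A → ℝ)} {L κ : ℝ}
    (hF : ∀ h < H, ∀ f ∈ F h, Measurable f ∧ ∀ z, f z ∈ Set.Icc 0 L)
    (hcov : M.Coverage μ ρ F κ) {Λ p : ℝ} (hΛ : Λ ≤ K * κ / 4)
    (hp : ((Finset.univ : Finset (Fin H)).sigma
      fun h => F h ×ˢ F h).card * Real.exp (-Λ) ≤ p) :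
    ∃ G : Set Ω, MeasurableSet G ∧ Pr Gᶜ ≤ ENNReal.ofReal p ∧ ∀ ω ∈ G,
      EmpiricalCoverage F κ (fun k => X k ω) := by
  classical
  set m : (S × A → ℝ) × (S × A → ℝ) → ℝ := fun q => ⨆ z, |q.1 z - q.2 z| with hm
  let I := (Finset.univ : Finset (Fin H)).sigma fun h => F h ×ˢ F h
  have hI : ∀ {j}, j ∈ I → (j.2.1 ∈ F j.1 ∧ j.2.2 ∈ F j.1) := fun hj => by
    simpa [I] using hj
  have hmem : ∀ j ∈ I, ∀ z, ((j.2.1 z - j.2.2 z) / m j.2) ^ 2 ∈ Set.Icc (0 : ℝ) 1 := by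
    intro j hj z
    refine ⟨sq_nonneg _, ?_⟩
    have h1 := abs_sub_le_iSup (hF _ j.1.2 _ (hI hj).1).2 (hF _ j.1.2 _ (hI hj).2).2 z
    rw [sq_le_one_iff_abs_le_one, abs_div, abs_of_nonneg ((abs_nonneg _).trans h1)]
    exact div_le_one_of_le₀ h1 ((abs_nonneg _).trans h1)
  -- for a vanishing difference the normalization is a division by zero, and the index is dropped
  obtain ⟨G, hG, hPG, hGω⟩ := exists_event_forall_sum_le hX hind hlaw (I.filter fun j => m j.2 ≠ 0)
    (φ := fun j τ => κ / 2 - ((j.2.1 (τ j.1.castSucc) - j.2.2 (τ j.1.castSucc)) / m j.2) ^ 2)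
    (Λ := Λ) (p := p)
    (fun j hj => by
      have hj' := (Finset.mem_filter.1 hj).1
      have h1 := (hF _ j.1.2 _ (hI hj').1).1
      have h2 := (hF _ j.1.2 _ (hI hj').2).1
      fun_prop)
    (fun j hj => by
      obtain ⟨hj', hmj⟩ := Finset.mem_filter.1 hj
      have h1 := (hF _ j.1.2 _ (hI hj').1).1
      have h2 := (hF _ j.1.2 _ (hI hj').2).1
      have h3 : κ ≤ ∫ z, ((j.2.1 z - j.2.2 z) / m j.2) ^ 2 ∂(M.stageLaw μ ρ j.1) := by
        simp_rw [div_pow]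
        rw [integral_div, le_div_iff₀ (by positivity)]
        exact hcov j.1 _ (hI hj').1 _ (hI hj').2
      have h4 := lintegral_exp_lower_tail (m := M.stageLaw μ ρ j.1)
        (g := fun z => ((j.2.1 z - j.2.2 z) / m j.2) ^ 2) (by fun_prop) (hmem j hj') h3
      rw [MDP.stageLaw, lintegral_map (by fun_prop) (measurable_pi_apply _)] at h4
      exact h4)
    (le_trans (by gcongr; exact Finset.filter_subset _ _) hp)
  refine ⟨G, hG, hPG, fun ω hω h f₁ hf₁ f₂ hf₂ => ?_⟩
  by_cases h0 : m (f₁, f₂) = 0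
  · have h0' : (⨆ z, |f₁ z - f₂ z|) = 0 := h0
    rw [h0']
    simpa using wnormSq_nonneg _ _ _
  have h1 := hGω ω hω ⟨h, (f₁, f₂)⟩ (Finset.mem_filter.2 ⟨by simp [I, hf₁, hf₂], h0⟩)
  simp only [Finset.sum_sub_distrib, Finset.sum_const, Finset.card_univ, Fintype.card_fin,
    nsmul_eq_mul, div_pow] at h1
  rw [← Finset.sum_div] at h1
  have h2 : K * κ / 4 ≤ (∑ k, (f₁ (X k ω h.castSucc) - f₂ (X k ω h.castSucc)) ^ 2) /
      m (f₁, f₂) ^ 2 := by linarith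
  rw [le_div_iff₀ (by positivity)] at h2
  simpa [wnormSq, pairs, hm] using h2

end Events

/-! ### The good events of the two phases -/

section Classes

variable {S : Type u} {A : Type v} {H : ℕ}

/-- The finite, data-independent class that contains every pessimistic value estimate of stage `j`
which the algorithm can produce; the estimate after the last stage is zero. -/
def valueClass (H : ℕ) (F : ℕ → Finset (S × A → ℝ)) (W : Finset (S × A → ℝ)) (eps : ℝ) (j : ℕ) :
    Finset (S → ℝ) :=
  open Classical in
  if j < H then (F j ×ˢ W).image fun q => maxA fun z => clip ((H : ℝ) - j) (q.1 z - q.2 z - eps)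
  else {fun _ => 0}

/-- The weight function of the planning phase, as a function of the two regressions of the variance
phase. -/
def sigmaOf (pert : ℝ) (f g : S × A → ℝ) (z : S × A) : ℝ := √(max 1 (g z - f z ^ 2 - pert))

lemma one_le_sigmaOf (pert : ℝ) (f g : S × A → ℝ) (z : S × A) : 1 ≤ sigmaOf pert f g z := by
  rw [sigmaOf, Real.one_le_sqrt]; exact le_max_left _ _

lemma sigmaOf_sq (pert : ℝ) (f g : S × A → ℝ) (z : S × A) :
    sigmaOf pert f g z ^ 2 = max 1 (g z - f z ^ 2 - pert) :=
  Real.sq_sqrt (zero_le_one.trans (le_max_left _ _))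

lemma card_le_complexity (F : ℕ → Finset (S × A → ℝ)) {h : ℕ} (hh : h < H) :
    (F h).card ≤ complexity H F :=
  Finset.le_sup (f := fun h : Fin H => (F h).card) (Finset.mem_univ (⟨h, hh⟩ : Fin H))

lemma card_valueClass_le {F : ℕ → Finset (S × A → ℝ)} {W : Finset (S × A → ℝ)}
    (hNW : 1 ≤ complexity H F * W.card) (eps : ℝ) (j : ℕ) :
    (valueClass H F W eps j).card ≤ complexity H F * W.card := by
  classical
  unfold valueClass
  split_ifs with hj
  · refine Finset.card_image_le.trans ?_
    rw [Finset.card_product]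
    exact Nat.mul_le_mul_right _ (card_le_complexity F hj)
  · simpa using hNW

lemma mem_valueClass {F : ℕ → Finset (S × A → ℝ)} {W : Finset (S × A → ℝ)} {eps : ℝ} {j : ℕ}
    {f b fh : S × A → ℝ} (hj : j < H) (hf : f ∈ F j) (hb : b ∈ W)
    (hfh : ∀ z, fh z = clip ((H : ℝ) - j) (f z - b z - eps)) :
    maxA fh ∈ valueClass H F W eps j := by
  classical
  rw [valueClass, if_pos hj, Finset.mem_image]
  exact ⟨(f, b), by simp [hf, hb], by rw [funext hfh]⟩

lemma zero_mem_valueClass (F : ℕ → Finset (S × A → ℝ)) (W : Finset (S × A → ℝ)) (eps : ℝ) :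
    (fun _ => 0) ∈ valueClass H F W eps H := by
  simp [valueClass]

lemma maxA_zero [Nonempty A] : maxA (fun _ : S × A => (0 : ℝ)) = fun _ => 0 := by
  funext s; simp [maxA]

lemma maxA_mem_valueClass [Nonempty A] {F : ℕ → Finset (S × A → ℝ)}
    {W : Finset (S × A → ℝ)} {eps : ℝ} {est f b : ℕ → S × A → ℝ} (hlast : est H = fun _ => 0)
    (hf : ∀ h : Fin H, f h ∈ F h) (hb : ∀ h : Fin H, b h ∈ W)
    (hspec : ∀ h : Fin H, ∀ z, est h z = clip ((H : ℝ) - (h : ℕ)) (f h z - b h z - eps))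
    {j : ℕ} (hj : j ≤ H) : maxA (est j) ∈ valueClass H F W eps j := by
  rcases hj.lt_or_eq with hj | rfl
  · exact mem_valueClass hj (hf ⟨j, hj⟩) (hb ⟨j, hj⟩) (hspec ⟨j, hj⟩)
  · rw [hlast, maxA_zero]
    exact zero_mem_valueClass F W eps

lemma valueClass_spec [MeasurableSpace S] [MeasurableSpace A] [Fintype A] [Nonempty A]
    {F : ℕ → Finset (S × A → ℝ)} {W : Finset (S × A → ℝ)} {eps : ℝ} {j : ℕ} (hj : j ≤ H)
    (hF : ∀ h < H, ∀ f ∈ F h, Measurable f) (hW : ∀ b ∈ W, Measurable b)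
    {V : S → ℝ} (hV : V ∈ valueClass H F W eps j) :
    Measurable V ∧ ∀ s, V s ∈ Set.Icc 0 ((H : ℝ) - j) := by
  classical
  have h0 : (0 : ℝ) ≤ (H : ℝ) - j := sub_nonneg.2 (by exact_mod_cast hj)
  unfold valueClass at hV
  split_ifs at hV with hjH
  · obtain ⟨q, hq, rfl⟩ := Finset.mem_image.1 hV
    obtain ⟨hq1, hq2⟩ := Finset.mem_product.1 hq
    have h1 := hF j hjH _ hq1
    have h2 := hW _ hq2
    refine ⟨measurable_maxA ?_, maxA_mem fun z => clip_mem h0 _⟩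
    exact (measurable_clip _).comp ((h1.sub h2).sub_const eps)
  · rw [Finset.mem_singleton] at hV
    subst hV
    exact ⟨measurable_const, fun s => ⟨le_rfl, h0⟩⟩

/-- The logarithmic factor pays for a union bound over `H M ^ 5` events. -/
lemma mul_exp_le {K : ℕ} {δ M : ℝ} (hH : 1 ≤ H) (hK : 1 ≤ K) (hδ : 0 < δ) (hδ1 : δ < 1)
    (hM : 2 ≤ M) {n : ℕ} (hn : (n : ℝ) ≤ H * M ^ 5) :
    n * Real.exp (-(16 * (logFactor H K δ * Real.log M))) ≤ δ / 6 := by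
  have hH' : (1 : ℝ) ≤ H := by exact_mod_cast hH
  have hK' : (1 : ℝ) ≤ K := by exact_mod_cast hK
  have hx : 0.69 ≤ Real.log M := by
    have := Real.log_le_log (by norm_num) hM
    linarith [Real.log_two_gt_d9]
  have ht : Real.log (H / δ) ≤ Real.log ((H : ℝ) * K / δ) := by
    refine Real.log_le_log (by positivity) ?_
    gcongr
    nlinarith
  have ht0 : 0 ≤ Real.log (H / δ) := Real.log_nonneg (by
    rw [le_div_iff₀ hδ]; linarith)
  have h1 : 5 * Real.log M + 7 + Real.log (H / δ) ≤ 16 * (logFactor H K δ * Real.log M) := by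
    rw [logFactor]
    nlinarith [mul_nonneg ht0 (sub_nonneg.2 hx), mul_le_mul_of_nonneg_right ht
      (show 0 ≤ Real.log M by linarith)]
  have h2 : (6 : ℝ) ≤ Real.exp 7 := by linarith [Real.add_one_le_exp (7 : ℝ)]
  calc n * Real.exp (-(16 * (logFactor H K δ * Real.log M)))
      ≤ (H * M ^ 5) * Real.exp (-(5 * Real.log M + 7 + Real.log (H / δ))) := by gcongr
    _ = δ / Real.exp 7 := by
        rw [Real.exp_neg, Real.exp_add, Real.exp_add, Real.exp_log (by positivity),
          show (5 : ℝ) * Real.log M = Real.log (M ^ 5) by rw [Real.log_pow]; norm_num,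
          Real.exp_log (by positivity)]
        field_simp
    _ ≤ δ / 6 := by gcongr

end Classes

section Events

variable {S : Type u} {A : Type v} [MeasurableSpace S] [MeasurableSpace A] {H K : ℕ}

/-- The noise bounds needed in the variance phase: first and second moments of the targets, uniformly
over the possible value estimates. -/
def VarianceNoise (M : MDP S A H) (F : ℕ → Finset (S × A → ℝ)) (W : Finset (S × A → ℝ))
    (eps Λ : ℝ) (D : Fin K → Fin (H + 1) → S × A) : Prop :=
  ∀ h : Fin H, ∀ f₁ ∈ F h, ∀ f₂ ∈ F h, ∀ V ∈ valueClass H F W eps (h + 1),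
    (∑ k, (f₁ (pairs D h k) - f₂ (pairs D h k)) *
        (V (nexts D h k) - M.expNext h V (pairs D h k)) ≤
      wnormSq (pairs D h) (fun _ => 1) (fun z => f₁ z - f₂ z) / 8 + (H : ℝ) ^ 2 * Λ) ∧
    (∑ k, (f₁ (pairs D h k) - f₂ (pairs D h k)) *
        ((M.r h (pairs D h k) + V (nexts D h k)) ^ 2 - M.bellman₂ h V (pairs D h k)) ≤
      wnormSq (pairs D h) (fun _ => 1) (fun z => f₁ z - f₂ z) / 8 + (H : ℝ) ^ 4 * Λ)

/-- The noise bound for the optimal value function as regression target, for weights that dominate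
its conditional variance. The level `Λ` has to pay only for a union over the `F h`. -/
def ReferenceNoise (M : MDP S A H) (F : ℕ → Finset (S × A → ℝ)) (pert Λ : ℝ)
    (D : Fin K → Fin (H + 1) → S × A) : Prop :=
  ∀ h : Fin H, ∀ f₁ ∈ F h, ∀ f₂ ∈ F h, ∀ f₃ ∈ F h, ∀ g ∈ F h,
    (∀ z, M.condVar h (M.optValue (h + 1)) z ≤ 4 * sigmaOf pert f₃ g z ^ 2) →
    ∑ k, 1 / sigmaOf pert f₃ g (pairs D h k) ^ 2 * (f₁ (pairs D h k) - f₂ (pairs D h k)) *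
        (M.optValue (h + 1) (nexts D h k) -
          M.expNext h (M.optValue (h + 1)) (pairs D h k)) ≤
      wnormSq (pairs D h) (sigmaOf pert f₃ g) (fun z => f₁ z - f₂ z) / 16 +
        Λ * (64 + H * ⨆ z, |f₁ z - f₂ z|)

/-- The noise bound for the deviation of a value estimate from the optimal value function, over the
estimates with deviation at most `η`. -/
def AdvantageNoise (M : MDP S A H) (F : ℕ → Finset (S × A → ℝ)) (W : Finset (S × A → ℝ))
    (eps pert η Λ : ℝ) (D : Fin K → Fin (H + 1) → S × A) : Prop :=
  ∀ h : Fin H, ∀ f₁ ∈ F h, ∀ f₂ ∈ F h, ∀ f₃ ∈ F h, ∀ g ∈ F h,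
    ∀ V ∈ valueClass H F W eps (h + 1), (∀ s, |V s - M.optValue (h + 1) s| ≤ η) →
    ∑ k, 1 / sigmaOf pert f₃ g (pairs D h k) ^ 2 * (f₁ (pairs D h k) - f₂ (pairs D h k)) *
        ((V (nexts D h k) - M.optValue (h + 1) (nexts D h k)) -
          M.expNext h (fun s => V s - M.optValue (h + 1) s) (pairs D h k)) ≤
      wnormSq (pairs D h) (sigmaOf pert f₃ g) (fun z => f₁ z - f₂ z) / 8 + 4 * η ^ 2 * Λ

variable {Ω : Type w} [MeasurableSpace Ω] {M : MDP S A H} {μ : Policy S A} {ρ : Measure S}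
  [IsProbabilityMeasure ρ] {Pr : Measure Ω} {X : Fin K → Ω → Fin (H + 1) → S × A}
  {F : ℕ → Finset (S × A → ℝ)} {W : Finset (S × A → ℝ)} {L : ℝ}

lemma measurable_sigmaOf (pert : ℝ) {f g : S × A → ℝ} (hf : Measurable f) (hg : Measurable g) :
    Measurable (sigmaOf pert f g) := by
  unfold sigmaOf; fun_prop

/-- A union of two events of small probability. -/
lemma exists_event_inter {Pr : Measure Ω} {p q : ℝ} (hp : 0 ≤ p) (hq : 0 ≤ q) {P Q : Ω → Prop}
    (hP : ∃ G : Set Ω, MeasurableSet G ∧ Pr Gᶜ ≤ ENNReal.ofReal p ∧ ∀ ω ∈ G, P ω)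
    (hQ : ∃ G : Set Ω, MeasurableSet G ∧ Pr Gᶜ ≤ ENNReal.ofReal q ∧ ∀ ω ∈ G, Q ω) :
    ∃ G : Set Ω, MeasurableSet G ∧ Pr Gᶜ ≤ ENNReal.ofReal (p + q) ∧ ∀ ω ∈ G, P ω ∧ Q ω := by
  obtain ⟨G, hG, hGp, hGP⟩ := hP
  obtain ⟨G', hG', hGq, hGQ⟩ := hQ
  refine ⟨G ∩ G', hG.inter hG', ?_, fun ω hω => ⟨hGP ω hω.1, hGQ ω hω.2⟩⟩
  rw [Set.compl_inter, ENNReal.ofReal_add hp hq]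
  exact (measure_union_le _ _).trans (add_le_add hGp hGq)

lemma exists_event_referenceNoise (hX : ∀ k, Measurable (X k))
    (hind : iIndepFun X Pr) (hlaw : ∀ k, Pr.map (X k) = M.episodeLaw μ ρ)
    (hF : ∀ h < H, ∀ f ∈ F h, Measurable f ∧ ∀ z, f z ∈ Set.Icc 0 L)
    (hopt : ∀ h, Measurable (M.optValue h)) (hoptb : ∀ h s, M.optValue h s ∈ Set.Icc (0 : ℝ) H)
    {pert Λ p : ℝ}
    (hp : ((Finset.univ : Finset (Fin H)).sigma fun h => F h ×ˢ F h ×ˢ F h ×ˢ F h).card *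
      Real.exp (-Λ) ≤ p) :
    ∃ G : Set Ω, MeasurableSet G ∧ Pr Gᶜ ≤ ENNReal.ofReal p ∧
      ∀ ω ∈ G, ReferenceNoise M F pert Λ (fun k => X k ω) := by
  classical
  let I := (Finset.univ : Finset (Fin H)).sigma fun h => F h ×ˢ F h ×ˢ F h ×ˢ F h
  have hI : ∀ {j}, j ∈ I → (j.2.1 ∈ F j.1 ∧ j.2.2.1 ∈ F j.1 ∧ j.2.2.2.1 ∈ F j.1 ∧
      j.2.2.2.2 ∈ F j.1) := fun hj => by simpa [I] using hj
  set m : (S × A → ℝ) → (S × A → ℝ) → ℝ := fun f₁ f₂ => ⨆ z, |f₁ z - f₂ z| with hm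
  have hm0 : ∀ f₁ f₂, 0 ≤ m f₁ f₂ := fun f₁ f₂ => Real.iSup_nonneg fun z => abs_nonneg _
  have hpos : ∀ f₁ f₂, 0 < 64 + H * m f₁ f₂ := fun f₁ f₂ => by
    have := hm0 f₁ f₂
    positivity
  -- the rate is small enough for both the range condition and the variance proxy
  obtain ⟨G, hG, hPG, hGω⟩ := exists_event_bernstein M μ ρ hX hind hlaw I (st := fun j => j.1)
    (a := fun j z => 1 / sigmaOf pert j.2.2.2.1 j.2.2.2.2 z ^ 2 * (j.2.1 z - j.2.2.1 z))
    (fun j hj => by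
      have hj' := hI hj
      have h1 := (hF _ j.1.2 _ hj'.1).1
      have h2 := (hF _ j.1.2 _ hj'.2.1).1
      have h3 := measurable_sigmaOf pert (hF _ j.1.2 _ hj'.2.2.1).1 (hF _ j.1.2 _ hj'.2.2.2).1
      fun_prop)
    (g := fun j => M.optValue (j.1 + 1)) (fun j _ => hopt _) (R := H) (fun j _ => hoptb _)
    (θ := fun j => 1 / (64 + H * m j.2.1 j.2.2.1)) (fun j _ => one_div_pos.2 (hpos _ _))
    (fun j hj z => by
      have hj' := hI hj
      have h1 : |j.2.1 z - j.2.2.1 z| ≤ m j.2.1 j.2.2.1 :=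
        abs_sub_le_iSup (hF _ j.1.2 _ hj'.1).2 (hF _ j.1.2 _ hj'.2.1).2 z
      have h2 := one_div_sq_le_one (one_le_sigmaOf pert j.2.2.2.1 j.2.2.2.2 z)
      have h3 : 0 ≤ 1 / sigmaOf pert j.2.2.2.1 j.2.2.2.2 z ^ 2 := by positivity
      have h4 := hpos j.2.1 j.2.2.1
      rw [abs_mul, abs_mul, abs_of_nonneg h3, abs_of_pos (one_div_pos.2 h4), one_div_mul_eq_div,
        div_mul_eq_mul_div, div_le_one h4]
      have h5 : 1 / sigmaOf pert j.2.2.2.1 j.2.2.2.2 z ^ 2 * |j.2.1 z - j.2.2.1 z| ≤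
          m j.2.1 j.2.2.1 := (mul_le_of_le_one_left (abs_nonneg _) h2).trans h1
      have h6 : (0 : ℝ) ≤ H := Nat.cast_nonneg H
      nlinarith) hp
  refine ⟨G, hG, hPG, fun ω hω h f₁ hf₁ f₂ hf₂ f₃ hf₃ g hg hvar => ?_⟩
  have h1 := hGω ω hω ⟨h, f₁, f₂, f₃, g⟩ (by simp [I, hf₁, hf₂, hf₃, hg])
  simp only at h1
  refine h1.trans ?_
  have h2 : ∑ k, (1 / sigmaOf pert f₃ g (pairs (fun k => X k ω) h k) ^ 2 *
      (f₁ (pairs (fun k => X k ω) h k) - f₂ (pairs (fun k => X k ω) h k))) ^ 2 *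
        M.condVar h (M.optValue (h + 1)) (pairs (fun k => X k ω) h k) ≤
      4 * wnormSq (pairs (fun k => X k ω) h) (sigmaOf pert f₃ g) (fun z => f₁ z - f₂ z) := by
    rw [wnormSq, Finset.mul_sum]
    refine Finset.sum_le_sum fun k _ => ?_
    set z := pairs (fun k => X k ω) h k
    have h3 := one_le_sigmaOf pert f₃ g z
    calc _ ≤ (1 / sigmaOf pert f₃ g z ^ 2 * (f₁ z - f₂ z)) ^ 2 *
          (4 * sigmaOf pert f₃ g z ^ 2) := by gcongr; exact hvar z
      _ = _ := by field_simp
  have h3 : (1 : ℝ) / (64 + H * m f₁ f₂) ≤ 1 / 64 := by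
    have := hm0 f₁ f₂
    gcongr
    have : (0 : ℝ) ≤ H * m f₁ f₂ := by positivity
    linarith
  have h4 := wnormSq_nonneg (pairs (fun k => X k ω) h) (sigmaOf pert f₃ g) (fun z => f₁ z - f₂ z)
  rw [div_div_eq_mul_div, div_one]
  refine add_le_add ?_ le_rfl
  calc _ ≤ 1 / (64 + H * m f₁ f₂) *
        (4 * wnormSq (pairs (fun k => X k ω) h) (sigmaOf pert f₃ g) (fun z => f₁ z - f₂ z)) :=
        mul_le_mul_of_nonneg_left h2 (one_div_pos.2 (hpos _ _)).le
    _ ≤ 1 / 64 *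
        (4 * wnormSq (pairs (fun k => X k ω) h) (sigmaOf pert f₃ g) (fun z => f₁ z - f₂ z)) := by
        gcongr
    _ = _ := by ring

variable [Fintype A] [Nonempty A]

lemma exists_event_varianceNoise (hH : 1 ≤ H) (hX : ∀ k, Measurable (X k))
    (hind : iIndepFun X Pr) (hlaw : ∀ k, Pr.map (X k) = M.episodeLaw μ ρ)
    (hF : ∀ h < H, ∀ f ∈ F h, Measurable f) (hW : ∀ b ∈ W, Measurable b) {eps Λ p : ℝ}
    (hp0 : 0 ≤ p)
    (hp : ((Finset.univ : Finset (Fin H)).sigma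
      fun h => F h ×ˢ F h ×ˢ valueClass H F W eps (h + 1)).card * Real.exp (-Λ) ≤ p) :
    ∃ G : Set Ω, MeasurableSet G ∧ Pr Gᶜ ≤ ENNReal.ofReal (p + p) ∧
      ∀ ω ∈ G, VarianceNoise M F W eps Λ (fun k => X k ω) := by
  have hH0 : (0 : ℝ) < H := by exact_mod_cast hH
  have hI : ∀ {j}, j ∈ ((Finset.univ : Finset (Fin H)).sigma
      fun h => F h ×ˢ F h ×ˢ valueClass H F W eps (h + 1)) →
      (j.2.1 ∈ F j.1 ∧ j.2.2.1 ∈ F j.1 ∧ j.2.2.2 ∈ valueClass H F W eps (j.1 + 1)) :=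
    fun hj => by simpa using hj
  have hVc : ∀ {h : Fin H} {V}, V ∈ valueClass H F W eps (h + 1) →
      Measurable V ∧ ∀ s, V s ∈ Set.Icc 0 ((H : ℝ) - 1) := by
    intro h V hV
    have h1 := valueClass_spec (by have := h.2; omega) hF hW hV
    refine ⟨h1.1, fun s => ⟨(h1.2 s).1, (h1.2 s).2.trans ?_⟩⟩
    push_cast
    linarith [(Nat.cast_nonneg h : (0 : ℝ) ≤ (h : ℕ))]
  obtain ⟨G, hG, hPG, hGω⟩ := exists_event_inter hp0 hp0
    (exists_event_hoeffding M μ ρ hX hind hlaw _ (st := fun j => j.1)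
      (a := fun j z => j.2.1 z - j.2.2.1 z)
      (fun j hj => (hF _ j.1.2 _ (hI hj).1).sub (hF _ j.1.2 _ (hI hj).2.1))
      (u := fun j x => j.2.2.2 x.2) (fun j hj => (hVc (hI hj).2.2).1.comp measurable_snd) hH0
      (fun j hj z => ⟨0, fun s => ⟨((hVc (hI hj).2.2).2 s).1, by
        linarith [((hVc (hI hj).2.2).2 s).2]⟩⟩) hp)
    (exists_event_hoeffding M μ ρ hX hind hlaw _ (st := fun j => j.1)
      (a := fun j z => j.2.1 z - j.2.2.1 z)
      (fun j hj => (hF _ j.1.2 _ (hI hj).1).sub (hF _ j.1.2 _ (hI hj).2.1))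
      (u := fun j x => (M.r j.1 x.1 + j.2.2.2 x.2) ^ 2)
      (fun j hj => (((M.measurable_r _).comp measurable_fst).add
        ((hVc (hI hj).2.2).1.comp measurable_snd)).pow_const 2) (pow_pos hH0 2)
      (fun j hj z => ⟨0, fun s => ⟨sq_nonneg _, by
        have h1 := (hVc (hI hj).2.2).2 s
        have h2 := M.r_mem j.1 z
        rw [zero_add]
        exact pow_le_pow_left₀ (add_nonneg h2.1 h1.1) (by linarith [h1.2, h2.2]) 2⟩⟩) hp)
  refine ⟨G, hG, hPG, fun ω hω h f₁ hf₁ f₂ hf₂ V hV => ?_⟩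
  obtain ⟨h1, h2⟩ := hGω ω hω
  have hmem : (⟨h, f₁, f₂, V⟩ : Σ _ : Fin H, (S × A → ℝ) × (S × A → ℝ) × (S → ℝ)) ∈
      ((Finset.univ : Finset (Fin H)).sigma
        fun h => F h ×ˢ F h ×ˢ valueClass H F W eps (h + 1)) := by
    simp [hf₁, hf₂, hV]
  have h3 := h1 _ hmem
  have h4 := h2 _ hmem
  simp only at h3 h4
  rw [← pow_mul] at h4
  simp only [wnormSq, one_pow, div_one, one_mul]
  exact ⟨h3, h4⟩

lemma inv_sq_mul_sq_le {σ x : ℝ} (hσ : 1 ≤ σ) :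
    (1 / σ ^ 2 * x) ^ 2 ≤ 1 / σ ^ 2 * x ^ 2 := by
  have h1 := one_div_sq_le_one hσ
  have h2 : 0 ≤ 1 / σ ^ 2 := by positivity
  nlinarith [mul_nonneg (mul_nonneg h2 (sub_nonneg.2 h1)) (sq_nonneg x)]

lemma exists_event_advantageNoise (hX : ∀ k, Measurable (X k))
    (hind : iIndepFun X Pr) (hlaw : ∀ k, Pr.map (X k) = M.episodeLaw μ ρ)
    (hF : ∀ h < H, ∀ f ∈ F h, Measurable f) (hW : ∀ b ∈ W, Measurable b)
    (hopt : ∀ h, Measurable (M.optValue h)) {eps pert η Λ p : ℝ} (hη : 0 < η)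
    (hp : ((Finset.univ : Finset (Fin H)).sigma fun h => F h ×ˢ F h ×ˢ F h ×ˢ F h ×ˢ
      valueClass H F W eps (h + 1)).card * Real.exp (-Λ) ≤ p) :
    ∃ G : Set Ω, MeasurableSet G ∧ Pr Gᶜ ≤ ENNReal.ofReal p ∧
      ∀ ω ∈ G, AdvantageNoise M F W eps pert η Λ (fun k => X k ω) := by
  classical
  let I := (Finset.univ : Finset (Fin H)).sigma fun h => F h ×ˢ F h ×ˢ F h ×ˢ F h ×ˢ
      valueClass H F W eps (h + 1)
  have hI : ∀ {j}, j ∈ I → (j.2.1 ∈ F j.1 ∧ j.2.2.1 ∈ F j.1 ∧ j.2.2.2.1 ∈ F j.1 ∧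
      j.2.2.2.2.1 ∈ F j.1 ∧ j.2.2.2.2.2 ∈ valueClass H F W eps (j.1 + 1)) :=
    fun hj => by simpa [I] using hj
  have hVc : ∀ {h : Fin H} {V}, V ∈ valueClass H F W eps (h + 1) → Measurable V :=
    fun {h V} hV => (valueClass_spec (by have := h.2; omega) hF hW hV).1
  obtain ⟨G, hG, hPG, hGω⟩ := exists_event_hoeffding M μ ρ hX hind hlaw
    (I.filter fun j => ∀ s, |j.2.2.2.2.2 s - M.optValue (j.1 + 1) s| ≤ η) (st := fun j => j.1)
    (a := fun j z => 1 / sigmaOf pert j.2.2.2.1 j.2.2.2.2.1 z ^ 2 * (j.2.1 z - j.2.2.1 z))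
    (fun j hj => by
      have hj' := hI (Finset.mem_filter.1 hj).1
      have h1 := hF _ j.1.2 _ hj'.1
      have h2 := hF _ j.1.2 _ hj'.2.1
      have h3 := measurable_sigmaOf pert (hF _ j.1.2 _ hj'.2.2.1) (hF _ j.1.2 _ hj'.2.2.2.1)
      fun_prop)
    (u := fun j x => j.2.2.2.2.2 x.2 - M.optValue (j.1 + 1) x.2)
    (fun j hj => by
      have h1 := hVc (hI (Finset.mem_filter.1 hj).1).2.2.2.2
      have h2 := hopt (j.1 + 1)
      fun_prop)
    (R := 2 * η) (by positivity)
    (fun j hj z => ⟨-η, fun s => by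
      have h1 := abs_le.1 ((Finset.mem_filter.1 hj).2 s)
      exact ⟨h1.1, by linarith [h1.2]⟩⟩)
    (le_trans (by gcongr; exact Finset.filter_subset _ _) hp)
  refine ⟨G, hG, hPG, fun ω hω h f₁ hf₁ f₂ hf₂ f₃ hf₃ g hg V hV hVη => ?_⟩
  have h1 := hGω ω hω ⟨h, f₁, f₂, f₃, g, V⟩
    (Finset.mem_filter.2 ⟨by simp [I, hf₁, hf₂, hf₃, hg, hV], hVη⟩)
  simp only at h1
  refine h1.trans ?_
  have h2 : ∑ k, (1 / sigmaOf pert f₃ g (pairs (fun k => X k ω) h k) ^ 2 *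
      (f₁ (pairs (fun k => X k ω) h k) - f₂ (pairs (fun k => X k ω) h k))) ^ 2 ≤
      wnormSq (pairs (fun k => X k ω) h) (sigmaOf pert f₃ g) (fun z => f₁ z - f₂ z) :=
    Finset.sum_le_sum fun k _ => inv_sq_mul_sq_le (one_le_sigmaOf _ _ _ _)
  linarith

end Events

/-! ### Analysis of a run on the good events -/

section Analysis

/-- `2 b̄ + 2 ε` is at most `varConst C lam` times `H ^ 2 √(ℓ log (𝒩 𝒩_b) / (K κ))`. -/
def varConst (C lam : ℝ) : ℝ := C * (78 + 8 * √lam) + 4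

/-- `2 b + 2 ε` is at most `planConst C lam` times `H √(ℓ log 𝒩 / (K κ))`. -/
def planConst (C lam : ℝ) : ℝ := C * (1000 + 16 * √lam) + 4

/-- The square root of the constant in the lower bound on the number of episodes. Its summands keep
the value estimates of the variance phase `1 / 4`-close to the optimal value, those of the planning
phase within the range that pays for the union bound, and the regression errors and the perturbation
of the variance estimator together below `1 / 2`. -/
def rateConst (C lam : ℝ) : ℝ := 4 * varConst C lam + planConst C lam + 226

lemma varConst_pos {C lam : ℝ} (hC : 0 < C) : 0 < varConst C lam := by
  unfold varConst; positivity

lemma planConst_pos {C lam : ℝ} (hC : 0 < C) : 0 < planConst C lam := by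
  unfold planConst; positivity

variable {S : Type u} {A : Type v} [MeasurableSpace S] [MeasurableSpace A] {H : ℕ}

/-- The standing hypotheses of the analysis, with the abbreviations `s = 1 / √(K κ)`,
`a = √(ℓ log 𝒩)` and `b = √(ℓ log (𝒩 𝒩_b))`. -/
structure Regime (M : MDP S A H) (πstar : Policy S A) (F : ℕ → Finset (S × A → ℝ))
    (W : Finset (S × A → ℝ)) (C lam L eps κ : ℝ) (K : ℕ) (s a b : ℝ) : Prop where
  one_le_H : 1 ≤ H
  one_le_K : 1 ≤ K
  C_pos : 0 < C
  lam_nonneg : 0 ≤ lam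
  eps_pos : 0 < eps
  eps_le : eps ≤ s
  K_mul_eps_sq : K * eps ^ 2 ≤ 1
  s_pos : 0 < s
  s_sq : s ^ 2 * (K * κ) = 1
  a_ge : 3 / 4 ≤ a
  a_le_b : a ≤ b
  rate : s * b * H ^ 3 * rateConst C lam ≤ 1
  optimal : M.IsOptimal πstar
  class_spec : ∀ h < H, ∀ f ∈ F h, Measurable f ∧ ∀ z, f z ∈ Set.Icc 0 L
  bonus_measurable : ∀ b ∈ W, Measurable b
  complete : M.Complete F eps

section Rates

variable {M : MDP S A H} {πstar : Policy S A} {F : ℕ → Finset (S × A → ℝ)}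
  {W : Finset (S × A → ℝ)} {C lam L eps κ : ℝ} {K : ℕ} {s a b : ℝ}

lemma Regime.one_le_H' (hR : Regime M πstar F W C lam L eps κ K s a b) : (1 : ℝ) ≤ H := by
  exact_mod_cast hR.one_le_H

lemma Regime.b_pos (hR : Regime M πstar F W C lam L eps κ K s a b) : 0 < b := by
  linarith [hR.a_ge, hR.a_le_b]

lemma Regime.mul_rate_le (hR : Regime M πstar F W C lam L eps κ K s a b) {c : ℝ}
    (hc : c ≤ rateConst C lam) : s * b * H ^ 3 * c ≤ 1 := by
  refine le_trans ?_ hR.rate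
  have := hR.s_pos
  have := hR.b_pos
  gcongr

lemma Regime.mul_le_one (hR : Regime M πstar F W C lam L eps κ K s a b) {c : ℝ} {n : ℕ}
    (hn : n ≤ 3) (hc0 : 0 ≤ c) (hc : c ≤ rateConst C lam) : c * (H ^ n * (s * b)) ≤ 1 := by
  refine le_trans ?_ (hR.mul_rate_le hc)
  have h1 := hR.s_pos
  have h2 := hR.b_pos
  have h3 : (H : ℝ) ^ n ≤ H ^ 3 := pow_le_pow_right₀ hR.one_le_H' hn
  calc c * (H ^ n * (s * b)) ≤ c * (H ^ 3 * (s * b)) := by gcongr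
    _ = _ := by ring

lemma Regime.ge_226 (hR : Regime M πstar F W C lam L eps κ K s a b) :
    226 ≤ rateConst C lam := by
  have h1 := varConst_pos (lam := lam) hR.C_pos
  have h2 := planConst_pos (lam := lam) hR.C_pos
  unfold rateConst
  linarith

lemma Regime.s_le (hR : Regime M πstar F W C lam L eps κ K s a b) : s ≤ 2 * (s * b) := by
  nlinarith [hR.s_pos, hR.a_ge, hR.a_le_b]

/-- A small empirical norm forces a small sup norm. -/
lemma Regime.abs_sub_le (hR : Regime M πstar F W C lam L eps κ K s a b)
    {D : Fin K → Fin (H + 1) → S × A} (hD : EmpiricalCoverage F κ D) (h : Fin H)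
    {f₁ f₂ : S × A → ℝ} (hf₁ : f₁ ∈ F h) (hf₂ : f₂ ∈ F h) {x : ℝ} (hx : 0 ≤ x)
    (hw : wnormSq (pairs D h) (fun _ => 1) (fun z => f₁ z - f₂ z) ≤ x ^ 2) (z : S × A) :
    |f₁ z - f₂ z| ≤ 2 * s * x := by
  have h1 := (hD h f₁ hf₁ f₂ hf₂).trans hw
  have h2 := abs_sub_le_iSup (hR.class_spec h h.2 f₁ hf₁).2 (hR.class_spec h h.2 f₂ hf₂).2 z
  set m := ⨆ z, |f₁ z - f₂ z|
  have hs := hR.s_pos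
  refine h2.trans (abs_le_of_sq_le_sq' ?_ (by positivity)).2
  calc m ^ 2 = 4 * s ^ 2 * (K * κ / 4 * m ^ 2) := by
        linear_combination -(m ^ 2) * hR.s_sq
    _ ≤ 4 * s ^ 2 * x ^ 2 := by gcongr
    _ = _ := by ring

lemma sqrt_sq_add_le {x : ℝ} (hx : 0 ≤ x) {lam : ℝ} (hlam : 0 ≤ lam) :
    √(x ^ 2 + lam) ≤ x + √lam := by
  rw [Real.sqrt_le_left (by positivity)]
  nlinarith [Real.sq_sqrt hlam, mul_nonneg hx (Real.sqrt_nonneg lam)]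

/-- Empirical coverage bounds the divergence uniformly, for weights of order at most `τ`. -/
lemma Regime.div_le (hR : Regime M πstar F W C lam L eps κ K s a b)
    {D : Fin K → Fin (H + 1) → S × A} (hD : EmpiricalCoverage F κ D) (h : Fin H)
    {σ : S × A → ℝ} {τ : ℝ} (hσ : ∀ z, 1 ≤ σ z) (hτ : ∀ z, σ z ^ 2 ≤ τ ^ 2) (hτ0 : 0 ≤ τ)
    (z : S × A) : div (F h) (pairs D h) σ lam z ≤ ENNReal.ofReal (2 * s * τ) := by
  have hs := hR.s_pos
  refine div_le_ofReal hR.lam_nonneg (by positivity) fun f₁ hf₁ f₂ hf₂ => ?_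
  set w := wnormSq (pairs D h) σ (fun z => f₁ z - f₂ z) with hw
  have hw0 : 0 ≤ w := wnormSq_nonneg _ _ _
  have h1 : wnormSq (pairs D h) (fun _ => 1) (fun z => f₁ z - f₂ z) ≤ (τ * √w) ^ 2 := by
    rw [mul_pow, Real.sq_sqrt hw0, hw, wnormSq, wnormSq, Finset.mul_sum]
    refine Finset.sum_le_sum fun k _ => ?_
    have h2 := hσ (pairs D h k)
    rw [one_pow, div_one, one_mul, ← mul_assoc, mul_one_div]
    refine le_mul_of_one_le_left (sq_nonneg _) ?_
    rw [one_le_div (by positivity)]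
    exact hτ _
  have h2 := hR.abs_sub_le hD h hf₁ hf₂ (by positivity) h1 z
  calc (f₁ z - f₂ z) ^ 2 = |f₁ z - f₂ z| ^ 2 := (sq_abs _).symm
    _ ≤ (2 * s * (τ * √w)) ^ 2 := by gcongr
    _ = (2 * s * τ) ^ 2 * (√w) ^ 2 := by ring
    _ = _ := by rw [Real.sq_sqrt hw0]

variable [Fintype A] [Nonempty A]

lemma Regime.valueClass_spec (hR : Regime M πstar F W C lam L eps κ K s a b) {j : ℕ}
    (hj : j ≤ H) {V : S → ℝ} (hV : V ∈ valueClass H F W eps j) :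
    Measurable V ∧ (∀ s, V s ∈ Set.Icc 0 ((H : ℝ) - j)) ∧ ∀ s, V s ∈ Set.Icc 0 (H : ℝ) := by
  obtain ⟨h1, h2⟩ := OfflineRL.valueClass_spec hj (fun h hh f hf => (hR.class_spec h hh f hf).1)
    hR.bonus_measurable hV
  exact ⟨h1, h2, fun s => ⟨(h2 s).1, (h2 s).2.trans (by simp)⟩⟩

/-- First and second moment regression errors of the variance phase. -/
lemma Regime.variance_regression (hR : Regime M πstar F W C lam L eps κ K s a b)
    {D : Fin K → Fin (H + 1) → S × A} (hN : VarianceNoise M F W eps (16 * b ^ 2) D) (h : Fin H)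
    {V : S → ℝ} (hV : V ∈ valueClass H F W eps (h + 1)) {f g : S × A → ℝ}
    (hf : IsLeastSquares (F h) (pairs D h) (fun _ => 1)
      (fun k => M.r h (pairs D h k) + V (nexts D h k)) f)
    (hg : IsLeastSquares (F h) (pairs D h) (fun _ => 1)
      (fun k => (M.r h (pairs D h k) + V (nexts D h k)) ^ 2) g) :
    (∃ f₀ ∈ F h, (∀ z, |f₀ z - M.bellman h V z| ≤ eps) ∧
      wnormSq (pairs D h) (fun _ => 1) (fun z => f₀ z - f z) ≤ (13 * b * H) ^ 2) ∧
    (∃ g₀ ∈ F h, (∀ z, |g₀ z - M.bellman₂ h V z| ≤ eps) ∧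
      wnormSq (pairs D h) (fun _ => 1) (fun z => g₀ z - g z) ≤ (13 * b * H ^ 2) ^ 2) := by
  obtain ⟨hVm, hVb, hVH⟩ := hR.valueClass_spec (by have := h.2; omega) hV
  obtain ⟨⟨f₀, hf₀, hf₀T⟩, g₀, hg₀, hg₀T⟩ := hR.complete h h.2 V hVm hVH
  have hH := hR.one_le_H'
  have hb : 1 / 2 ≤ b ^ 2 := by nlinarith [hR.a_ge, hR.a_le_b]
  have hsymm : ∀ f g : S × A → ℝ, wnormSq (pairs D h) (fun _ => 1) (fun z => f z - g z) =
      wnormSq (pairs D h) (fun _ => 1) (fun z => g z - f z) := fun f g =>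
    Finset.sum_congr rfl fun k _ => by ring
  refine ⟨⟨f₀, hf₀, hf₀T, ?_⟩, ⟨g₀, hg₀, hg₀T, ?_⟩⟩
  · have h1 := (hN h f hf.1 f₀ hf₀ V hV).1
    have h0 := wnormSq_nonneg (pairs D h) (fun _ => 1) (fun z => f z - f₀ z)
    have h2 := hf.wnormSq_sub_le hf₀ (fun _ => le_rfl) hf₀T hR.K_mul_eps_sq
      (Q := (H : ℝ) ^ 2 * (16 * b ^ 2)) (by
        refine le_trans (le_of_eq ?_) (h1.trans (by linarith))
        refine Finset.sum_congr rfl fun k _ => ?_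
        rw [M.bellman_eq h hVm hVb]
        ring)
    have h3 : 1 / 2 ≤ (H : ℝ) ^ 2 * b ^ 2 :=
      hb.trans (le_mul_of_one_le_left (sq_nonneg b) (one_le_pow₀ hH))
    rw [hsymm]
    linarith
  · have h1 := (hN h g hg.1 g₀ hg₀ V hV).2
    have h0 := wnormSq_nonneg (pairs D h) (fun _ => 1) (fun z => g z - g₀ z)
    have h2 := hg.wnormSq_sub_le hg₀ (fun _ => le_rfl) hg₀T hR.K_mul_eps_sq
      (Q := (H : ℝ) ^ 4 * (16 * b ^ 2)) (by
        refine le_trans (le_of_eq ?_) (h1.trans (by linarith))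
        refine Finset.sum_congr rfl fun k _ => ?_
        ring)
    have h3 : 1 / 2 ≤ (H : ℝ) ^ 4 * b ^ 2 :=
      hb.trans (le_mul_of_one_le_left (sq_nonneg b) (one_le_pow₀ hH))
    rw [hsymm]
    linarith

/-- Regression errors of order `H ^ 2 √(ℓ log (𝒩 𝒩_b) / (K κ))` and a value estimate within `1 / 4`
of the optimal value make the weights comparable with the truncated conditional variance of the
optimal value. -/
lemma Regime.sigmaOf_comparable (hR : Regime M πstar F W C lam L eps κ K s a b) (h : Fin H)
    {V : S → ℝ} (hV : V ∈ valueClass H F W eps (h + 1))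
    (hclose : ∀ s, |V s - M.optValue (h + 1) s| ≤ 1 / 4) {f g : S × A → ℝ} (z : S × A)
    (hf : |f z - M.bellman h V z| ≤ 28 * (H * (s * b)))
    (hg : |g z - M.bellman₂ h V z| ≤ 28 * (H ^ 2 * (s * b))) :
    M.condVar h (M.optValue (h + 1)) z ≤ 4 * sigmaOf (H ^ 3 * (s * b)) f g z ^ 2 ∧
      sigmaOf (H ^ 3 * (s * b)) f g z ^ 2 ≤ 4 * M.truncVar h z := by
  obtain ⟨hVm, hVb, hVH⟩ := hR.valueClass_spec (by have := h.2; omega) hV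
  have hH := hR.one_le_H'
  have h226 := hR.ge_226
  have hsb : 0 < s * b := mul_pos hR.s_pos hR.b_pos
  have hTV : M.bellman h V z ∈ Set.Icc 0 (H : ℝ) := by
    have h1 := M.bellman_mem h z hVm hVb
    refine ⟨h1.1, h1.2.trans ?_⟩
    push_cast
    linarith [(Nat.cast_nonneg h : (0 : ℝ) ≤ (h : ℕ))]
  have hvar := M.bellman₂_sub_sq h z hVm hVb
  have e1 : 28 * ((H : ℝ) * (s * b)) ≤ 1 := by
    simpa using hR.mul_le_one (n := 1) (by norm_num) (by norm_num) (c := 28) (by linarith)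
  have e3 : 226 * ((H : ℝ) ^ 3 * (s * b)) ≤ 1 :=
    hR.mul_le_one le_rfl (by norm_num) h226
  have e23 : (H : ℝ) ^ 2 * (s * b) ≤ H ^ 3 * (s * b) := by gcongr; norm_num
  -- the square of the first moment regression
  have hf2 : |f z ^ 2 - M.bellman h V z ^ 2| ≤ 84 * (H ^ 2 * (s * b)) := by
    have h1 : |f z + M.bellman h V z| ≤ 3 * H := by
      calc |f z + M.bellman h V z| = |(f z - M.bellman h V z) + 2 * M.bellman h V z| := by
            ring_nf
        _ ≤ |f z - M.bellman h V z| + |2 * M.bellman h V z| := abs_add_le _ _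
        _ ≤ 1 + 2 * H := by
            rw [abs_of_nonneg (show 0 ≤ 2 * M.bellman h V z by linarith [hTV.1])]
            linarith [hTV.2]
        _ ≤ 3 * H := by linarith
    calc _ = |f z - M.bellman h V z| * |f z + M.bellman h V z| := by
          rw [← abs_mul]; ring_nf
      _ ≤ (28 * (H * (s * b))) * (3 * H) := by gcongr
      _ = _ := by ring
  have h0 : 0 ≤ (H : ℝ) ^ 3 * (s * b) := by positivity
  obtain ⟨f1, f2⟩ := abs_le.1 hf2
  obtain ⟨g1, g2⟩ := abs_le.1 hg
  have hVs := hR.optimal.measurable_optValue (h + 1)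
  have hVsb := hR.optimal.optValue_mem (h + 1)
  have v1 := M.condVar_le_of_abs_sub_le h z hVm hVH hVs hVsb hclose
  have v2 := M.condVar_le_of_abs_sub_le h z hVs hVsb hVm hVH
    (fun s => by rw [abs_sub_comm]; exact hclose s)
  rw [sigmaOf_sq, MDP.truncVar]
  set arg := g z - f z ^ 2 - H ^ 3 * (s * b)
  set vs := M.condVar h (M.optValue (h + 1)) z
  have l1 := le_max_left 1 arg
  have l2 := le_max_right 1 arg
  have l3 := le_max_left 1 vs
  have l4 := le_max_right 1 vs
  constructor
  · linarith
  · exact max_le (by linarith) (by linarith)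

end Rates

end Analysis

/-! ### The variance phase and the planning phase -/

section Phases

variable {S : Type u} {A : Type v} [MeasurableSpace S] [MeasurableSpace A] [Fintype A] [Nonempty A]
  {H : ℕ} {M : MDP S A H} {πstar : Policy S A} {F : ℕ → Finset (S × A → ℝ)}
  {W : Finset (S × A → ℝ)} {C lam L eps κ : ℝ} {K : ℕ} {s a b : ℝ}

/-- Backward induction: an estimate that is pessimistic and loses at most `y` at every stage stays
within `H y` of the optimal value. Each step may use the closeness of the next stage. -/
lemma Regime.estimate_close (hR : Regime M πstar F W C lam L eps κ K s a b)
    {est : ℕ → S × A → ℝ} (hest : ∀ h ≤ H, maxA (est h) ∈ valueClass H F W eps h)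
    (hlast : est H = fun _ => 0) {y : ℝ} (hy : 0 ≤ y)
    (hstep : ∀ h : Fin H, (∀ x, |maxA (est (h + 1)) x - M.optValue (h + 1) x| ≤ H * y) →
      ∀ z, est h z ≤ M.bellman h (maxA (est (h + 1))) z ∧
        M.bellman h (maxA (est (h + 1))) z ≤ est h z + y) {h : ℕ} (hh : h ≤ H) (x : S) :
    maxA (est h) x ≤ M.optValue h x ∧ |maxA (est h) x - M.optValue h x| ≤ H * y := by
  suffices key : ∀ x, maxA (est h) x ≤ M.optValue h x ∧
      M.optValue h x ≤ maxA (est h) x + ((H : ℝ) - h) * y by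
    refine ⟨(key x).1, ?_⟩
    rw [abs_sub_comm, abs_of_nonneg (by linarith [(key x).1])]
    have h0 : 0 ≤ (h : ℝ) * y := by positivity
    linarith [(key x).2]
  clear x
  induction hh using Nat.decreasingInduction with
  | self =>
    intro x
    rw [hlast, maxA_zero, hR.optimal.optValue_last]
    simp
  | of_succ h hh ih =>
    intro x
    obtain ⟨hVm, -, hVH⟩ := hR.valueClass_spec hh (hest (h + 1) hh)
    have hcl : ∀ x, |maxA (est (h + 1)) x - M.optValue (h + 1) x| ≤ H * y := by
      intro x
      rw [abs_sub_comm, abs_of_nonneg (by linarith [(ih x).1])]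
      have h0 : 0 ≤ ((h + 1 : ℕ) : ℝ) * y := by positivity
      linarith [(ih x).2]
    have h1 := hR.optimal.maxA_close hh hVm hVH ih (hstep ⟨h, hh⟩ hcl) x
    refine ⟨h1.1, h1.2.trans (le_of_eq ?_)⟩
    push_cast
    ring

/-- A regression within the confidence radius, lowered by its bonus and truncated, is pessimistic
and loses at most twice the width. -/
lemma Regime.pessimistic_of_bonus (hR : Regime M πstar F W C lam L eps κ K s a b)
    {D : Fin K → Fin (H + 1) → S × A} (h : Fin H) {V : S → ℝ}
    (hV : V ∈ valueClass H F W eps (h + 1)) {σ : S × A → ℝ} {β : ℝ} {f₀ f bon est : S × A → ℝ}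
    (hf : f ∈ F h) (hf₀ : f₀ ∈ F h) (hf₀T : ∀ z, |f₀ z - M.bellman h V z| ≤ eps)
    (hbon : IsBonus (F h) W C lam eps β (pairs D h) σ f bon)
    (hw : wnormSq (pairs D h) σ (fun z => f₀ z - f z) ≤ β ^ 2)
    (hest : ∀ z, est z = clip ((H : ℝ) - (h : ℕ)) (f z - bon z - eps)) (z : S × A) :
    est z ≤ M.bellman h V z ∧ M.bellman h V z ≤ est z + (2 * bon z + 2 * eps) := by
  obtain ⟨hVm, hVb, -⟩ := hR.valueClass_spec (by have := h.2; omega) hV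
  rw [hest]
  refine clip_sub_bellman hVm (fun s => by simpa using hVb s) (hbon.nonneg hf z)
    hR.eps_pos.le ?_
  calc |f z - M.bellman h V z| = |(f z - f₀ z) + (f₀ z - M.bellman h V z)| := by ring_nf
    _ ≤ |f z - f₀ z| + |f₀ z - M.bellman h V z| := abs_add_le _ _
    _ ≤ bon z + eps := by
        refine add_le_add ?_ (hf₀T z)
        rw [abs_sub_comm]
        exact hbon.lower z f₀ hf₀ hw

variable {βbar β : ℕ → ℝ} {pert : ℝ} {Dbar D : Fin K → Fin (H + 1) → S × A} {R : Run S A}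

/-- The variance phase: the estimated weights are comparable with the truncated conditional variance
of the optimal value function. -/
lemma Regime.sigmaHat_comparable (hR : Regime M πstar F W C lam L eps κ K s a b)
    (hrun : IsRun M F W C lam eps βbar β pert Dbar D R)
    (hcov : EmpiricalCoverage F κ Dbar) (hN : VarianceNoise M F W eps (16 * b ^ 2) Dbar)
    (hβ : ∀ h < H, 13 * b * H ≤ βbar h ∧ βbar h ≤ 13 * b * H ^ 2) (h : Fin H) (z : S × A) :
    M.condVar h (M.optValue (h + 1)) z ≤
        4 * sigmaOf (H ^ 3 * (s * b)) (R.fbar h) (R.gbar h) z ^ 2 ∧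
      sigmaOf (H ^ 3 * (s * b)) (R.fbar h) (R.gbar h) z ^ 2 ≤ 4 * M.truncVar h z := by
  have hH := hR.one_le_H'
  have hs := hR.s_pos
  have hb := hR.b_pos
  have hsb : 0 < s * b := mul_pos hs hb
  have hC := hR.C_pos
  have hsle := hR.s_le
  have hl := Real.sqrt_nonneg lam
  have hvc : ∀ h ≤ H, maxA (R.fcheck h) ∈ valueClass H F W eps h := fun h hh =>
    maxA_mem_valueClass hrun.fcheck_last (fun h => (hrun.fbar_spec h).1)
      (fun h => (hrun.bbar_spec h).mem) hrun.fcheck_spec hh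
  have hreg := fun h : Fin H => hR.variance_regression hN h (hvc (h + 1) h.2)
    (hrun.fbar_spec h) (hrun.gbar_spec h)
  have hwidth : ∀ (h : Fin H) z,
      2 * R.bbar h z + 2 * eps ≤ varConst C lam * (H ^ 2 * (s * b)) := by
    intro h z
    obtain ⟨hβ1, hβ2⟩ := hβ h h.2
    have hβ0 : 0 ≤ βbar h := le_trans (by positivity) hβ1
    have h1 := (hrun.bbar_spec h).le_of_div_le hC.le (d := 2 * s * 1) (by positivity)
      hR.eps_pos.le hβ0
      (hR.div_le hcov h (fun _ => le_rfl) (fun _ => le_rfl) zero_le_one z)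
    have h2 := sqrt_sq_add_le hβ0 hR.lam_nonneg
    have e1 : s ≤ 2 * (H ^ 2 * (s * b)) := by
      have : s * b ≤ H ^ 2 * (s * b) := le_mul_of_one_le_left hsb.le (one_le_pow₀ hH)
      linarith
    have h3 : 2 * s * 1 * √(βbar h ^ 2 + lam) + eps * βbar h ≤
        (39 + 4 * √lam) * (H ^ 2 * (s * b)) := by
      calc _ ≤ 2 * s * 1 * (βbar h + √lam) + s * βbar h := by
            gcongr
            exact hR.eps_le
        _ = 3 * s * βbar h + 2 * √lam * s := by ring
        _ ≤ 3 * s * (13 * b * H ^ 2) + 2 * √lam * (2 * (H ^ 2 * (s * b))) := by gcongr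
        _ = _ := by ring
    have h4 := h1.trans (mul_le_mul_of_nonneg_left h3 hC.le)
    have h5 := hR.eps_le
    unfold varConst
    linarith
  have hHy : H * (varConst C lam * (H ^ 2 * (s * b))) ≤ 1 / 4 := by
    have h1 := hR.mul_le_one (n := 3) le_rfl (c := 4 * varConst C lam)
      (by have := varConst_pos (lam := lam) hC; positivity)
      (by have := planConst_pos (lam := lam) hC; unfold rateConst; linarith)
    linarith
  have hclose := fun x => (hR.estimate_close hvc hrun.fcheck_last
    (y := varConst C lam * (H ^ 2 * (s * b)))
    (by have := varConst_pos (lam := lam) hC; positivity) (fun h _ z => by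
      obtain ⟨⟨f₀, hf₀, hf₀T, hw⟩, -⟩ := hreg h
      have h1 := hR.pessimistic_of_bonus h (hvc (h + 1) h.2) (hrun.fbar_spec h).1 hf₀ hf₀T
        (hrun.bbar_spec h) (hw.trans ?_) (hrun.fcheck_spec h) z
      · exact ⟨h1.1, h1.2.trans (by linarith [hwidth h z])⟩
      · exact pow_le_pow_left₀ (by positivity) (hβ h h.2).1 2) h.2 x).2.trans hHy
  obtain ⟨⟨f₀, hf₀, hf₀T, hfw⟩, g₀, hg₀, hg₀T, hgw⟩ := hreg h
  have hf1 := hR.abs_sub_le hcov h hf₀ (hrun.fbar_spec h).1 (by positivity) hfw z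
  have hg1 := hR.abs_sub_le hcov h hg₀ (hrun.gbar_spec h).1 (by positivity) hgw z
  have heps := hR.eps_le
  refine hR.sigmaOf_comparable h (hvc (h + 1) h.2) hclose z ?_ ?_
  · calc _ = |(f₀ z - M.bellman h (maxA (R.fcheck (h + 1))) z) - (f₀ z - R.fbar h z)| := by
          ring_nf
      _ ≤ _ := abs_sub _ _
      _ ≤ eps + 2 * s * (13 * b * H) := add_le_add (hf₀T z) hf1
      _ ≤ _ := by
          have : s * b ≤ H * (s * b) := le_mul_of_one_le_left hsb.le hH
          linarith
  · calc _ = |(g₀ z - M.bellman₂ h (maxA (R.fcheck (h + 1))) z) - (g₀ z - R.gbar h z)| := by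
          ring_nf
      _ ≤ _ := abs_sub _ _
      _ ≤ eps + 2 * s * (13 * b * H ^ 2) := add_le_add (hg₀T z) hg1
      _ ≤ _ := by
          have : s * b ≤ H ^ 2 * (s * b) := le_mul_of_one_le_left hsb.le (one_le_pow₀ hH)
          linarith

/-- The weighted regression of the planning phase. The noise is split into that of the optimal value
function, which has conditional variance of the order of the weights, and that of the deviation
`V - V*`, which is so small that the union bound over the value estimates is affordable. -/
lemma Regime.planning_regression (hR : Regime M πstar F W C lam L eps κ K s a b)
    (hcov : EmpiricalCoverage F κ D) (hRef : ReferenceNoise M F pert (16 * a ^ 2) D)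
    (hAdv : AdvantageNoise M F W eps pert (a / b) (16 * b ^ 2) D) (h : Fin H)
    {V : S → ℝ} (hV : V ∈ valueClass H F W eps (h + 1))
    (hclose : ∀ s, |V s - M.optValue (h + 1) s| ≤ a / b) {f₁ g₁ f : S × A → ℝ}
    (hf₁ : f₁ ∈ F h) (hg₁ : g₁ ∈ F h)
    (hσ1 : ∀ z, M.condVar h (M.optValue (h + 1)) z ≤ 4 * sigmaOf pert f₁ g₁ z ^ 2)
    (hσ2 : ∀ z, sigmaOf pert f₁ g₁ z ^ 2 ≤ (2 * H) ^ 2)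
    (hf : IsLeastSquares (F h) (pairs D h) (sigmaOf pert f₁ g₁)
      (fun k => M.r h (pairs D h k) + V (nexts D h k)) f) :
    ∃ f₀ ∈ F h, (∀ z, |f₀ z - M.bellman h V z| ≤ eps) ∧
      wnormSq (pairs D h) (sigmaOf pert f₁ g₁) (fun z => f₀ z - f z) ≤ (100 * a) ^ 2 := by
  obtain ⟨hVm, hVb, hVH⟩ := hR.valueClass_spec (by have := h.2; omega) hV
  obtain ⟨⟨f₀, hf₀, hf₀T⟩, -⟩ := hR.complete h h.2 V hVm hVH
  refine ⟨f₀, hf₀, hf₀T, ?_⟩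
  have hH := hR.one_le_H'
  have hs := hR.s_pos
  have hb := hR.b_pos
  have ha : 0 < a := by linarith [hR.a_ge]
  have ha2 : 1 / 2 ≤ a ^ 2 := by nlinarith [hR.a_ge]
  set σ := sigmaOf pert f₁ g₁ with hσ
  have hσ0 : ∀ z, 1 ≤ σ z := one_le_sigmaOf pert f₁ g₁
  have hsymm : wnormSq (pairs D h) σ (fun z => f₀ z - f z) =
      wnormSq (pairs D h) σ (fun z => f z - f₀ z) :=
    Finset.sum_congr rfl fun k _ => by ring
  have h1 := hRef h f hf.1 f₀ hf₀ f₁ hf₁ g₁ hg₁ hσ1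
  have h2 := hAdv h f hf.1 f₀ hf₀ f₁ hf₁ g₁ hg₁ V hV hclose
  rw [← hσ] at h1 h2
  set w := wnormSq (pairs D h) σ (fun z => f z - f₀ z) with hw
  have hw0 : 0 ≤ w := wnormSq_nonneg _ _ _
  -- the range term of the Bernstein bound is of lower order, by coverage
  have hsup : (⨆ z, |f z - f₀ z|) ≤ 2 * s * (2 * H * √w) := by
    have h3 : wnormSq (pairs D h) (fun _ => 1) (fun z => f z - f₀ z) ≤ (2 * H * √w) ^ 2 := by
      rw [mul_pow (2 * (H : ℝ)), Real.sq_sqrt hw0, hw, wnormSq, wnormSq, Finset.mul_sum]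
      refine Finset.sum_le_sum fun k _ => ?_
      have h4 := hσ0 (pairs D h k)
      rw [one_pow, div_one, one_mul, ← mul_assoc, mul_one_div]
      refine le_mul_of_one_le_left (sq_nonneg _) ?_
      rw [one_le_div (by positivity)]
      exact hσ2 _
    rcases isEmpty_or_nonempty (S × A) with he | hne
    · rw [Real.iSup_of_isEmpty]; positivity
    · exact ciSup_le fun z => hR.abs_sub_le hcov h hf.1 hf₀ (by positivity) h3 z
  have hrange : 16 * a ^ 2 * (H * ⨆ z, |f z - f₀ z|) ≤ w / 16 + a ^ 2 := by
    have h3 : 128 * (H ^ 2 * (s * b)) ≤ 1 :=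
      hR.mul_le_one (n := 2) (by norm_num) (by norm_num) (by linarith [hR.ge_226])
    have h4 : 128 * (H ^ 2 * (s * a)) ≤ 1 := by
      refine le_trans ?_ h3
      have := hR.a_le_b
      gcongr
    calc 16 * a ^ 2 * (H * ⨆ z, |f z - f₀ z|)
        ≤ 16 * a ^ 2 * (H * (2 * s * (2 * H * √w))) := by gcongr
      _ = (128 * (H ^ 2 * (s * a))) * (a * √w / 2) := by ring
      _ ≤ 1 * (a * √w / 2) := by gcongr
      _ ≤ w / 16 + a ^ 2 := by
          nlinarith [Real.sq_sqrt hw0, sq_nonneg (√w / 4 - a)]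
  have hab : 4 * (a / b) ^ 2 * (16 * b ^ 2) = 64 * a ^ 2 := by field_simp; norm_num
  have hVs := hR.optimal.measurable_optValue (h + 1)
  have hVsb := hR.optimal.optValue_mem (h + 1)
  have hnoise := hf.wnormSq_sub_le hf₀ hσ0 hf₀T hR.K_mul_eps_sq (Q := 1089 * a ^ 2) (by
    rw [hab] at h2
    have h3 : ∑ k, 1 / σ (pairs D h k) ^ 2 * (f (pairs D h k) - f₀ (pairs D h k)) *
        (M.r h (pairs D h k) + V (nexts D h k) - M.bellman h V (pairs D h k)) =
        ∑ k, 1 / σ (pairs D h k) ^ 2 * (f (pairs D h k) - f₀ (pairs D h k)) *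
          (M.optValue (h + 1) (nexts D h k) -
            M.expNext h (M.optValue (h + 1)) (pairs D h k)) +
        ∑ k, 1 / σ (pairs D h k) ^ 2 * (f (pairs D h k) - f₀ (pairs D h k)) *
          ((V (nexts D h k) - M.optValue (h + 1) (nexts D h k)) -
            M.expNext h (fun s => V s - M.optValue (h + 1) s) (pairs D h k)) := by
      rw [← Finset.sum_add_distrib]
      refine Finset.sum_congr rfl fun k _ => ?_
      have h4 : M.expNext h (fun s => V s - M.optValue (h + 1) s) (pairs D h k) =
          M.expNext h V (pairs D h k) - M.expNext h (M.optValue (h + 1)) (pairs D h k) :=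
        integral_sub (integrable_of_mem_Icc _ hVm hVH) (integrable_of_mem_Icc _ hVs hVsb)
      rw [h4, M.bellman_eq h hVm hVH]
      ring
    rw [h3]
    linarith)
  rw [hsymm]
  linarith

end Phases

/-! ### The suboptimality bound on the good events -/

section Conclusion

variable {S : Type u} {A : Type v} [MeasurableSpace S] [MeasurableSpace A]
  {H : ℕ} {M : MDP S A H} {πstar : Policy S A} {F : ℕ → Finset (S × A → ℝ)}
  {W : Finset (S × A → ℝ)} {C lam L eps κ : ℝ} {K : ℕ} {s a b : ℝ}

lemma measurable_div {F : Finset (S × A → ℝ)} (hF : ∀ f ∈ F, Measurable f)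
    (zs : Fin K → S × A) (σ : S × A → ℝ) (lam : ℝ) : Measurable (div F zs σ lam) := by
  have h1 : Measurable (divSq F zs σ lam) := by
    unfold divSq
    refine Measurable.biSup (F : Set (S × A → ℝ)) F.countable_toSet fun f₁ hf₁ => ?_
    refine Measurable.biSup (F : Set (S × A → ℝ)) F.countable_toSet fun f₂ hf₂ => ?_
    have h1 := hF f₁ hf₁
    have h2 := hF f₂ hf₂
    fun_prop
  exact h1.pow_const _

/-- The constant in front of the final bound. -/
def regretConst (C lam : ℝ) : ℝ := C * (1000 + 408 * √lam) + (12 + 8 * √lam)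

/-- Completeness at the value functions `0` and `1` provides two functions of the class at distance
about one, so the approximation error `ε` is dominated by the divergence. -/
lemma Regime.ofReal_eps_le (hR : Regime M πstar F W C lam L eps κ K s a b)
    (zs : Fin K → S × A) {σ : S × A → ℝ} (hσ : ∀ z, 1 ≤ σ z) {h : ℕ} (hh : h < H) (z : S × A) :
    ENNReal.ofReal eps ≤ ENNReal.ofReal (3 + 2 * √lam) * div (F h) zs σ lam z := by
  have hH := hR.one_le_H'
  obtain ⟨⟨f₀, hf₀, hf₀T⟩, -⟩ := hR.complete h hh (fun _ => 0) measurable_const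
    fun _ => ⟨le_rfl, by linarith⟩
  obtain ⟨⟨f₁, hf₁, hf₁T⟩, -⟩ := hR.complete h hh (fun _ => 1) measurable_const
    fun _ => ⟨zero_le_one, hH⟩
  have heps : eps ≤ 1 / 4 := by
    have h1 : 8 * ((H : ℝ) ^ 0 * (s * b)) ≤ 1 :=
      hR.mul_le_one (by norm_num) (by norm_num) (by linarith [hR.ge_226])
    linarith [hR.eps_le, hR.s_le]
  refine ofReal_le_mul_div hR.lam_nonneg hR.eps_pos.le hR.K_mul_eps_sq hR.one_le_K hσ hf₁ hf₀
    (fun z => ?_) z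
  have h0 := abs_le.1 (hf₀T z)
  have h1 := abs_le.1 (hf₁T z)
  have e0 : M.bellman h (fun _ => 0) z = M.r h z := by simp [MDP.bellman]
  have e1 : M.bellman h (fun _ => 1) z = M.r h z + 1 := by simp [MDP.bellman]
  rw [e0] at h0
  rw [e1] at h1
  constructor <;> linarith [h0.1, h0.2, h1.1, h1.2]

/-- The width of the planning phase is dominated by the divergence with the optimal weights. -/
lemma Regime.ofReal_width_le (hR : Regime M πstar F W C lam L eps κ K s a b) (h : Fin H)
    {zs : Fin K → S × A} {σ f₀ bon : S × A → ℝ} (hσ : ∀ z, 1 ≤ σ z)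
    (hσ2 : ∀ z, σ z ^ 2 ≤ 4 * M.truncVar h z)
    (hbon : IsBonus (F h) W C lam eps (100 * a) zs σ f₀ bon) (hf₀ : f₀ ∈ F h) (z : S × A) :
    ENNReal.ofReal (2 * bon z + 2 * eps) ≤
      ENNReal.ofReal (regretConst C lam * a) * div (F h) zs (fun z => √(M.truncVar h z)) lam z := by
  have hC := hR.C_pos
  have ha : 0 < a := by linarith [hR.a_ge]
  have hl := Real.sqrt_nonneg lam
  have hτ1 : ∀ z, 1 ≤ M.truncVar h z := fun z => le_max_left _ _
  have hτ : ∀ z, 1 ≤ √(M.truncVar h z) := fun z => Real.one_le_sqrt.2 (hτ1 z)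
  set d := div (F h) zs (fun z => √(M.truncVar h z)) lam z with hd
  have h1 : div (F h) zs σ lam z ≤ 2 * d := div_le_two_mul_div hR.lam_nonneg hσ hτ (fun z => by
    rw [Real.sq_sqrt (zero_le_one.trans (hτ1 z))]; exact hσ2 z) z
  have h2 := hR.ofReal_eps_le zs hτ h.2 z
  have h3 : √((100 * a) ^ 2 + lam) ≤ (100 + 2 * √lam) * a := by
    have := sqrt_sq_add_le (x := 100 * a) (by positivity) hR.lam_nonneg
    nlinarith [hR.a_ge]
  have h4 : ENNReal.ofReal (bon z) ≤
      ENNReal.ofReal (C * (2 * ((100 + 2 * √lam) * a) + (3 + 2 * √lam) * (100 * a))) * d := by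
    calc ENNReal.ofReal (bon z) ≤ ENNReal.ofReal C * (div (F h) zs σ lam z *
          ENNReal.ofReal (√((100 * a) ^ 2 + lam)) + ENNReal.ofReal (eps * (100 * a))) :=
          hbon.upper z
      _ ≤ ENNReal.ofReal C * (2 * d * ENNReal.ofReal ((100 + 2 * √lam) * a) +
          ENNReal.ofReal (3 + 2 * √lam) * d * ENNReal.ofReal (100 * a)) := by
          rw [ENNReal.ofReal_mul hR.eps_pos.le]
          gcongr
      _ = _ := by
          rw [ENNReal.ofReal_mul hC.le,
            ENNReal.ofReal_add (p := 2 * ((100 + 2 * √lam) * a)) (by positivity) (by positivity),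
            ENNReal.ofReal_mul (p := 2) (by norm_num),
            ENNReal.ofReal_mul (p := 3 + 2 * √lam) (by positivity), ENNReal.ofReal_ofNat]
          ring
  have hb0 : 0 ≤ bon z := hbon.nonneg hf₀ z
  calc ENNReal.ofReal (2 * bon z + 2 * eps)
      = 2 * ENNReal.ofReal (bon z) + 2 * ENNReal.ofReal eps := by
        rw [ENNReal.ofReal_add (by positivity) (by linarith [hR.eps_pos]),
          ENNReal.ofReal_mul (by norm_num), ENNReal.ofReal_mul (by norm_num), ENNReal.ofReal_ofNat]
    _ ≤ 2 * (ENNReal.ofReal (C * (2 * ((100 + 2 * √lam) * a) + (3 + 2 * √lam) * (100 * a))) * d) +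
        2 * (ENNReal.ofReal (3 + 2 * √lam) * d) := by gcongr
    _ = ENNReal.ofReal (2 * (C * (2 * ((100 + 2 * √lam) * a) + (3 + 2 * √lam) * (100 * a))) +
        2 * (3 + 2 * √lam)) * d := by
        rw [ENNReal.ofReal_add (q := 2 * (3 + 2 * √lam)) (by positivity) (by positivity),
          ENNReal.ofReal_mul (p := 2) (by norm_num), ENNReal.ofReal_mul (p := 2) (by norm_num),
          ENNReal.ofReal_ofNat]
        ring
    _ ≤ _ := by
        refine mul_le_mul_left (ENNReal.ofReal_le_ofReal ?_) _
        unfold regretConst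
        nlinarith [hR.a_ge]

variable [Fintype A] [Nonempty A]
  {βbar β : ℕ → ℝ} {Dbar D : Fin K → Fin (H + 1) → S × A} {R : Run S A}

/-- The planning phase: on the good events every output policy satisfies the suboptimality bound. -/
lemma Regime.suboptimality_le [MeasurableSingletonClass A]
    (hR : Regime M πstar F W C lam L eps κ K s a b)
    (hrun : IsRun M F W C lam eps βbar β (H ^ 3 * (s * b)) Dbar D R)
    (hcovbar : EmpiricalCoverage F κ Dbar) (hN : VarianceNoise M F W eps (16 * b ^ 2) Dbar)
    (hcov : EmpiricalCoverage F κ D)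
    (hRef : ReferenceNoise M F (H ^ 3 * (s * b)) (16 * a ^ 2) D)
    (hAdv : AdvantageNoise M F W eps (H ^ 3 * (s * b)) (a / b) (16 * b ^ 2) D)
    (hβbar : ∀ h < H, 13 * b * H ≤ βbar h ∧ βbar h ≤ 13 * b * H ^ 2)
    (hβ : ∀ h < H, β h = 100 * a) {πhat : Policy S A} (hout : R.IsOutput H πhat) (x : S) :
    ENNReal.ofReal (M.optValue 0 x - M.value πhat 0 x) ≤
      ENNReal.ofReal (regretConst C lam * a) * ∑ h : Fin H, ∫⁻ τ,
        div (F h) (pairs D h) (fun z => √(M.truncVar h z)) lam (τ h.castSucc)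
          ∂(M.episodeLaw πstar (Measure.dirac x)) := by
  have hH := hR.one_le_H'
  have hs := hR.s_pos
  have hb := hR.b_pos
  have ha : 0 < a := by linarith [hR.a_ge]
  have hC := hR.C_pos
  have hl := Real.sqrt_nonneg lam
  have hpc := planConst_pos (lam := lam) hC
  have hσ := hR.sigmaHat_comparable hrun hcovbar hN hβbar
  have hτH : ∀ (h : Fin H) z, M.truncVar h z ≤ (H : ℝ) ^ 2 := fun h z =>
    max_le (one_le_pow₀ hH) (M.condVar_le_sq h z (hR.optimal.measurable_optValue _)
      (hR.optimal.optValue_mem _))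
  have hσH : ∀ (h : Fin H) z,
      sigmaOf (H ^ 3 * (s * b)) (R.fbar h) (R.gbar h) z ^ 2 ≤ (2 * (H : ℝ)) ^ 2 := fun h z => by
    have h1 := (hσ h z).2
    have h2 := hτH h z
    linarith
  have hvc : ∀ h ≤ H, maxA (R.fhat h) ∈ valueClass H F W eps h := fun h hh =>
    maxA_mem_valueClass hrun.fhat_last (fun h => (hrun.ftilde_spec h).1)
      (fun h => (hrun.b_spec h).mem) hrun.fhat_spec hh
  have hbon : ∀ h : Fin H, IsBonus (F h) W C lam eps (100 * a) (pairs D h)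
      (sigmaOf (H ^ 3 * (s * b)) (R.fbar h) (R.gbar h)) (R.ftilde h) (R.b h) := fun h => by
    rw [← hβ h h.2]; exact hrun.b_spec h
  -- one step of the backward induction, given that the next stage is close to optimal
  have hstep : ∀ h : Fin H, (∀ x, |maxA (R.fhat (h + 1)) x - M.optValue (h + 1) x| ≤ a / b) →
      ∀ z, R.fhat h z ≤ M.bellman h (maxA (R.fhat (h + 1))) z ∧
        M.bellman h (maxA (R.fhat (h + 1))) z ≤ R.fhat h z + (2 * R.b h z + 2 * eps) := by
    intro h hclose z
    obtain ⟨f₀, hf₀, hf₀T, hw⟩ := hR.planning_regression hcov hRef hAdv h (hvc (h + 1) h.2) hclose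
      (hrun.fbar_spec h).1 (hrun.gbar_spec h).1 (fun z => (hσ h z).1) (hσH h)
      (hrun.ftilde_spec h)
    exact hR.pessimistic_of_bonus h (hvc (h + 1) h.2) (hrun.ftilde_spec h).1 hf₀ hf₀T (hbon h) hw
      (hrun.fhat_spec h) z
  have hwidth : ∀ (h : Fin H) z, 2 * R.b h z + 2 * eps ≤ planConst C lam * (H * (s * a)) := by
    intro h z
    have h1 := (hbon h).le_of_div_le hC.le (d := 2 * s * (2 * H)) (by positivity)
      hR.eps_pos.le (by positivity)
      (hR.div_le hcov h (one_le_sigmaOf _ _ _) (hσH h) (by positivity) z)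
    have h2 := sqrt_sq_add_le (x := 100 * a) (by positivity) hR.lam_nonneg
    have e1 : s * a ≤ H * (s * a) := le_mul_of_one_le_left (by positivity) hH
    have e2 : s ≤ 2 * (s * a) := by nlinarith [hR.a_ge]
    have h3 : 2 * s * (2 * H) * √((100 * a) ^ 2 + lam) + eps * (100 * a) ≤
        (500 + 8 * √lam) * (H * (s * a)) := by
      calc _ ≤ 2 * s * (2 * H) * (100 * a + √lam) + s * (100 * a) := by
            gcongr
            exact hR.eps_le
        _ = 400 * (H * (s * a)) + 4 * √lam * (H * s) + 100 * (s * a) := by ring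
        _ ≤ 400 * (H * (s * a)) + 4 * √lam * (H * (2 * (s * a))) + 100 * (H * (s * a)) := by
            gcongr
        _ = _ := by ring
    have h4 := h1.trans (mul_le_mul_of_nonneg_left h3 hC.le)
    have h5 := hR.eps_le
    unfold planConst
    linarith
  have hHy : H * (planConst C lam * (H * (s * a))) ≤ a / b := by
    have h1 := hR.mul_le_one (n := 2) (by norm_num) (c := planConst C lam) hpc.le
      (by have := varConst_pos (lam := lam) hC; unfold rateConst; linarith)
    rw [le_div_iff₀ hb]
    calc H * (planConst C lam * (H * (s * a))) * b =
          (planConst C lam * (H ^ 2 * (s * b))) * a := by ring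
      _ ≤ 1 * a := by gcongr
      _ = a := one_mul a
  have hclose : ∀ h ≤ H, ∀ x, maxA (R.fhat h) x ≤ M.optValue h x ∧
      |maxA (R.fhat h) x - M.optValue h x| ≤ a / b := fun h hh x => by
    have h1 := hR.estimate_close hvc hrun.fhat_last (y := planConst C lam * (H * (s * a)))
      (by positivity) (fun h hcl z => by
        have h1 := hstep h (fun x => (hcl x).trans hHy) z
        exact ⟨h1.1, h1.2.trans (by linarith [hwidth h z])⟩) hh x
    exact ⟨h1.1, h1.2.trans hHy⟩
  have hdm : ∀ h : Fin H, Measurable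
      (div (F h) (pairs D h) (fun z => √(M.truncVar h z)) lam) := fun h =>
    measurable_div (fun f hf => (hR.class_spec h h.2 f hf).1) _ _ _
  have hmain := hR.optimal.suboptimality_le (πhat := πhat) (f := R.fhat)
    (fun h hh => (hR.valueClass_spec hh (hvc h hh)).1)
    (fun h hh => (hR.valueClass_spec hh (hvc h hh)).2.2)
    (fun x => by rw [hrun.fhat_last, maxA_zero])
    (fun h hh x => (hclose h hh x).1) (y := fun h z => 2 * R.b h z + 2 * eps)
    (fun h hh => hstep ⟨h, hh⟩ fun x => (hclose (h + 1) hh x).2) hout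
    (g := fun h z => ENNReal.ofReal (regretConst C lam * a) *
      div (F h) (pairs D h) (fun z => √(M.truncVar h z)) lam z)
    (fun h => (hdm h).const_mul _)
    (fun h z => hR.ofReal_width_le h (one_le_sigmaOf _ _ _) (fun z => (hσ h z).2) (hbon h)
      (hrun.ftilde_spec h).1 z) x
  refine hmain.trans (le_of_eq ?_)
  rw [Finset.mul_sum]
  refine Finset.sum_congr rfl fun h _ => ?_
  exact lintegral_const_mul _ ((hdm h).comp (measurable_pi_apply _))

end Conclusion

/-! ### The sample size and the probability of the good events -/

section Probability

variable {S : Type u} {A : Type v} [MeasurableSpace S] [MeasurableSpace A]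
  {H : ℕ} {M : MDP S A H} {F : ℕ → Finset (S × A → ℝ)}

/-- Two distinct bounded functions in some class force the coverage constant to be at most one. -/
lemma MDP.Coverage.le_one {μ : Policy S A} {ρ : Measure S} [IsProbabilityMeasure ρ] {κ L : ℝ}
    (hcov : M.Coverage μ ρ F κ)
    (hF : ∀ h < H, ∀ f ∈ F h, Measurable f ∧ ∀ z, f z ∈ Set.Icc 0 L)
    (hN : 2 ≤ complexity H F) : κ ≤ 1 := by
  obtain ⟨h, -, hh⟩ : ∃ h ∈ (Finset.univ : Finset (Fin H)), 1 < (F h).card := by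
    have h1 : 1 < Finset.univ.sup fun h : Fin H => (F h).card := hN
    rwa [Finset.lt_sup_iff] at h1
  obtain ⟨f₁, hf₁, f₂, hf₂, hne⟩ := Finset.one_lt_card.1 hh
  have hle := abs_sub_le_iSup (hF h h.2 f₁ hf₁).2 (hF h h.2 f₂ hf₂).2
  obtain ⟨z, hz⟩ := Function.ne_iff.1 hne
  have h1 := hcov h f₁ hf₁ f₂ hf₂
  set m := ⨆ z, |f₁ z - f₂ z|
  have hm : 0 < m := (abs_pos.2 (sub_ne_zero.2 hz)).trans_le (hle z)
  have h2 : ∀ z, (f₁ z - f₂ z) ^ 2 ∈ Set.Icc 0 (m ^ 2) := fun z =>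
    ⟨sq_nonneg _, by rw [← sq_abs]; exact pow_le_pow_left₀ (abs_nonneg _) (hle z) 2⟩
  have h3 : ∫ z, (f₁ z - f₂ z) ^ 2 ∂(M.stageLaw μ ρ h) ≤ m ^ 2 := by
    have hmeas : Measurable fun z => (f₁ z - f₂ z) ^ 2 :=
      ((hF h h.2 f₁ hf₁).1.sub (hF h h.2 f₂ hf₂).1).pow_const 2
    simpa using integral_mono (integrable_of_mem_Icc (M.stageLaw μ ρ h) hmeas h2)
      (integrable_const (m ^ 2)) fun z => (h2 z).2
  have h4 : κ * m ^ 2 ≤ 1 * m ^ 2 := by linarith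
  exact le_of_mul_le_mul_right h4 (by positivity)

lemma card_sigma_le {T : Fin H → Type*} {I : ∀ h, Finset (T h)} {n : ℕ} (hI : ∀ h, (I h).card ≤ n) :
    ((Finset.univ : Finset (Fin H)).sigma I).card ≤ H * n := by
  rw [Finset.card_sigma]
  simpa using Finset.sum_le_card_nsmul Finset.univ (fun h => (I h).card) n fun h _ => hI h

end Probability

section Probability

variable {S : Type u} {A : Type v} [MeasurableSpace S] [MeasurableSpace A]
  {H : ℕ} {M : MDP S A H} {F : ℕ → Finset (S × A → ℝ)}

variable {K : ℕ} {μ : Policy S A}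
  {ρ : Measure S} [IsProbabilityMeasure ρ] {W : Finset (S × A → ℝ)} {C lam L eps κ δ : ℝ}
  {πstar : Policy S A}

lemma one_le_logFactor (hδ : 0 < δ) (hδ1 : δ < 1) : 1 ≤ logFactor H K δ := by
  rw [logFactor]
  rcases Nat.eq_zero_or_pos (H * K) with h0 | h0
  · -- without stages or episodes the logarithm is that of zero
    have h0' : (H : ℝ) * K = 0 := by exact_mod_cast h0
    simp [h0']
  · have h1 : (1 : ℝ) ≤ (H : ℝ) * K := by exact_mod_cast h0
    have : 0 ≤ Real.log ((H : ℝ) * K / δ) := Real.log_nonneg (by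
      rw [le_div_iff₀ hδ]; linarith)
    linarith

/-- The lower bound on the number of episodes puts the analysis in its regime. -/
lemma regime_of_le (hC : 0 < C) (hlam : 0 ≤ lam) (hH : 1 ≤ H) (heps : 0 < eps) (hκ : 0 < κ)
    (hδ : 0 < δ) (hδ1 : δ < 1)
    (hF : ∀ h < H, ∀ f ∈ F h, Measurable f ∧ ∀ z, f z ∈ Set.Icc 0 L)
    (hW : ∀ b ∈ W, Measurable b) (hN : 2 ≤ complexity H F) (hcomp : M.Complete F eps)
    (hepsK : eps ≤ 1 / √(K : ℝ)) (hcov : M.Coverage μ ρ F κ) (hWne : W.Nonempty)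
    (hK : rateConst C lam ^ 2 * logFactor H K δ *
      (Real.log ((complexity H F : ℝ) * W.card) * (H : ℝ) ^ 6 / κ ^ 2) ≤ K)
    (hopt : M.IsOptimal πstar) :
    Regime M πstar F W C lam L eps κ K (1 / √(K * κ))
      (√(logFactor H K δ * Real.log (complexity H F)))
      (√(logFactor H K δ * Real.log ((complexity H F : ℝ) * W.card))) := by
  have hℓ := one_le_logFactor (H := H) (K := K) hδ hδ1
  have hN' : (2 : ℝ) ≤ complexity H F := by exact_mod_cast hN
  have hw1 : (1 : ℝ) ≤ W.card := by exact_mod_cast hWne.card_pos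
  have hlogN : 0.69 ≤ Real.log (complexity H F) := by
    have := Real.log_le_log (by norm_num) hN'
    linarith [Real.log_two_gt_d9]
  have hlogNW : Real.log (complexity H F) ≤ Real.log ((complexity H F : ℝ) * W.card) :=
    Real.log_le_log (by linarith) (le_mul_of_one_le_right (by linarith) hw1)
  have hκ1 := hcov.le_one hF hN
  have hH' : (1 : ℝ) ≤ H := by exact_mod_cast hH
  have hrc : 0 < rateConst C lam := by
    have := varConst_pos (lam := lam) hC
    have := planConst_pos (lam := lam) hC
    unfold rateConst
    positivity
  have hlB : 0 < Real.log ((complexity H F : ℝ) * W.card) := by linarith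
  have hK0 : (0 : ℝ) < K := lt_of_lt_of_le (by positivity) hK
  have hKκ : 0 < (K : ℝ) * κ := by positivity
  have hsK : 0 < √(K : ℝ) := Real.sqrt_pos.2 hK0
  refine
    { one_le_H := hH
      one_le_K := Nat.one_le_iff_ne_zero.2 fun h => by simp [h] at hK0
      C_pos := hC
      lam_nonneg := hlam
      eps_pos := heps
      eps_le := hepsK.trans ?_
      K_mul_eps_sq := ?_
      s_pos := by positivity
      s_sq := ?_
      a_ge := ?_
      a_le_b := ?_
      rate := ?_
      optimal := hopt
      class_spec := hF
      bonus_measurable := hW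
      complete := hcomp }
  · exact one_div_le_one_div_of_le (Real.sqrt_pos.2 hKκ)
      (Real.sqrt_le_sqrt (mul_le_of_le_one_right hK0.le hκ1))
  · calc (K : ℝ) * eps ^ 2 ≤ K * (1 / √(K : ℝ)) ^ 2 := by gcongr
      _ = 1 := by rw [div_pow, Real.sq_sqrt hK0.le]; field_simp
  · rw [div_pow, Real.sq_sqrt hKκ.le]; field_simp
  · rw [Real.le_sqrt' (by norm_num)]
    nlinarith
  · exact Real.sqrt_le_sqrt (by gcongr)
  · set B := logFactor H K δ * Real.log ((complexity H F : ℝ) * W.card) with hB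
    have hB0 : 0 < B := by positivity
    have h1 : B * (H : ℝ) ^ 6 * rateConst C lam ^ 2 ≤ K * κ := by
      have h2 : rateConst C lam ^ 2 * B * (H : ℝ) ^ 6 ≤ K * κ ^ 2 := by
        rw [← div_le_iff₀ (by positivity)]
        refine le_trans (le_of_eq ?_) hK
        rw [hB]; ring
      have h3 : (K : ℝ) * κ ^ 2 ≤ K * κ := by
        gcongr
        nlinarith
      linarith
    refine (abs_le_of_sq_le_sq' ?_ zero_le_one).2
    rw [mul_pow, mul_pow, mul_pow, div_pow, Real.sq_sqrt hKκ.le, Real.sq_sqrt hB0.le]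
    calc 1 ^ 2 / ((K : ℝ) * κ) * B * ((H : ℝ) ^ 3) ^ 2 * rateConst C lam ^ 2
        = (B * (H : ℝ) ^ 6 * rateConst C lam ^ 2) / (K * κ) := by ring
      _ ≤ 1 ^ 2 := by rw [one_pow]; exact div_le_one_of_le₀ h1 hKκ.le

variable {Ω : Type w} [MeasurableSpace Ω] {Pr : Measure Ω} [Fintype A] [Nonempty A]

/-- All the good events hold simultaneously with probability at least `1 - δ`. -/
lemma Regime.exists_event (hR : Regime M πstar F W C lam L eps κ K (1 / √(K * κ))
      (√(logFactor H K δ * Real.log (complexity H F)))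
      (√(logFactor H K δ * Real.log ((complexity H F : ℝ) * W.card))))
    (hδ : 0 < δ) (hδ1 : δ < 1) (hN : 2 ≤ complexity H F) (hWne : W.Nonempty)
    (hcov : M.Coverage μ ρ F κ)
    {X : Fin K ⊕ Fin K → Ω → Fin (H + 1) → S × A} (hX : ∀ i, Measurable (X i))
    (hind : iIndepFun X Pr) (hlaw : ∀ i, Pr.map (X i) = M.episodeLaw μ ρ) (pert : ℝ) {η ΛA ΛB : ℝ}
    (hη : 0 < η) (hΛA : ΛA = 16 * (logFactor H K δ * Real.log (complexity H F)))
    (hΛB : ΛB = 16 * (logFactor H K δ * Real.log ((complexity H F : ℝ) * W.card)))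
    (hΛK : ΛB ≤ K * κ / 4) :
    ∃ G : Set Ω, MeasurableSet G ∧ Pr Gᶜ ≤ ENNReal.ofReal δ ∧ ∀ ω ∈ G,
      (EmpiricalCoverage F κ (fun k => X (Sum.inr k) ω) ∧
        VarianceNoise M F W eps ΛB (fun k => X (Sum.inr k) ω)) ∧
      EmpiricalCoverage F κ (fun k => X (Sum.inl k) ω) ∧
      ReferenceNoise M F pert ΛA (fun k => X (Sum.inl k) ω) ∧
      AdvantageNoise M F W eps pert η ΛB (fun k => X (Sum.inl k) ω) := by
  set N := complexity H F with hNdef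
  have hw1 : 1 ≤ W.card := hWne.card_pos
  have hNW : 1 ≤ N * W.card := one_le_mul (by omega) hw1
  have hN' : (2 : ℝ) ≤ N := by exact_mod_cast hN
  have hM' : (2 : ℝ) ≤ (N : ℝ) * W.card := by
    have : 2 ≤ N * W.card := hN.trans (Nat.le_mul_of_pos_right N hw1)
    exact_mod_cast this
  have hNM : N ≤ N * W.card := Nat.le_mul_of_pos_right N hw1
  have hcF : ∀ h : Fin H, (F h).card ≤ N := fun h => card_le_complexity F h.2
  have hcV : ∀ h : Fin H, (valueClass H F W eps (h + 1)).card ≤ N * W.card := fun h =>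
    card_valueClass_le hNW eps _
  have hFm : ∀ h < H, ∀ f ∈ F h, Measurable f := fun h hh f hf => (hR.class_spec h hh f hf).1
  -- a union over at most `H M ^ 5` events
  have hcount : ∀ {Λ : ℝ} {n m : ℕ}, 2 ≤ (m : ℝ) → Λ = 16 * (logFactor H K δ * Real.log m) →
      n ≤ H * m ^ 5 → n * Real.exp (-Λ) ≤ δ / 6 := by
    intro Λ n m hm hΛ hn
    rw [hΛ]
    exact mul_exp_le hR.one_le_H hR.one_le_K hδ hδ1 hm (by exact_mod_cast hn)
  have hΛB' : ΛB = 16 * (logFactor H K δ * Real.log ((N * W.card : ℕ) : ℝ)) := by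
    rw [hΛB]; push_cast; rfl
  have hMB : (2 : ℝ) ≤ ((N * W.card : ℕ) : ℝ) := by push_cast; exact hM'
  have hpow : ∀ {j : ℕ}, j ≤ 5 → (N * W.card) ^ j ≤ (N * W.card) ^ 5 := fun hj =>
    Nat.pow_le_pow_right (by omega) hj
  have hc2 : ((Finset.univ : Finset (Fin H)).sigma fun h => F h ×ˢ F h).card *
      Real.exp (-ΛB) ≤ δ / 6 := by
    refine hcount hMB hΛB' (card_sigma_le fun h => ?_)
    rw [Finset.card_product]
    calc (F h).card * (F h).card ≤ (N * W.card) * (N * W.card) :=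
          Nat.mul_le_mul ((hcF h).trans hNM) ((hcF h).trans hNM)
      _ = (N * W.card) ^ 2 := by ring
      _ ≤ _ := hpow (by norm_num)
  have hc3 : ((Finset.univ : Finset (Fin H)).sigma fun h => F h ×ˢ F h ×ˢ
      valueClass H F W eps (h + 1)).card * Real.exp (-ΛB) ≤ δ / 6 := by
    refine hcount hMB hΛB' (card_sigma_le fun h => ?_)
    rw [Finset.card_product, Finset.card_product]
    calc _ ≤ (N * W.card) * ((N * W.card) * (N * W.card)) :=
          Nat.mul_le_mul ((hcF h).trans hNM) (Nat.mul_le_mul ((hcF h).trans hNM) (hcV h))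
      _ = (N * W.card) ^ 3 := by ring
      _ ≤ _ := hpow (by norm_num)
  have hc5 : ((Finset.univ : Finset (Fin H)).sigma fun h => F h ×ˢ F h ×ˢ F h ×ˢ F h ×ˢ
      valueClass H F W eps (h + 1)).card * Real.exp (-ΛB) ≤ δ / 6 := by
    refine hcount hMB hΛB' (card_sigma_le fun h => ?_)
    simp only [Finset.card_product]
    calc _ ≤ (N * W.card) * ((N * W.card) * ((N * W.card) * ((N * W.card) * (N * W.card)))) :=
          Nat.mul_le_mul ((hcF h).trans hNM) (Nat.mul_le_mul ((hcF h).trans hNM)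
            (Nat.mul_le_mul ((hcF h).trans hNM) (Nat.mul_le_mul ((hcF h).trans hNM) (hcV h))))
      _ = (N * W.card) ^ 5 := by ring
  have hc4 : ((Finset.univ : Finset (Fin H)).sigma fun h => F h ×ˢ F h ×ˢ F h ×ˢ F h).card *
      Real.exp (-ΛA) ≤ δ / 6 := by
    refine hcount hN' hΛA (card_sigma_le fun h => ?_)
    simp only [Finset.card_product]
    calc _ ≤ N * (N * (N * N)) :=
          Nat.mul_le_mul (hcF h) (Nat.mul_le_mul (hcF h) (Nat.mul_le_mul (hcF h) (hcF h)))
      _ = N ^ 4 := by ring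
      _ ≤ _ := Nat.pow_le_pow_right (by omega) (by norm_num)
  have hXl : ∀ k, Measurable (X (Sum.inl k)) := fun k => hX _
  have hXr : ∀ k, Measurable (X (Sum.inr k)) := fun k => hX _
  have hil : iIndepFun (fun k => X (Sum.inl k)) Pr := hind.precomp Sum.inl_injective
  have hir : iIndepFun (fun k => X (Sum.inr k)) Pr := hind.precomp Sum.inr_injective
  have h6 : 0 ≤ δ / 6 := by positivity
  have hbar := exists_event_inter h6 (add_nonneg h6 h6)
    (exists_event_coverage hXr hir (fun k => hlaw _) hR.class_spec hcov hΛK hc2)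
    (exists_event_varianceNoise hR.one_le_H hXr hir (fun k => hlaw _) hFm hR.bonus_measurable h6
      hc3)
  have hmain := exists_event_inter h6 (add_nonneg h6 h6)
    (exists_event_coverage hXl hil (fun k => hlaw _) hR.class_spec hcov hΛK hc2)
    (exists_event_inter h6 h6
      (exists_event_referenceNoise (pert := pert) hXl hil (fun k => hlaw _) hR.class_spec
        hR.optimal.measurable_optValue hR.optimal.optValue_mem hc4)
      (exists_event_advantageNoise (pert := pert) hXl hil (fun k => hlaw _) hFm hR.bonus_measurable
        hR.optimal.measurable_optValue hη hc5))
  obtain ⟨G, hG, hPG, hGω⟩ := exists_event_inter (by positivity) (by positivity) hbar hmain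
  refine ⟨G, hG, hPG.trans (ENNReal.ofReal_le_ofReal (by linarith)), hGω⟩

end Probability

end OfflineRL

end

theorem theorem1 (C lam : ℝ) (hC : 0 < C) (hlam : 0 ≤ lam) :
    ∃ cK cBar cVar cBeta cReg : ℝ,
      0 < cK ∧ 0 < cBar ∧ 0 < cVar ∧ 0 < cBeta ∧ 0 < cReg ∧
      ∀ (S : Type u) (A : Type v) (Ω : Type w)
        [MeasurableSpace S] [MeasurableSpace A] [MeasurableSpace Ω]
        [Fintype A] [Nonempty A] [MeasurableSingletonClass A]
        (H K : ℕ) (M : OfflineRL.MDP S A H)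
        -- behavior policy and distribution of the initial state
        (μ : OfflineRL.Policy S A) (ρ : Measure S) [IsProbabilityMeasure ρ]
        -- the finite function classes and the finite bonus class
        (F : ℕ → Finset (S × A → ℝ)) (W : Finset (S × A → ℝ))
        (L eps κ δ : ℝ)
        -- the data: `2 K` independent episodes collected by the behavior policy
        (Pr : Measure Ω) [IsProbabilityMeasure Pr]
        (X : Fin K ⊕ Fin K → Ω → (Fin (H + 1) → S × A))
        -- the confidence parameters of the two phases
        (βbar β : ℕ → ℝ)
        (πstar : OfflineRL.Policy S A),
        1 ≤ H → 0 < eps → 0 < κ → 0 < δ → δ < 1 →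
        (∀ h < H, ∀ f ∈ F h, Measurable f ∧ ∀ z, f z ∈ Set.Icc 0 L) →
        (∀ b ∈ W, Measurable b) →
        2 ≤ OfflineRL.complexity H F →
        M.Complete F eps →
        eps ≤ 1 / √(K : ℝ) →
        M.Coverage μ ρ F κ →
        (∀ i, Measurable (X i)) →
        iIndepFun X Pr →
        (∀ i, Pr.map (X i) = M.episodeLaw μ ρ) →
        cK * OfflineRL.logFactor H K δ *
            (Real.log ((OfflineRL.complexity H F : ℝ) * W.card) * (H : ℝ) ^ 6 / κ ^ 2) ≤ K →
        (∀ h < H,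
          cBar * √(OfflineRL.logFactor H K δ *
              Real.log ((OfflineRL.complexity H F : ℝ) * W.card)) * (H : ℝ) ≤ βbar h ∧
          βbar h ≤ cBar * √(OfflineRL.logFactor H K δ *
              Real.log ((OfflineRL.complexity H F : ℝ) * W.card)) * (H : ℝ) ^ 2) →
        (∀ h < H, β h = cBeta * √(OfflineRL.logFactor H K δ *
              Real.log (OfflineRL.complexity H F : ℝ))) →
        M.IsOptimal πstar →
        ∃ G : Set Ω, MeasurableSet G ∧ ENNReal.ofReal (1 - δ) ≤ Pr G ∧
          ∀ ω ∈ G, ∀ (R : OfflineRL.Run S A) (πhat : OfflineRL.Policy S A),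
            OfflineRL.IsRun M F W C lam eps βbar β
              (cVar * (√(OfflineRL.logFactor H K δ *
                Real.log ((OfflineRL.complexity H F : ℝ) * W.card)) * (H : ℝ) ^ 3 / √(K * κ)))
              (fun k => X (Sum.inr k) ω) (fun k => X (Sum.inl k) ω) R →
            R.IsOutput H πhat →
            ∀ s : S,
              ENNReal.ofReal (M.optValue 0 s - M.value πhat 0 s) ≤
                ENNReal.ofReal (cReg * √(OfflineRL.logFactor H K δ *
                    Real.log (OfflineRL.complexity H F : ℝ))) *
                  ∑ h : Fin H, ∫⁻ τ,
                    OfflineRL.div (F h)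
                      (OfflineRL.pairs (fun k => X (Sum.inl k) ω) h)
                      (fun z => √(M.truncVar h z)) lam (τ h.castSucc)
                    ∂(M.episodeLaw πstar (Measure.dirac s)) := by
  -- `13 H` and `100` are the radii at which the regressions of the two phases are solved
  refine ⟨OfflineRL.rateConst C lam ^ 2, 13, 1, 100, OfflineRL.regretConst C lam, ?_, by norm_num,
    one_pos, by norm_num, ?_, ?_⟩
  · have := OfflineRL.varConst_pos (lam := lam) hC
    have := OfflineRL.planConst_pos (lam := lam) hC
    unfold OfflineRL.rateConst
    positivity
  · unfold OfflineRL.regretConst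
    positivity
  intro S A Ω _ _ _ _ _ _ H K M μ ρ _ F W L eps κ δ Pr _ X βbar β πstar hH heps hκ hδ hδ1 hF hW hN
    hcomp hepsK hcov hX hind hlaw hK hβbar hβ hopt
  -- an empty bonus class admits no run at all
  rcases W.eq_empty_or_nonempty with rfl | hWne
  · exact ⟨Set.univ, MeasurableSet.univ, by simp [hδ.le], fun ω _ R πhat hrun =>
      absurd (hrun.bbar_spec ⟨0, hH⟩).mem (Finset.notMem_empty _)⟩
  have hR := OfflineRL.regime_of_le hC hlam hH heps hκ hδ hδ1 hF hW hN hcomp hepsK hcov hWne hK hopt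
  set a := √(OfflineRL.logFactor H K δ * Real.log (OfflineRL.complexity H F : ℝ)) with ha
  set b := √(OfflineRL.logFactor H K δ *
    Real.log ((OfflineRL.complexity H F : ℝ) * W.card)) with hb
  have hb0 := hR.b_pos
  have ha0 : 0 < a := by linarith [hR.a_ge]
  have ha2 : a ^ 2 = OfflineRL.logFactor H K δ * Real.log (OfflineRL.complexity H F : ℝ) :=
    Real.sq_sqrt (Real.sqrt_pos.1 ha0).le
  have hb2 : b ^ 2 = OfflineRL.logFactor H K δ *
      Real.log ((OfflineRL.complexity H F : ℝ) * W.card) := Real.sq_sqrt (Real.sqrt_pos.1 hb0).le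
  have hs := hR.s_pos
  -- the sample size also pays for the union bound of the empirical coverage
  have hKκ : 16 * b ^ 2 ≤ K * κ / 4 := by
    have h1 := hR.mul_le_one (n := 0) (by norm_num) (c := 8) (by norm_num)
      (by linarith [hR.ge_226])
    rw [pow_zero, one_mul] at h1
    have h2 : (8 * (1 / √(K * κ) * b)) ^ 2 ≤ 1 := pow_le_one₀ (by positivity) h1
    have h3 : 0 ≤ (K : ℝ) * κ := by positivity
    have h4 : (8 * (1 / √(K * κ) * b)) ^ 2 * (K * κ) ≤ 1 * (K * κ) := by gcongr
    have h5 := hR.s_sq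
    have h6 : (8 * (1 / √(K * κ) * b)) ^ 2 * (K * κ) = 64 * b ^ 2 := by
      linear_combination (64 * b ^ 2) * h5
    linarith
  obtain ⟨G, hG, hPG, hGω⟩ := hR.exists_event hδ hδ1 hN hWne hcov hX hind hlaw
    (H ^ 3 * (1 / √(K * κ) * b)) (η := a / b) (ΛA := 16 * a ^ 2) (ΛB := 16 * b ^ 2)
    (by positivity) (by rw [ha2]) (by rw [hb2]) hKκ
  refine ⟨G, hG, ?_, fun ω hω R πhat hrun hout s => ?_⟩
  · rw [ENNReal.ofReal_sub _ hδ.le, ENNReal.ofReal_one, tsub_le_iff_right]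
    calc 1 = Pr G + Pr Gᶜ := (prob_add_prob_compl hG).symm
      _ ≤ _ := by gcongr
  · obtain ⟨⟨hcovbar, hN1⟩, hcovD, hRef, hAdv⟩ := hGω ω hω
    rw [show 1 * (b * (H : ℝ) ^ 3 / √(K * κ)) = H ^ 3 * (1 / √(K * κ) * b) by ring] at hrun
    exact hR.suboptimality_le hrun hcovbar hN1 hcovD hRef hAdv hβbar hβ hout s
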